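/- **Theorem (Pappus's hexagon theorem in $X$ space).** Let $X$ be one of $S^2\times\mathbb R$, $H^2\times\mathbb R$, $\mathrm{Sol}$, $\widetilde{SL_2\mathbb R}$. *Translation curves.* In $\mathrm{Sol}$ and $\widetilde{SL_2\mathbb R}$ a translation curve is a non-constant curve $\gamma:\mathbb R\to X$ whose velocity at each point is the image of one fixed tangent vector at the origin under the translation carrying the origin to that point. In $S^2\times\mathbb R$ and $H^2\times\mathbb R$ it is a non-constant geodesic $\gamma:\mathbb R\to X$. We use the models $\mathbb R^3\setminus\{0\}$ of $S^2\times\mathbb R$ and $\{x_0>0,\ x_0^2>x_1^2+x_2^2\}$ of $H^2\times\mathbb R$, where $(p,h)$ is the point $e^hp$; the fibres are the rays from $0$. A translation segment is an arc of a translation curve, or a point; in $S^2\times\mathbb R$ it is required to be a shortest geodesic. *Translation surfaces.* A translation triangle $T$ consists of three points of $X$ that are joined in pairs by translation segments and do not lie on one translation curve. Its translation surface $\mathcal S$ is the set of all $P\in X$ for which there are translation segments from $P$ to the three vertices whose tangents at $P$ are coplanar. There is one exception: if $X$ is $S^2\times\mathbb R$ or $H^2\times\mathbb R$ and the vertices of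 $T$ lie in a plane through $0$ ($T$ is *of fibre type*), then $\mathcal S$ is the intersection of $X$ with the linear span of the vertices (that is, with this plane). *Curves for $\mathcal S$.* If $X$ is $S^2\times\mathbb R$ or $H^2\times\mathbb R$ and $T$ is not of fibre type, then $\mathcal S$ does not in general contain the geodesics joining its points, and a translation curve for $\mathcal S$ means the projection along the fibres of such a geodesic into $\mathcal S$, that is, a section of $\mathcal S$ by a plane through $0$. In all other cases it is a translation curve of $X$. If $X=S^2\times\mathbb R$ and $T$ is of fibre type, then fix an open half-space $U$ whose boundary plane passes through $0$; a translation curve for $\mathcal S$ then means a connected arc (a component) of the part in $U$ of a translation curve of $X$. We write $g_{PQ}$ for the translation curve for $\mathcal S$ through $P$ and $Q$, if there is exactly one. *Statement.* Let $A_1,A_2,A_3\in\mathcal S$ be three different points on a translation curve $g_a$ for $\mathcal S$, and let $B_1,B_2,B_3\in\mathcal S$ be three different points on another translation curve $g_b$ for $\mathcal S$. Suppose that $g_{A_1B_1},g_{A_3B_2},g_{A_2B_2},g_{A_1B_3},g_{A_3B_3},g_{A_2B_1}$ are defined, and that there are points $$M_1\in g_{A_1B_1}\cap g_{A_3B_2},\qquad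 M_2\in g_{A_2B_2}\cap g_{A_1B_3},\qquad M_3\in g_{A_3B_3}\cap g_{A_2B_1}.$$ If $X=\widetilde{SL_2\mathbb R}$, suppose moreover that any two of $M_1,M_2,M_3$ lie on a common translation curve. Then $M_1,M_2,M_3$ all lie on one translation curve for $\mathcal S$. -/

import Mathlib

open scoped Matrix

/-- The Thurston geometries under consideration: `S² × ℝ`, `H² × ℝ`, `Sol` and the universal
cover of `SL₂(ℝ)`. -/
inductive ThurstonX
  | S2R
  | H2R
  | Sol
  | SL2

/-- Coordinate triples. Every geometry is modelled on a subset of `ℝ³`. -/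
abbrev Triple : Type := Fin 3 → ℝ

/-- The point set of the model.

* `S² × ℝ` is `ℝ³ ∖ {0}`: the pair `(p, h)` with `|p| = 1` is the point `eʰ p`.
* `H² × ℝ` is the open cone `x₀ > 0`, `x₀² > x₁² + x₂²`: the pair `(p, h)`, with `p` on the sheet
  `p₀² - p₁² - p₂² = 1`, `p₀ > 0`, is the point `eʰ p`.
  In these two models the fibres are the open rays from the origin of `ℝ³`, and the planes through
  the origin cut out the preimages of the geodesics of the base surface `S²` or `H²`.
* `Sol` is `ℝ³` with the group law
  `(a, b, c) (x, y, z) = (a + x e⁻ᶜ, b + y eᶜ, c + z)`.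
* The universal cover of `SL₂(ℝ)` is `ℝ³` with coordinates `(φ, y, z)`; see `sl2Cover`. -/
def ThurstonX.domain : ThurstonX → Set Triple
  | .S2R => {P | P ≠ 0}
  | .H2R => {P | 0 < P 0 ∧ P 1 ^ 2 + P 2 ^ 2 < P 0 ^ 2}
  | .Sol => Set.univ
  | .SL2 => Set.univ

/-- The universal covering map of the hyperboloid `x₀² + x₁² - x₂² - x₃² = 1`, a copy of
`SL₂(ℝ)`; the point `(x₀, x₁, x₂, x₃)` is the matrix with rows `(α, β)`, `(conj β, conj α)`, where
`α = x₀ + i x₁` and `β = x₂ + i x₃`. -/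
noncomputable def sl2Cover (P : Triple) : Fin 4 → ℝ :=
  ![Real.sqrt (1 + P 1 ^ 2 + P 2 ^ 2) * Real.cos (P 0),
    Real.sqrt (1 + P 1 ^ 2 + P 2 ^ 2) * Real.sin (P 0), P 1, P 2]

/-- The translation of `SL₂(ℝ)` that carries the origin `(1, 0, 0, 0)` to `x`, as a linear map
acting on row vectors from the right. -/
def sl2Translation (x : Fin 4 → ℝ) : Matrix (Fin 4) (Fin 4) ℝ :=
  !![x 0, x 1, x 2, x 3;
     -x 1, x 0, x 3, -x 2;
     x 2, x 3, x 0, x 1;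
     x 3, -x 2, -x 1, x 0]

/-- A geodesic of constant speed of `S² × ℝ` in the model `ℝ³ ∖ {0}`; `a` is the speed of its
projection to the unit sphere and `b` the speed along the fibre. -/
def IsS2RMotion (a : ℝ) (γ : ℝ → Triple) : Prop :=
  ∃ (b : ℝ) (p w : Triple), p ≠ 0 ∧
    p 0 * w 0 + p 1 * w 1 + p 2 * w 2 = 0 ∧
    w 0 ^ 2 + w 1 ^ 2 + w 2 ^ 2 = p 0 ^ 2 + p 1 ^ 2 + p 2 ^ 2 ∧
    ∀ t, γ t = Real.exp (b * t) • (Real.cos (a * t) • p + Real.sin (a * t) • w)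

/-- A geodesic of constant speed of `H² × ℝ` in the cone model; `a` is the speed of its projection
to the hyperbolic plane and `b` the speed along the fibre. -/
def IsH2RMotion (a : ℝ) (γ : ℝ → Triple) : Prop :=
  ∃ (b : ℝ) (p w : Triple), p ∈ ThurstonX.H2R.domain ∧
    p 0 * w 0 - p 1 * w 1 - p 2 * w 2 = 0 ∧
    w 1 ^ 2 + w 2 ^ 2 - w 0 ^ 2 = p 0 ^ 2 - p 1 ^ 2 - p 2 ^ 2 ∧
    ∀ t, γ t = Real.exp (b * t) • (Real.cosh (a * t) • p + Real.sinh (a * t) • w)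

/-- `γ` is a translation curve with its natural parametrization, or a constant. In `Sol` and in the
cover of `SL₂(ℝ)` its velocity at every point is the image, under the translation that carries the
origin to that point, of one fixed tangent vector `u` at the origin. In `S² × ℝ` and `H² × ℝ` the
translation curves are the geodesics. -/
def IsTranslationMotion : ThurstonX → (ℝ → Triple) → Prop
  | .S2R, γ => ∃ a, IsS2RMotion a γ
  | .H2R, γ => ∃ a, IsH2RMotion a γ
  | .Sol, γ => ∃ u : Triple, ∀ t,
      HasDerivAt γ ![u 0 * Real.exp (-γ t 2), u 1 * Real.exp (γ t 2), u 2] t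
  | .SL2, γ => Continuous γ ∧ ∃ u : Triple, ∀ t,
      HasDerivAt (fun s => sl2Cover (γ s))
        (![0, u 0, u 1, u 2] ᵥ* sl2Translation (sl2Cover (γ t))) t

/-- A (complete, parametrized) translation curve. -/
def IsTranslationCurve (X : ThurstonX) (γ : ℝ → Triple) : Prop :=
  IsTranslationMotion X γ ∧ ∃ t, γ t ≠ γ 0

/-- `γ` restricted to `[0, 1]` is a translation segment from `P` to `Q` (constant if `P = Q`).
In `S² × ℝ`, where two points are joined by infinitely many geodesics, it has to project to an arc
of length at most `π` of the unit sphere, that is, to be a shortest geodesic. -/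
def IsTranslationSegment (X : ThurstonX) (P Q : Triple) (γ : ℝ → Triple) : Prop :=
  IsTranslationMotion X γ ∧ γ 0 = P ∧ γ 1 = Q ∧
    (X = .S2R → ∃ a, |a| ≤ Real.pi ∧ IsS2RMotion a γ)

/-- A translation triangle: three points of `X` that are joined in pairs by translation segments,
the sides, and that do not lie on one translation curve. -/
def IsTranslationTriangle (X : ThurstonX) (T : Fin 3 → Triple) : Prop :=
  (∀ i, T i ∈ X.domain) ∧
  (∀ i j, ∃ γ, IsTranslationSegment X (T i) (T j) γ) ∧
  ¬ ∃ γ, IsTranslationCurve X γ ∧ ∀ i, T i ∈ Set.range γ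

/-- A triangle of `S² × ℝ` or `H² × ℝ` is of fibre type if its vertices lie in a plane through the
origin of `ℝ³`, that is, over one geodesic of the base surface. -/
def IsFibreType (X : ThurstonX) (T : Fin 3 → Triple) : Prop :=
  (X = .S2R ∨ X = .H2R) ∧ ¬ LinearIndependent ℝ T

/-- The other triangles of `S² × ℝ` or `H² × ℝ` are of general type. -/
def IsGeneralType (X : ThurstonX) (T : Fin 3 → Triple) : Prop :=
  (X = .S2R ∨ X = .H2R) ∧ LinearIndependent ℝ T

/-- The tangents at `P` of the translation segments from `P` to the vertices of `T` are coplanar. -/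
def HasCoplanarTangents (X : ThurstonX) (T : Fin 3 → Triple) (P : Triple) : Prop :=
  ∃ (γ : Fin 3 → ℝ → Triple) (w : Fin 3 → Triple),
    (∀ i, IsTranslationSegment X P (T i) (γ i) ∧ HasDerivAt (γ i) (w i) 0) ∧
    ¬ LinearIndependent ℝ w

/-- The surface of the translation triangle `T`: the set of all points at which the tangents of the
translation segments to the three vertices are coplanar. For a triangle of fibre type the surface is
the plane through the origin that contains the triangle (all of whose points have this property). -/
def translationSurface (X : ThurstonX) (T : Fin 3 → Triple) : Set Triple :=
  {P | P ∈ X.domain ∧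
    ((IsFibreType X T ∧ P ∈ Submodule.span ℝ (Set.range T)) ∨
      (¬ IsFibreType X T ∧ HasCoplanarTangents X T P))}

/-- The part of the model in which the curves are considered. It is the whole space, except for a
triangle of fibre type in `S² × ℝ`: its surface is a cylinder, on which two points are joined by
infinitely many translation curves, and one restricts to the part over an open hemisphere. -/
def IsAdmissibleRegion (X : ThurstonX) (T : Fin 3 → Triple) (U : Set Triple) : Prop :=
  (X = .S2R ∧ IsFibreType X T ∧ ∃ l : Triple, U = {P | 0 < l ⬝ᵥ P}) ∨
  (¬ (X = .S2R ∧ IsFibreType X T) ∧ U = X.domain)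

/-- `C` is a translation curve for the surface of the triangle `T` (inside the region `U`).

For a triangle of general type in `S² × ℝ` or `H² × ℝ`, whose surface does not contain the geodesics
joining its points, the translation curves on the surface are the projections along the fibres of
the geodesics into the surface, that is, the sections of the surface by the planes through the
origin. In all the other cases `C` is a translation curve of the space, or, where `U` is not the
whole space, a connected component of the part in `U` of such a curve. -/
def IsSurfaceCurve (X : ThurstonX) (T : Fin 3 → Triple) (U C : Set Triple) : Prop :=
  (IsGeneralType X T ∧ ∃ V : Submodule ℝ Triple, Module.finrank ℝ V = 2 ∧
    C = translationSurface X T ∩ (V : Set Triple)) ∨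
  (¬ IsGeneralType X T ∧ ∃ (γ : ℝ → Triple) (s : ℝ), IsTranslationCurve X γ ∧ γ s ∈ U ∧
    C = γ '' connectedComponentIn (γ ⁻¹' U) s)

/-- `C` is the curve `g_{PQ}`, the only translation curve through `P` and `Q`. -/
def IsJoin (X : ThurstonX) (T : Fin 3 → Triple) (U : Set Triple) (P Q : Triple)
    (C : Set Triple) : Prop :=
  IsSurfaceCurve X T U C ∧ P ∈ C ∧ Q ∈ C ∧
    ∀ C', IsSurfaceCurve X T U C' → P ∈ C' → Q ∈ C' → C' = C

/-! ### Pappus's theorem for planes through the origin of a vector space. -/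

section Pappus

open Module Submodule

variable {K V : Type*} [Field K] [AddCommGroup V] [Module K V]

/-! In every case the curves are straight lines in disguise, and the theorem is the projective
theorem of Pappus. That theorem, `pappus`, is proved over any field and in any dimension: projective
points are vectors, lines are subspaces of dimension two, and collinearity of three points is linear
dependence. If the two carrier lines meet, the hexagon lies in one projective plane and a
determinant identity settles it. If they are skew, the vertices that matter coincide, and the points
M lie on a single line joining one point of each carrier. Hexagons with two coinciding opposite
sides are treated apart.

`pappus_of_chart` transfers this to a family of curves cut out of a set D by planes through the
origin, by way of a map F to a vector space. A unique join forces the images of its two end points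
to be independent: otherwise many planes would contain both images. Homogenization gives the
variants for charts in which the curves are pieces of affine lines.

The charts are as follows. For a triangle of general type F is the identity, since the curves are
plane sections by definition; the surface only has to contain three independent vectors, and its
vertices serve. In `Sol` the map `solChart` turns translation curves into the lines of a half-space.
For a triangle of fibre type in `S² × ℝ` or `H² × ℝ` the surface is part of a plane through 0, and
geodesics become straight in the coordinates (logarithm of the radius, angle), the angle being
circular (`polar`) or hyperbolic (`hpolar`).

In the cover of `SL₂(ℝ)` a translation curve is mapped by `sl2Cover` into a plane of `ℝ⁴`, but it is
not the whole preimage of that plane, so `pappus_of_chart` does not apply. Pappus's theorem still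
makes the images of the points M dependent. That the points lie on one curve upstairs follows from
the assumed pairwise joins, because a plane and one point over it determine the curve
(`IsTranslationCurve.range_eq_of_sl2Cover_mem`). Points with proportional images differ by a central
element; such points lie together on every elliptic curve through one of them, so they never have a
unique join. -/

theorem finrank_span_two {x y : V} (h : LinearIndependent K ![x, y]) :
    finrank K (span K {x, y}) = 2 := by
  have := finrank_span_eq_card h
  rw [Matrix.range_cons_cons_empty] at this
  simpa using this

theorem span_two_eq {W : Submodule K V} (hW : finrank K W = 2) {x y : V}
    (h : LinearIndependent K ![x, y]) (hx : x ∈ W) (hy : y ∈ W) : span K {x, y} = W := by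
  have : FiniteDimensional K W := FiniteDimensional.of_finrank_pos (by omega)
  refine Submodule.eq_of_le_of_finrank_eq ?_ (by rw [finrank_span_two h, hW])
  rw [span_le]
  rintro z (rfl | rfl) <;> assumption

theorem not_linearIndependent_of_mem {W : Submodule K V} (hW : finrank K W = 2) {x y z : V}
    (hx : x ∈ W) (hy : y ∈ W) (hz : z ∈ W) : ¬ LinearIndependent K ![x, y, z] := by
  intro h
  have : FiniteDimensional K W := FiniteDimensional.of_finrank_pos (by omega)
  have h3 := finrank_span_eq_card h
  have hle : span K (Set.range ![x, y, z]) ≤ W := by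
    rw [span_le]
    rintro _ ⟨i, rfl⟩
    fin_cases i <;> assumption
  have := Submodule.finrank_mono hle
  simp at h3
  omega

theorem exists_smul_of_mem_inf {L L' : Submodule K V} (hL : finrank K L = 2)
    (hL' : finrank K L' = 2) (hne : L ≠ L') {x y : V} (hx0 : x ≠ 0)
    (hx : x ∈ L) (hx' : x ∈ L') (hy : y ∈ L) (hy' : y ∈ L') : ∃ c : K, y = c • x := by
  by_contra hcon
  have hli : LinearIndependent K ![x, y] := by
    rw [LinearIndependent.pair_iff' hx0]
    exact fun c hc => hcon ⟨c, hc.symm⟩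
  exact hne ((span_two_eq hL hli hx hy).symm.trans (span_two_eq hL' hli hx' hy'))

theorem exists_smul_of_not_pair {x y : V} (hx : x ≠ 0) (hy : y ≠ 0)
    (h : ¬ LinearIndependent K ![x, y]) : ∃ c : K, c ≠ 0 ∧ y = c • x := by
  rw [LinearIndependent.pair_iff' hx] at h
  push Not at h
  obtain ⟨c, hc⟩ := h
  refine ⟨c, ?_, hc.symm⟩
  rintro rfl
  exact hy (by simpa using hc.symm)

theorem span_pair_smul_left {x y : V} {c : K} (hc : c ≠ 0) :
    span K {c • x, y} = span K {x, y} := by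
  rw [span_insert, span_insert, span_singleton_smul_eq (IsUnit.mk0 c hc)]

theorem span_pair_smul_right {x y : V} {c : K} (hc : c ≠ 0) :
    span K {x, c • y} = span K {x, y} := by
  rw [span_insert, span_insert, span_singleton_smul_eq (IsUnit.mk0 c hc)]

/-- The degenerate case of Pappus's theorem in which two opposite sides of the hexagon lie on one
line. -/
theorem pappus_of_span_eq {Wa Wb : Submodule K V} (hWa : finrank K Wa = 2)
    (hWb : finrank K Wb = 2)
    {a₁ a₂ a₃ b₁ b₂ b₃ m₁ m₂ m₃ : V}
    (ha₁ : a₁ ∈ Wa) (ha₂ : a₂ ∈ Wa) (ha₃ : a₃ ∈ Wa)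
    (hb₁ : b₁ ∈ Wb) (hb₂ : b₂ ∈ Wb) (hb₃ : b₃ ∈ Wb)
    (h₁₁ : LinearIndependent K ![a₁, b₁]) (h₃₂ : LinearIndependent K ![a₃, b₂])
    (h₂₂ : LinearIndependent K ![a₂, b₂]) (h₁₃ : LinearIndependent K ![a₁, b₃])
    (h₃₃ : LinearIndependent K ![a₃, b₃]) (h₂₁ : LinearIndependent K ![a₂, b₁])
    (hm₁ : m₁ ∈ span K {a₁, b₁})
    (hm₂ : m₂ ∈ span K {a₂, b₂}) (hm₂' : m₂ ∈ span K {a₁, b₃})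
    (hm₃ : m₃ ∈ span K {a₃, b₃}) (hm₃' : m₃ ∈ span K {a₂, b₁})
    (heq : span K {a₁, b₁} = span K {a₃, b₂}) :
    ¬ LinearIndependent K ![m₁, m₂, m₃] := by
  have hL := finrank_span_two h₁₁
  have e1 : a₁ ∈ span K {a₁, b₁} := subset_span (by simp)
  have e2 : b₁ ∈ span K {a₁, b₁} := subset_span (by simp)
  have e3 : a₃ ∈ span K {a₁, b₁} := heq ▸ subset_span (by simp)
  have e4 : b₂ ∈ span K {a₁, b₁} := heq ▸ subset_span (by simp)
  by_cases hA : LinearIndependent K ![a₁, a₃]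
  · have hLW := (span_two_eq hL hA e1 e3).symm.trans (span_two_eq hWa hA ha₁ ha₃)
    rw [hLW] at e2 e4 hm₁
    rw [span_two_eq hWa h₂₂ ha₂ e4] at hm₂
    rw [span_two_eq hWa h₂₁ ha₂ e2] at hm₃'
    exact not_linearIndependent_of_mem hWa hm₁ hm₂ hm₃'
  by_cases hB : LinearIndependent K ![b₁, b₂]
  · have hLW := (span_two_eq hL hB e2 e4).symm.trans (span_two_eq hWb hB hb₁ hb₂)
    rw [hLW] at e1 e3 hm₁
    rw [span_two_eq hWb h₁₃ e1 hb₃] at hm₂'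
    rw [span_two_eq hWb h₃₃ e3 hb₃] at hm₃
    exact not_linearIndependent_of_mem hWb hm₁ hm₂' hm₃
  -- Now a₃ is the point a₁ and b₂ is the point b₁. Hence m₂ and m₃ both lie on the lines a₂b₁ and
  -- a₁b₃: either they are one point, or these lines coincide and contain a₁, b₁ and therefore m₁.
  obtain ⟨c, hc, rfl⟩ := exists_smul_of_not_pair (h₁₁.ne_zero 0) (h₃₂.ne_zero 0) hA
  obtain ⟨d, hd, rfl⟩ := exists_smul_of_not_pair (h₁₁.ne_zero 1) (h₃₂.ne_zero 1) hB
  simp only [Matrix.cons_val_zero, Matrix.cons_val_one] at *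
  rw [span_pair_smul_right hd] at hm₂
  rw [span_pair_smul_left hc] at hm₃
  by_cases hPQ : span K {a₂, b₁} = span K {a₁, b₃}
  · have h1 : a₁ ∈ span K {a₂, b₁} := hPQ ▸ subset_span (by simp)
    have h2 : b₁ ∈ span K {a₂, b₁} := subset_span (by simp)
    rw [span_two_eq (finrank_span_two h₂₁) h₁₁ h1 h2] at hm₁
    exact not_linearIndependent_of_mem (finrank_span_two h₂₁) hm₁ hm₂ hm₃'
  · intro hli
    obtain ⟨e, he⟩ := exists_smul_of_mem_inf (finrank_span_two h₂₁) (finrank_span_two h₁₃) hPQ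
      (hli.ne_zero 1) hm₂ hm₂' hm₃' hm₃
    have hmem : m₃ ∈ span K {m₁, m₂} := by
      rw [he]
      exact smul_mem _ _ (subset_span (by simp))
    have hli2 : LinearIndependent K ![m₁, m₂] := by
      have := hli.comp ![0, 1] (by decide)
      convert this using 1
      ext i; fin_cases i <;> rfl
    exact not_linearIndependent_of_mem (finrank_span_two hli2) (subset_span (by simp))
      (subset_span (by simp)) hmem hli

/-- Pappus's theorem for two lines without a common point. -/
theorem pappus_of_disjoint {Wa Wb : Submodule K V} (hW : Disjoint Wa Wb)
    {a₁ a₂ a₃ b₁ b₂ b₃ m₁ m₂ m₃ : V}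
    (ha₁ : a₁ ∈ Wa) (ha₂ : a₂ ∈ Wa) (ha₃ : a₃ ∈ Wa)
    (hb₁ : b₁ ∈ Wb) (hb₂ : b₂ ∈ Wb) (hb₃ : b₃ ∈ Wb)
    (hm₁ : m₁ ∈ span K {a₁, b₁}) (hm₁' : m₁ ∈ span K {a₃, b₂})
    (hm₂ : m₂ ∈ span K {a₂, b₂}) (hm₂' : m₂ ∈ span K {a₁, b₃})
    (hm₃ : m₃ ∈ span K {a₃, b₃}) (hm₃' : m₃ ∈ span K {a₂, b₁}) :
    ¬ LinearIndependent K ![m₁, m₂, m₃] := by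
  -- The sum of `Wa` and `Wb` is direct, so two expressions of m agree component by component.
  have key : ∀ {a b a' b' : V}, a ∈ Wa → b ∈ Wb → a' ∈ Wa → b' ∈ Wb → ∀ {m : V},
      m ∈ span K {a, b} → m ∈ span K {a', b'} → ∃ α β α' β' : K, m = α • a + β • b ∧
        α • a = α' • a' ∧ β • b = β' • b' := by
    intro a b a' b' ha hb ha' hb' m hm hm'
    obtain ⟨α, β, h1⟩ := mem_span_pair.1 hm
    obtain ⟨α', β', h2⟩ := mem_span_pair.1 hm'
    refine ⟨α, β, α', β', h1.symm, ?_⟩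
    have h3 : α • a - α' • a' = β' • b' - β • b := by
      rw [sub_eq_sub_iff_add_eq_add, h1, ← h2, add_comm]
    have h4 : α • a - α' • a' = 0 := by
      refine disjoint_def.1 hW _ (sub_mem (smul_mem _ _ ha) (smul_mem _ _ ha')) ?_
      rw [h3]
      exact sub_mem (smul_mem _ _ hb') (smul_mem _ _ hb)
    rw [h4] at h3
    exact ⟨sub_eq_zero.1 h4, (sub_eq_zero.1 h3.symm).symm⟩
  obtain ⟨α₁, β₁, γ₁, δ₁, rfl, p1, q1⟩ := key ha₁ hb₁ ha₃ hb₂ hm₁ hm₁'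
  obtain ⟨α₂, β₂, γ₂, δ₂, rfl, p2, q2⟩ := key ha₂ hb₂ ha₁ hb₃ hm₂ hm₂'
  obtain ⟨α₃, β₃, γ₃, δ₃, rfl, p3, q3⟩ := key ha₃ hb₃ ha₂ hb₁ hm₃ hm₃'
  -- The components of the three points m in one carrier are linked in a cycle and are therefore
  -- multiples of one vector. Vanishing components break the cycle, which is why the choice of v
  -- needs cases.
  have cyc : ∀ {a₁ a₂ a₃ : V} {α₁ α₂ α₃ γ₁ γ₂ γ₃ : K}, α₁ • a₁ = γ₁ • a₃ → α₂ • a₂ = γ₂ • a₁ →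
      α₃ • a₃ = γ₃ • a₂ → (∃ v : V, ∃ r s t : K, α₁ • a₁ = r • v ∧ α₂ • a₂ = s • v ∧
        α₃ • a₃ = t • v) := by
    intro a₁ a₂ a₃ α₁ α₂ α₃ γ₁ γ₂ γ₃ h1 h2 h3
    by_cases z1 : α₁ • a₁ = 0
    · by_cases z2 : α₂ • a₂ = 0
      · exact ⟨a₃, 0, 0, α₃, by simpa using z1, by simpa using z2, rfl⟩
      · refine ⟨a₂, 0, α₂, γ₃, by simpa using z1, rfl, h3⟩
    · refine ⟨a₁, α₁, γ₂, ?_⟩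
      have g1 : γ₁ ≠ 0 := by rintro rfl; exact z1 (by simpa using h1)
      refine ⟨α₃ * (γ₁⁻¹ * α₁), rfl, h2, ?_⟩
      rw [mul_smul, mul_smul, h1, inv_smul_smul₀ g1]
  obtain ⟨v, r₁, r₂, r₃, e1, e2, e3⟩ := cyc p1 p2 p3
  obtain ⟨w, s₁, s₃, s₂, f1, f3, f2⟩ := cyc q1 q3 q2
  intro hli
  have h3 := finrank_span_eq_card hli
  have hfin : FiniteDimensional K (span K {v, w}) :=
    FiniteDimensional.span_of_finite K (by simp)
  have hle : span K (Set.range ![α₁ • a₁ + β₁ • b₁, α₂ • a₂ + β₂ • b₂, α₃ • a₃ + β₃ • b₃]) ≤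
      span K {v, w} := by
    rw [e1, e2, e3, f1, f2, f3, span_le]
    rintro _ ⟨i, rfl⟩
    fin_cases i <;> exact mem_span_pair.2 ⟨_, _, rfl⟩
  have h2 := Submodule.finrank_mono hle
  have h4 : finrank K (span K {v, w}) ≤ 2 := by
    classical
    have := finrank_span_finset_le_card (R := K) ({v, w} : Finset V)
    simp only [Finset.coe_insert, Finset.coe_singleton] at this
    exact this.trans Finset.card_le_two
  simp at h3
  omega

/-- The algebraic core of Pappus's theorem. The first basis vector is the common point of the
carriers, so that aᵢ = (xᵢ, yᵢ, 0) and bᵢ = (zᵢ, 0, wᵢ); the rows are the intersections of opposite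
sides as computed in `exists_smul_crossing`. -/
theorem det_pappus (c₁ c₂ c₃ x₁ y₁ x₂ y₂ x₃ y₃ z₁ w₁ z₂ w₂ z₃ w₃ : K) :
    Matrix.det (Matrix.of ![
      c₁ • ![x₁ * w₁ * (y₃ * z₂) - y₁ * z₁ * (x₃ * w₂), y₁ * y₃ * (w₁ * z₂ - z₁ * w₂),
        w₁ * w₂ * (x₁ * y₃ - y₁ * x₃)],
      c₂ • ![x₂ * w₂ * (y₁ * z₃) - y₂ * z₂ * (x₁ * w₃), y₂ * y₁ * (w₂ * z₃ - z₂ * w₃),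
        w₂ * w₃ * (x₂ * y₁ - y₂ * x₁)],
      c₃ • ![x₃ * w₃ * (y₂ * z₁) - y₃ * z₃ * (x₂ * w₁), y₃ * y₂ * (w₃ * z₁ - z₃ * w₁),
        w₃ * w₁ * (x₃ * y₂ - y₃ * x₂)]]) = 0 := by
  rw [Matrix.det_fin_three]
  simp
  ring

theorem linearIndependent_triple {a b c : V} :
    LinearIndependent K ![a, b, c] ↔ LinearIndependent K ![a, b] ∧ c ∉ span K {a, b} := by
  have h : ![a, b, c] = Fin.snoc (α := fun _ => V) ![a, b] c := by
    ext i; fin_cases i <;> rfl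
  rw [h, linearIndependent_finSnoc, Matrix.range_cons_cons_empty]

theorem not_linearIndependent_of_det_eq_zero {a b c : Fin 3 → K}
    (hdet : Matrix.det (Matrix.of ![a, b, c]) = 0) : ¬ LinearIndependent K ![a, b, c] := by
  intro hli
  have := (Matrix.linearIndependent_rows_iff_isUnit (A := Matrix.of ![a, b, c])).1 hli
  rw [Matrix.isUnit_iff_isUnit_det, hdet] at this
  exact not_isUnit_zero this

theorem mem_span_pair_of_det_eq_zero {a b c : Fin 3 → K} (h : LinearIndependent K ![a, b])
    (hdet : Matrix.det (Matrix.of ![a, b, c]) = 0) : c ∈ span K {a, b} := by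
  by_contra hc
  exact not_linearIndependent_of_det_eq_zero hdet (linearIndependent_triple.2 ⟨h, hc⟩)

/-- The point of intersection of two sides of the hexagon, in coordinates. -/
theorem exists_smul_crossing {x y z w x' y' z' w' : K} {m : Fin 3 → K}
    (h : LinearIndependent K ![![x, y, 0], ![z, 0, w]])
    (h' : LinearIndependent K ![![x', y', 0], ![z', 0, w']])
    (hne : span K {![x, y, 0], ![z, 0, w]} ≠ span K {![x', y', 0], ![z', 0, w']})
    (hm : m ∈ span K {![x, y, 0], ![z, 0, w]}) (hm' : m ∈ span K {![x', y', 0], ![z', 0, w']}) :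
    ∃ c : K, m = c • ![x * w * (y' * z') - y * z * (x' * w'), y * y' * (w * z' - z * w'),
        w * w' * (x * y' - y * x')] := by
  set q : Fin 3 → K := ![x * w * (y' * z') - y * z * (x' * w'), y * y' * (w * z' - z * w'),
        w * w' * (x * y' - y * x')] with hq
  have h1 : q = (y * (w * z' - z * w')) • ![x', y', 0] + (w * (x * y' - y * x')) • ![z', 0, w'] := by
    rw [hq]; ext i; fin_cases i <;> simp <;> ring
  have h2 : q = (y' * (w * z' - z * w')) • ![x, y, 0] + (w' * (x * y' - y * x')) • ![z, 0, w] := by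
    rw [hq]; ext i; fin_cases i <;> simp <;> ring
  refine exists_smul_of_mem_inf (finrank_span_two h) (finrank_span_two h') hne ?_
    (h2 ▸ mem_span_pair.2 ⟨_, _, rfl⟩) (h1 ▸ mem_span_pair.2 ⟨_, _, rfl⟩) hm hm'
  -- Up to sign the coefficients in `h1` are the determinants of the first pair of vectors with each
  -- vector of the second pair. If q vanished, both would be zero and the two lines would coincide.
  intro h0
  obtain ⟨e1, e2⟩ := LinearIndependent.pair_iff.1 h' _ _ (h1.symm.trans h0)
  refine hne (span_two_eq (finrank_span_two h) h' ?_ ?_).symm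
  · refine mem_span_pair_of_det_eq_zero h ?_
    rw [Matrix.det_fin_three]
    simp
    linear_combination -e2
  · refine mem_span_pair_of_det_eq_zero h ?_
    rw [Matrix.det_fin_three]
    simp
    linear_combination e1

/-- **Pappus's theorem**, for points and lines of a projective space that are given by vectors and
planes of a vector space. -/
theorem pappus {Wa Wb : Submodule K V} (hWa : finrank K Wa = 2)
    (hWb : finrank K Wb = 2) (hne : Wa ≠ Wb)
    {a₁ a₂ a₃ b₁ b₂ b₃ m₁ m₂ m₃ : V}
    (ha₁ : a₁ ∈ Wa) (ha₂ : a₂ ∈ Wa) (ha₃ : a₃ ∈ Wa)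
    (hb₁ : b₁ ∈ Wb) (hb₂ : b₂ ∈ Wb) (hb₃ : b₃ ∈ Wb)
    (h₁₁ : LinearIndependent K ![a₁, b₁]) (h₃₂ : LinearIndependent K ![a₃, b₂])
    (h₂₂ : LinearIndependent K ![a₂, b₂]) (h₁₃ : LinearIndependent K ![a₁, b₃])
    (h₃₃ : LinearIndependent K ![a₃, b₃]) (h₂₁ : LinearIndependent K ![a₂, b₁])
    (hm₁ : m₁ ∈ span K {a₁, b₁}) (hm₁' : m₁ ∈ span K {a₃, b₂})
    (hm₂ : m₂ ∈ span K {a₂, b₂}) (hm₂' : m₂ ∈ span K {a₁, b₃})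
    (hm₃ : m₃ ∈ span K {a₃, b₃}) (hm₃' : m₃ ∈ span K {a₂, b₁}) :
    ¬ LinearIndependent K ![m₁, m₂, m₃] := by
  by_cases hd : Disjoint Wa Wb
  · exact pappus_of_disjoint hd ha₁ ha₂ ha₃ hb₁ hb₂ hb₃ hm₁ hm₁' hm₂ hm₂' hm₃ hm₃'
  by_cases e1 : span K {a₁, b₁} = span K {a₃, b₂}
  · exact pappus_of_span_eq hWa hWb ha₁ ha₂ ha₃ hb₁ hb₂ hb₃ h₁₁ h₃₂ h₂₂ h₁₃ h₃₃ h₂₁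
      hm₁ hm₂ hm₂' hm₃ hm₃' e1
  by_cases e2 : span K {a₂, b₂} = span K {a₁, b₃}
  · intro hli
    -- The configuration is invariant under the cyclic shift of all indices.
    refine pappus_of_span_eq hWa hWb ha₂ ha₃ ha₁ hb₂ hb₃ hb₁ h₂₂ h₁₃ h₃₃ h₂₁ h₁₁ h₃₂
      hm₂ hm₃ hm₃' hm₁ hm₁' e2 ?_
    have := hli.comp ![1, 2, 0] (by decide)
    convert this using 1
    ext i; fin_cases i <;> rfl
  by_cases e3 : span K {a₃, b₃} = span K {a₂, b₁}
  · intro hli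
    refine pappus_of_span_eq hWa hWb ha₃ ha₁ ha₂ hb₃ hb₁ hb₂ h₃₃ h₂₁ h₁₁ h₃₂ h₂₂ h₁₃
      hm₃ hm₁ hm₁' hm₂ hm₂' e3 ?_
    have := hli.comp ![2, 0, 1] (by decide)
    convert this using 1
    ext i; fin_cases i <;> rfl
  obtain ⟨o, hoa, hob, ho⟩ : ∃ o ∈ Wa, o ∈ Wb ∧ o ≠ 0 := by
    rw [disjoint_def] at hd
    push Not at hd
    exact hd
  have hbasis : ∀ {W : Submodule K V}, finrank K W = 2 → o ∈ W →
      ∃ a, LinearIndependent K ![o, a] ∧ W = span K {o, a} := by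
    intro W hW hoW
    obtain ⟨a, haW, ha⟩ : ∃ a ∈ W, a ∉ span K {o} := by
      by_contra! hcon
      have hle : W ≤ span K {o} := hcon
      have := Submodule.finrank_mono hle
      have := finrank_span_singleton (K := K) ho
      omega
    have hli : LinearIndependent K ![o, a] := by
      rw [LinearIndependent.pair_iff' ho]
      exact fun c hc => ha (mem_span_singleton.2 ⟨c, hc⟩)
    exact ⟨a, hli, (span_two_eq hW hli hoW haW).symm⟩
  obtain ⟨a, hoa', rfl⟩ := hbasis hWa hoa
  obtain ⟨b, hob', rfl⟩ := hbasis hWb hob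
  have hoab : LinearIndependent K ![o, a, b] :=
    linearIndependent_triple.2
      ⟨hoa', fun hb => hne (span_two_eq hWa hob' (subset_span (by simp)) hb).symm⟩
  let φ : (Fin 3 → K) →ₗ[K] V := Fintype.linearCombination K ![o, a, b]
  have hφ : ∀ x y z : K, φ ![x, y, z] = x • o + y • a + z • b := by
    intro x y z
    simp [φ, Fintype.linearCombination_apply, Fin.sum_univ_three]
  have hinj : Function.Injective φ := LinearIndependent.fintypeLinearCombination_injective hoab
  have hA : ∀ {v}, v ∈ span K {o, a} → ∃ x y, v = φ ![x, y, 0] := by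
    intro v hv
    obtain ⟨x, y, rfl⟩ := mem_span_pair.1 hv
    exact ⟨x, y, by simp [hφ]⟩
  have hB : ∀ {v}, v ∈ span K {o, b} → ∃ x y, v = φ ![x, 0, y] := by
    intro v hv
    obtain ⟨x, y, rfl⟩ := mem_span_pair.1 hv
    exact ⟨x, y, by simp [hφ]⟩
  obtain ⟨x₁, y₁, rfl⟩ := hA ha₁
  obtain ⟨x₂, y₂, rfl⟩ := hA ha₂
  obtain ⟨x₃, y₃, rfl⟩ := hA ha₃
  obtain ⟨z₁, w₁, rfl⟩ := hB hb₁
  obtain ⟨z₂, w₂, rfl⟩ := hB hb₂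
  obtain ⟨z₃, w₃, rfl⟩ := hB hb₃
  have hLI : ∀ {u v : Fin 3 → K}, LinearIndependent K ![φ u, φ v] → LinearIndependent K ![u, v] := by
    intro u v h
    refine LinearIndependent.of_comp φ ?_
    convert h using 1
    ext i; fin_cases i <;> rfl
  have hspan : ∀ u v : Fin 3 → K, span K {φ u, φ v} = (span K {u, v}).map φ := by
    intro u v
    rw [map_span, Set.image_pair]
  simp only [hspan] at hm₁ hm₁' hm₂ hm₂' hm₃ hm₃' e1 e2 e3
  obtain ⟨m₁, hm₁, rfl⟩ := hm₁
  obtain ⟨m₂, hm₂, rfl⟩ := hm₂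
  obtain ⟨m₃, hm₃, rfl⟩ := hm₃
  have hmm : ∀ {m : Fin 3 → K} {S : Submodule K (Fin 3 → K)}, φ m ∈ S.map φ → m ∈ S := by
    rintro m S ⟨m', hm', he⟩
    exact hinj he ▸ hm'
  obtain ⟨c₁, rfl⟩ := exists_smul_crossing (hLI h₁₁) (hLI h₃₂) (fun h => e1 (by rw [h])) hm₁
    (hmm hm₁')
  obtain ⟨c₂, rfl⟩ := exists_smul_crossing (hLI h₂₂) (hLI h₁₃) (fun h => e2 (by rw [h])) hm₂
    (hmm hm₂')
  obtain ⟨c₃, rfl⟩ := exists_smul_crossing (hLI h₃₃) (hLI h₂₁) (fun h => e3 (by rw [h])) hm₃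
    (hmm hm₃')
  intro hli
  refine not_linearIndependent_of_det_eq_zero
    (det_pappus c₁ c₂ c₃ x₁ y₁ x₂ y₂ x₃ y₃ z₁ w₁ z₂ w₂ z₃ w₃) (LinearIndependent.of_comp φ ?_)
  convert hli using 1
  ext i; fin_cases i <;> rfl

end Pappus

/-! ### Transfer of Pappus's theorem through charts. -/

section Chart

open Module Submodule

/-- The vector u supplies a second direction when x, y, z are all proportional. -/
theorem exists_plane_of_not_linearIndependent {K V : Type*} [Field K] [AddCommGroup V] [Module K V]
    {x y z u : V} (hu : LinearIndependent K ![x, u]) (h : ¬ LinearIndependent K ![x, y, z]) :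
    ∃ W : Submodule K V, finrank K W = 2 ∧ x ∈ W ∧ y ∈ W ∧ z ∈ W := by
  have hx : x ≠ 0 := hu.ne_zero 0
  have hmul : ∀ {v w : V}, ¬ LinearIndependent K ![x, v] → v ∈ span K {x, w} := by
    intro v w hv
    rw [LinearIndependent.pair_iff' hx] at hv
    push Not at hv
    obtain ⟨c, rfl⟩ := hv
    exact smul_mem _ _ (subset_span (by simp))
  by_cases hy : LinearIndependent K ![x, y]
  · refine ⟨_, finrank_span_two hy, subset_span (by simp), subset_span (by simp), ?_⟩
    by_contra hz
    exact h (linearIndependent_triple.2 ⟨hy, hz⟩)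
  by_cases hz : LinearIndependent K ![x, z]
  · exact ⟨_, finrank_span_two hz, subset_span (by simp), hmul hy, subset_span (by simp)⟩
  · exact ⟨_, finrank_span_two hu, subset_span (by simp), hmul hy, hmul hz⟩

/-- `C` is the only curve of the family `𝒞` through `p` and `q`. -/
def IsOnlyCurve {P : Type*} (𝒞 : Set P → Prop) (p q : P) (C : Set P) : Prop :=
  𝒞 C ∧ p ∈ C ∧ q ∈ C ∧ ∀ C', 𝒞 C' → p ∈ C' → q ∈ C' → C' = C

/-- The hexagon theorem of Pappus for the curves of the family `𝒞`, where the vertices of the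
hexagon are points of `D`. -/
def PappusProperty {P : Type*} (𝒞 : Set P → Prop) (D : Set P) : Prop :=
  ∀ ⦃a₁ a₂ a₃ b₁ b₂ b₃ m₁ m₂ m₃ : P⦄ ⦃ga gb g₁₁ g₃₂ g₂₂ g₁₃ g₃₃ g₂₁ : Set P⦄,
    𝒞 ga → 𝒞 gb → ga ≠ gb → a₁ ∈ D ∩ ga → a₂ ∈ D ∩ ga → a₃ ∈ D ∩ ga →
    b₁ ∈ D ∩ gb → b₂ ∈ D ∩ gb → b₃ ∈ D ∩ gb → a₁ ≠ a₂ → b₁ ≠ b₂ →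
    IsOnlyCurve 𝒞 a₁ b₁ g₁₁ → IsOnlyCurve 𝒞 a₃ b₂ g₃₂ → IsOnlyCurve 𝒞 a₂ b₂ g₂₂ →
    IsOnlyCurve 𝒞 a₁ b₃ g₁₃ → IsOnlyCurve 𝒞 a₃ b₃ g₃₃ → IsOnlyCurve 𝒞 a₂ b₁ g₂₁ →
    m₁ ∈ g₁₁ ∩ g₃₂ → m₂ ∈ g₂₂ ∩ g₁₃ → m₃ ∈ g₃₃ ∩ g₂₁ →
    ∃ C, 𝒞 C ∧ m₁ ∈ C ∧ m₂ ∈ C ∧ m₃ ∈ C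

/-- Pappus's theorem for a family of curves that a map `F` to a vector space represents by
planes through the origin. -/
theorem pappus_of_chart {K V P : Type*} [Field K] [AddCommGroup V] [Module K V]
    {𝒞 : Set P → Prop} {D : Set P} (F : P → V)
    (plane_of_curve : ∀ C, 𝒞 C → ∀ p ∈ C, ∀ q ∈ C, p ∈ D → q ∈ D → p ≠ q →
      ∃ W : Submodule K V, finrank K W = 2 ∧ C = {x | x ∈ D ∧ F x ∈ W})
    (curve_of_plane : ∀ W : Submodule K V, finrank K W = 2 → ∀ p ∈ D, F p ∈ W →
      𝒞 {x | x ∈ D ∧ F x ∈ W})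
    (exists_triple : ∀ p ∈ D, ∃ q ∈ D, ∃ r ∈ D, LinearIndependent K ![F p, F q, F r]) :
    PappusProperty 𝒞 D := by
  have join : ∀ {p q : P} {g : Set P}, p ∈ D → q ∈ D → IsOnlyCurve 𝒞 p q g →
      LinearIndependent K ![F p, F q] ∧ ∀ x ∈ g, x ∈ D ∧ F x ∈ span K {F p, F q} := by
    rintro p q g hp hq ⟨hg, hpg, hqg, huniq⟩
    obtain ⟨r, hr, s, hs, hli⟩ := exists_triple p hp
    have hli2 : LinearIndependent K ![F p, F q] := by
      by_contra hcon
      have hp0 : F p ≠ 0 := hli.ne_zero 0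
      have hmul : ∀ {v : V}, F q ∈ span K {F p, v} := by
        intro v
        rw [LinearIndependent.pair_iff' hp0] at hcon
        push Not at hcon
        obtain ⟨c, hc⟩ := hcon
        exact hc ▸ smul_mem _ _ (subset_span (by simp))
      have hpr : LinearIndependent K ![F p, F r] := (linearIndependent_triple.1 hli).1
      have hps : LinearIndependent K ![F p, F s] := by
        have := hli.comp ![0, 2] (by decide)
        convert this using 1
        ext i; fin_cases i <;> rfl
      have hp1 : ∀ {v : V}, F p ∈ span K {F p, v} := subset_span (by simp)
      have e1 := huniq _ (curve_of_plane _ (finrank_span_two hpr) p hp hp1) ⟨hp, hp1⟩ ⟨hq, hmul⟩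
      have e2 := huniq _ (curve_of_plane _ (finrank_span_two hps) p hp hp1) ⟨hp, hp1⟩ ⟨hq, hmul⟩
      -- If F q were a multiple of F p, the planes spanned by F p with F r and with F s would both
      -- give curves through p and q. Uniqueness identifies these curves and puts s over the first
      -- plane, against independence.
      have hsmem : s ∈ {x | x ∈ D ∧ F x ∈ span K {F p, F r}} := by
        rw [e1, ← e2]
        exact ⟨hs, subset_span (by simp)⟩
      exact (linearIndependent_triple.1 hli).2 hsmem.2
    refine ⟨hli2, ?_⟩
    have hne : p ≠ q := by
      rintro rfl
      exact one_ne_zero (LinearIndependent.pair_iff.1 hli2 1 (-1) (by simp)).1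
    obtain ⟨W, hW, rfl⟩ := plane_of_curve g hg p hpg q hqg hp hq hne
    rw [span_two_eq hW hli2 hpg.2 hqg.2]
    exact fun x hx => hx
  rintro a₁ a₂ a₃ b₁ b₂ b₃ m₁ m₂ m₃ ga gb g₁₁ g₃₂ g₂₂ g₁₃ g₃₃ g₂₁ hga hgb hab ⟨hDa₁, ha₁⟩
    ⟨hDa₂, ha₂⟩ ⟨hDa₃, ha₃⟩ ⟨hDb₁, hb₁⟩ ⟨hDb₂, hb₂⟩ ⟨hDb₃, hb₃⟩ ha₁₂ hb₁₂ h₁₁ h₃₂ h₂₂ h₁₃ h₃₃ h₂₁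
    hm₁ hm₂ hm₃
  obtain ⟨Wa, hWa, rfl⟩ := plane_of_curve ga hga a₁ ha₁ a₂ ha₂ hDa₁ hDa₂ ha₁₂
  obtain ⟨Wb, hWb, rfl⟩ := plane_of_curve gb hgb b₁ hb₁ b₂ hb₂ hDb₁ hDb₂ hb₁₂
  obtain ⟨i₁₁, j₁₁⟩ := join hDa₁ hDb₁ h₁₁
  obtain ⟨i₃₂, j₃₂⟩ := join hDa₃ hDb₂ h₃₂
  obtain ⟨i₂₂, j₂₂⟩ := join hDa₂ hDb₂ h₂₂
  obtain ⟨i₁₃, j₁₃⟩ := join hDa₁ hDb₃ h₁₃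
  obtain ⟨i₃₃, j₃₃⟩ := join hDa₃ hDb₃ h₃₃
  obtain ⟨i₂₁, j₂₁⟩ := join hDa₂ hDb₁ h₂₁
  have hdep := pappus hWa hWb (fun h => hab (by rw [h])) ha₁.2 ha₂.2 ha₃.2 hb₁.2 hb₂.2 hb₃.2
    i₁₁ i₃₂ i₂₂ i₁₃ i₃₃ i₂₁ (j₁₁ _ hm₁.1).2 (j₃₂ _ hm₁.2).2 (j₂₂ _ hm₂.1).2 (j₁₃ _ hm₂.2).2
    (j₃₃ _ hm₃.1).2 (j₂₁ _ hm₃.2).2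
  have hD := (j₁₁ _ hm₁.1).1
  obtain ⟨r, hr, s, hs, hli⟩ := exists_triple m₁ hD
  obtain ⟨W, hW, k₁, k₂, k₃⟩ :=
    exists_plane_of_not_linearIndependent (linearIndependent_triple.1 hli).1 hdep
  exact ⟨_, curve_of_plane W hW m₁ hD k₁, ⟨hD, k₁⟩, ⟨(j₂₂ _ hm₂.1).1, k₂⟩, ⟨(j₃₃ _ hm₃.1).1, k₃⟩⟩

section Affine

variable {E : Type*} [AddCommGroup E] [Module ℝ E]

theorem linearIndependent_point_direction {p d : E} (hd : d ≠ 0) :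
    LinearIndependent ℝ ![((1 : ℝ), p), ((0 : ℝ), d)] := by
  rw [LinearIndependent.pair_iff]
  intro s t h
  simp only [Prod.smul_mk, Prod.mk_add_mk, Prod.mk_eq_zero] at h
  obtain ⟨h1, h2⟩ := h
  have hs : s = 0 := by simpa using h1
  subst hs
  exact ⟨rfl, by simpa [hd] using h2⟩

theorem mem_span_point_direction {p d v : E} :
    ((1 : ℝ), v) ∈ span ℝ {((1 : ℝ), p), ((0 : ℝ), d)} ↔ ∃ t : ℝ, v = p + t • d := by
  rw [mem_span_pair]
  constructor
  · rintro ⟨s, t, h⟩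
    simp only [Prod.smul_mk, Prod.mk_add_mk, Prod.mk.injEq] at h
    have hs : s = 1 := by simpa using h.1
    subst hs
    exact ⟨t, by simpa using h.2.symm⟩
  · rintro ⟨t, rfl⟩
    exact ⟨1, t, by simp⟩

/-- A homogenized line meets the hyperplane at infinity `{0} × E` in its direction. Planes inside
that hyperplane, which represent no affine line, are excluded by `hp`. -/
theorem exists_direction_of_mem_plane {W : Submodule ℝ (ℝ × E)} (hW : finrank ℝ W = 2) {p : E}
    (hp : ((1 : ℝ), p) ∈ W) : ∃ d : E, d ≠ 0 ∧ W = span ℝ {((1 : ℝ), p), ((0 : ℝ), d)} := by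
  obtain ⟨a, haW, ha⟩ : ∃ a ∈ W, a ∉ span ℝ {((1 : ℝ), p)} := by
    by_contra! hcon
    have hle : W ≤ span ℝ {((1 : ℝ), p)} := hcon
    have := Submodule.finrank_mono hle
    have := finrank_span_singleton (K := ℝ) (v := ((1 : ℝ), p)) (by simp)
    omega
  have hmem : a - a.1 • ((1 : ℝ), p) ∈ W := sub_mem haW (smul_mem _ _ hp)
  have heq : a - a.1 • ((1 : ℝ), p) = ((0 : ℝ), a.2 - a.1 • p) := by
    ext <;> simp
  rw [heq] at hmem
  have hd : a.2 - a.1 • p ≠ 0 := by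
    intro h
    refine ha (mem_span_singleton.2 ⟨a.1, ?_⟩)
    ext
    · simp
    · simpa using (sub_eq_zero.1 h).symm
  exact ⟨_, hd, (span_two_eq hW (linearIndependent_point_direction hd) hp hmem).symm⟩

/-- Pappus's theorem for a family of curves that a chart maps to the parts of the straight lines
in a subset of an affine space. -/
theorem pappus_of_affine_chart {P : Type*} {𝒞 : Set P → Prop} {D : Set P} (f : P → E)
    (line_of_curve : ∀ C, 𝒞 C → ∀ p ∈ C, ∀ q ∈ C, p ∈ D → q ∈ D → p ≠ q →
      ∃ c d : E, d ≠ 0 ∧ C = {x | x ∈ D ∧ ∃ t : ℝ, f x = c + t • d})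
    (curve_of_line : ∀ p ∈ D, ∀ d : E, d ≠ 0 → 𝒞 {x | x ∈ D ∧ ∃ t : ℝ, f x = f p + t • d})
    (exists_triple : ∀ p ∈ D, ∃ q ∈ D, ∃ r ∈ D, LinearIndependent ℝ ![f q - f p, f r - f p]) :
    PappusProperty 𝒞 D := by
  -- Homogenization: the affine space becomes the hyperplane of height 1 in `ℝ × E`, and its lines
  -- become planes through the origin.
  refine pappus_of_chart (K := ℝ) (D := D) (fun x => ((1 : ℝ), f x)) ?_ ?_ ?_
  · intro C hC p hp q hq hpD hqD hpq
    obtain ⟨c, d, hd, rfl⟩ := line_of_curve C hC p hp q hq hpD hqD hpq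
    refine ⟨span ℝ {((1 : ℝ), c), ((0 : ℝ), d)},
      finrank_span_two (linearIndependent_point_direction hd), ?_⟩
    simp only [mem_span_point_direction]
  · intro W hW p hpD hp
    obtain ⟨d, hd, rfl⟩ := exists_direction_of_mem_plane hW hp
    simp only [mem_span_point_direction]
    exact curve_of_line p hpD d hd
  · intro p hp
    obtain ⟨q, hq, r, hr, h⟩ := exists_triple p hp
    refine ⟨q, hq, r, hr, ?_⟩
    rw [LinearIndependent.pair_iff] at h
    rw [Fintype.linearIndependent_iff]
    intro g hg
    simp only [Fin.sum_univ_three, Matrix.cons_val, Prod.smul_mk, Prod.mk_add_mk,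
      Prod.mk_eq_zero, smul_eq_mul, mul_one] at hg
    obtain ⟨h1, h2⟩ := hg
    have h0 : g 0 = -g 1 - g 2 := by linear_combination h1
    obtain ⟨e1, e2⟩ := h (g 1) (g 2) (by
      rw [← h2, h0]
      module)
    intro i
    fin_cases i
    · simp [h0, e1, e2]
    · exact e1
    · exact e2

end Affine

end Chart

/-! ### Triangles of general type. -/

section GeneralType

open Module Submodule

/-- Otherwise p would lie in the spans of all three pairs of vectors of T, and comparing coordinates
would give p = 0. -/
theorem exists_linearIndependent_triple {K V : Type*} [Field K] [AddCommGroup V] [Module K V]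
    {T : Fin 3 → V} (hT : LinearIndependent K T) {p : V} (hp : p ≠ 0) :
    ∃ i j, LinearIndependent K ![p, T i, T j] := by
  by_contra! hcon
  have key : ∀ i j, i ≠ j → ∃ s t : K, p = s • T i + t • T j := by
    intro i j hij
    have hli : LinearIndependent K ![T i, T j] := by
      have := hT.comp ![i, j] (by
        intro a b h
        fin_cases a <;> fin_cases b <;> simp_all [eq_comm])
      convert this using 1
      ext k; fin_cases k <;> rfl
    have hmem : p ∈ span K {T i, T j} := by
      by_contra hmem
      refine hcon i j ?_
      have := (linearIndependent_triple.2 ⟨hli, hmem⟩).comp ![2, 0, 1] (by decide)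
      convert this using 1
      ext k; fin_cases k <;> rfl
    obtain ⟨s, t, h⟩ := mem_span_pair.1 hmem
    exact ⟨s, t, h.symm⟩
  obtain ⟨s, t, h1⟩ := key 0 1 (by decide)
  obtain ⟨u, v, h2⟩ := key 0 2 (by decide)
  obtain ⟨x, y, h3⟩ := key 1 2 (by decide)
  rw [Fintype.linearIndependent_iff] at hT
  have e1 := hT ![s - u, t, -v] (by
    simp only [Fin.sum_univ_three, Matrix.cons_val]
    rw [show (0 : V) = p - p by simp]
    nth_rewrite 1 [h1]
    rw [h2]
    module)
  have e2 := hT ![s, t - x, -y] (by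
    simp only [Fin.sum_univ_three, Matrix.cons_val]
    rw [show (0 : V) = p - p by simp]
    nth_rewrite 1 [h1]
    rw [h3]
    module)
  have ht : t = 0 := e1 1
  have hs : s = 0 := e2 0
  exact hp (by rw [h1, hs, ht]; simp)

theorem IsS2RMotion.differentiable {a : ℝ} {γ : ℝ → Triple} (h : IsS2RMotion a γ) :
    Differentiable ℝ γ := by
  obtain ⟨b, p, w, -, -, -, h⟩ := h
  rw [funext h]
  fun_prop

theorem IsH2RMotion.differentiable {a : ℝ} {γ : ℝ → Triple} (h : IsH2RMotion a γ) :
    Differentiable ℝ γ := by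
  obtain ⟨b, p, w, -, -, -, h⟩ := h
  rw [funext h]
  fun_prop

theorem IsTranslationMotion.differentiable {X : ThurstonX} (hX : X = .S2R ∨ X = .H2R)
    {γ : ℝ → Triple} (h : IsTranslationMotion X γ) : Differentiable ℝ γ := by
  rcases hX with rfl | rfl
  · exact h.choose_spec.differentiable
  · exact h.choose_spec.differentiable

/-- A motion of speed zero must still come with a vector w orthogonal to p and suitably normalized;
it is borrowed from the given motion. -/
theorem IsTranslationSegment.const {X : ThurstonX} (hX : X = .S2R ∨ X = .H2R) {P : Triple}
    {γ : ℝ → Triple} (h : IsTranslationSegment X P P γ) :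
    IsTranslationSegment X P P (fun _ => P) := by
  obtain ⟨h, h0, -, -⟩ := h
  rcases hX with rfl | rfl
  · obtain ⟨a, b, p, w, hp, hpw, hw, h⟩ := h
    have hpP : p = P := by simpa [h] using h0
    subst hpP
    have hm : IsS2RMotion 0 (fun _ => p) := ⟨0, p, w, hp, hpw, hw, fun t => by simp⟩
    exact ⟨⟨0, hm⟩, rfl, rfl, fun _ => ⟨0, by simpa using Real.pi_pos.le, hm⟩⟩
  · obtain ⟨a, b, p, w, hp, hpw, hw, h⟩ := h
    have hpP : p = P := by simpa [h] using h0
    subst hpP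
    have hm : IsH2RMotion 0 (fun _ => p) := ⟨0, p, w, hp, hpw, hw, fun t => by simp⟩
    exact ⟨⟨0, hm⟩, rfl, rfl, by simp⟩

/-- The constant segment from a vertex to itself has tangent zero, which makes the three tangents
dependent. This is all that is needed about the shape of the surface: it is not contained in a plane
through 0. -/
theorem vertex_mem_translationSurface {X : ThurstonX} {T : Fin 3 → Triple}
    (hT : IsTranslationTriangle X T) (hG : IsGeneralType X T) (i : Fin 3) :
    T i ∈ translationSurface X T := by
  obtain ⟨hdom, hseg, -⟩ := hT
  refine ⟨hdom i, Or.inr ⟨fun hF => hF.2 hG.2, ?_⟩⟩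
  choose γ hγ using hseg i
  refine ⟨Function.update γ i (fun _ => T i), fun j => deriv (Function.update γ i (fun _ => T i) j) 0,
    fun j => ?_, fun hli => hli.ne_zero i (by simp)⟩
  have hj : IsTranslationSegment X (T i) (T j) (Function.update γ i (fun _ => T i) j) := by
    rcases eq_or_ne j i with rfl | hne
    · simpa using (hγ j).const hG.1
    · simpa [hne] using hγ j
  exact ⟨hj, (hj.1.differentiable hG.1 0).hasDerivAt⟩

theorem ne_zero_of_mem_domain {X : ThurstonX} (hX : X = .S2R ∨ X = .H2R) {P : Triple}
    (h : P ∈ X.domain) : P ≠ 0 := by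
  rcases hX with rfl | rfl
  · exact h
  · rintro rfl
    exact lt_irrefl _ h.1

theorem exists_linearIndependent_of_mem_translationSurface {X : ThurstonX} {T : Fin 3 → Triple}
    (hT : IsTranslationTriangle X T) (hG : IsGeneralType X T) {P : Triple}
    (hP : P ∈ translationSurface X T) : ∃ Q ∈ translationSurface X T,
      ∃ R ∈ translationSurface X T, LinearIndependent ℝ ![P, Q, R] := by
  obtain ⟨i, j, hij⟩ := exists_linearIndependent_triple hG.2 (ne_zero_of_mem_domain hG.1 hP.1)
  exact ⟨_, vertex_mem_translationSurface hT hG i, _, vertex_mem_translationSurface hT hG j, hij⟩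

theorem IsGeneralType.exists_plane {X : ThurstonX} {T : Fin 3 → Triple} (hG : IsGeneralType X T)
    {U C : Set Triple} (hC : IsSurfaceCurve X T U C) :
    ∃ V : Submodule ℝ Triple, finrank ℝ V = 2 ∧ C = {x | x ∈ translationSurface X T ∧ x ∈ V} :=
  hC.elim (fun h => h.2) (fun h => absurd hG h.1)

end GeneralType

/-! ### Straightening the translation curves of `Sol`. -/

section Sol

/-- The integral of `exp (-u t)` from `0` to `t`. -/
noncomputable def expInt (u t : ℝ) : ℝ := if u = 0 then t else (1 - Real.exp (-(u * t))) / u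

theorem expInt_zero (u : ℝ) : expInt u 0 = 0 := by simp [expInt]

theorem one_sub_mul_expInt (u t : ℝ) : 1 - u * expInt u t = Real.exp (-(u * t)) := by
  unfold expInt
  split_ifs with h
  · simp [h]
  · field_simp
    ring

theorem expInt_neg (u t : ℝ) : expInt (-u) t * Real.exp (-(u * t)) = expInt u t := by
  unfold expInt
  by_cases h : u = 0
  · simp [h]
  · have : Real.exp (u * t) * Real.exp (-(u * t)) = 1 := by
      rw [← Real.exp_add]; simp
    simp only [neg_eq_zero, h, if_false, neg_mul, neg_neg]
    field_simp
    linear_combination this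

theorem hasDerivAt_expInt (u t : ℝ) : HasDerivAt (expInt u) (Real.exp (-(u * t))) t := by
  by_cases h : u = 0
  · subst h
    have : expInt 0 = fun t => t := by ext t; simp [expInt]
    rw [this]
    simpa using hasDerivAt_id' t
  · have : expInt u = fun t => (1 - Real.exp (-(u * t))) / u := by ext t; simp [expInt, h]
    rw [this]
    have h1 := (((hasDerivAt_id' t).const_mul u).fun_neg.exp.const_sub 1).div_const u
    refine h1.congr_deriv ?_
    field_simp

/-- This is the condition that a point of the image line lies in the half-space of `solChart`; it
makes a translation curve fill the whole part of its line in that half-space. -/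
theorem exists_expInt_eq {u τ : ℝ} (h : 0 < 1 - u * τ) : ∃ t, expInt u t = τ := by
  by_cases hu : u = 0
  · exact ⟨τ, by simp [expInt, hu]⟩
  · refine ⟨-Real.log (1 - u * τ) / u, ?_⟩
    have : -(u * (-Real.log (1 - u * τ) / u)) = Real.log (1 - u * τ) := by field_simp
    rw [expInt, if_neg hu, this, Real.exp_log h]
    field_simp
    ring

theorem expInt_one_ne_zero (u : ℝ) : expInt u 1 ≠ 0 := by
  intro h
  have h1 := one_sub_mul_expInt u 1
  rw [h, mul_zero, sub_zero, mul_one, eq_comm, Real.exp_eq_one_iff, neg_eq_zero] at h1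
  simp [expInt, h1] at h

/-- The chart of `Sol` that maps the translation curves to straight lines of a half-space. -/
noncomputable def solChart (P : Triple) : Triple :=
  ![Real.exp (-P 2), P 0, P 1 * Real.exp (-P 2)]

theorem solChart_injective : Function.Injective solChart := by
  intro P Q h
  have h0 := congrFun h 0
  have h1 := congrFun h 1
  have h2 := congrFun h 2
  simp only [solChart, Matrix.cons_val] at h0 h1 h2
  rw [h0] at h2
  have h3 := mul_right_cancel₀ (Real.exp_pos _).ne' h2
  have h4 := neg_injective (Real.exp_injective h0)
  ext i; fin_cases i <;> assumption

/-- The translation curve of `Sol` through `P` with initial direction `u`. -/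
noncomputable def solMotion (P u : Triple) (t : ℝ) : Triple :=
  ![P 0 + u 0 * Real.exp (-P 2) * expInt (u 2) t,
    P 1 + u 1 * Real.exp (P 2) * expInt (-u 2) t, P 2 + u 2 * t]

/-- The direction of the image of a translation curve under `solChart`. -/
noncomputable def solDirection (P u : Triple) : Triple :=
  ![-(u 2 * Real.exp (-P 2)), u 0 * Real.exp (-P 2), u 1 - u 2 * (P 1 * Real.exp (-P 2))]

theorem hasDerivAt_solMotion (P u : Triple) (t : ℝ) :
    HasDerivAt (solMotion P u) ![u 0 * Real.exp (-solMotion P u t 2),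
      u 1 * Real.exp (solMotion P u t 2), u 2] t := by
  rw [hasDerivAt_pi]
  intro i
  fin_cases i
  · have := ((hasDerivAt_expInt (u 2) t).const_mul (u 0 * Real.exp (-P 2))).const_add (P 0)
    simp only [solMotion, Fin.zero_eta, Matrix.cons_val]
    convert this using 1
    rw [mul_assoc, ← Real.exp_add]
    ring_nf
  · have := ((hasDerivAt_expInt (-u 2) t).const_mul (u 1 * Real.exp (P 2))).const_add (P 1)
    simp only [solMotion, Fin.mk_one, Matrix.cons_val]
    convert this using 1
    rw [mul_assoc, ← Real.exp_add]
    ring_nf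
  · have := ((hasDerivAt_id t).const_mul (u 2)).const_add (P 2)
    simpa [solMotion] using this

theorem eq_of_hasDerivAt_eq {f g f' : ℝ → ℝ} (hf : ∀ t, HasDerivAt f (f' t) t)
    (hg : ∀ t, HasDerivAt g (f' t) t) (h0 : f 0 = g 0) (t : ℝ) : f t = g t := by
  have h : ∀ t, HasDerivAt (fun t => f t - g t) 0 t := fun t => by
    have := (hf t).fun_sub (hg t)
    rwa [sub_self] at this
  have := is_const_of_deriv_eq_zero (fun t => (h t).differentiableAt) (fun t => (h t).deriv) t 0
  simp only [h0, sub_self] at this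
  exact sub_eq_zero.1 this

theorem eq_solMotion {γ : ℝ → Triple} {u : Triple}
    (h : ∀ t, HasDerivAt γ ![u 0 * Real.exp (-γ t 2), u 1 * Real.exp (γ t 2), u 2] t) :
    γ = solMotion (γ 0) u := by
  have hP := hasDerivAt_solMotion (γ 0) u
  simp only [hasDerivAt_pi] at h hP
  -- The third coordinate comes first: the velocity depends on the position only through it, so the
  -- other two coordinates are then plain integrals.
  have h2 : ∀ t, γ t 2 = solMotion (γ 0) u t 2 :=
    eq_of_hasDerivAt_eq (fun t => h t 2) (fun t => hP t 2) (by simp [solMotion])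
  have h0 : ∀ t, γ t 0 = solMotion (γ 0) u t 0 :=
    eq_of_hasDerivAt_eq (fun t => h t 0) (fun t => by simpa [h2] using hP t 0)
      (by simp [solMotion, expInt_zero])
  have h1 : ∀ t, γ t 1 = solMotion (γ 0) u t 1 :=
    eq_of_hasDerivAt_eq (fun t => h t 1) (fun t => by simpa [h2] using hP t 1)
      (by simp [solMotion, expInt_zero])
  ext t i
  fin_cases i
  · exact h0 t
  · exact h1 t
  · exact h2 t

/-- All three coordinates of the image are affine functions of `expInt (u 2) t`: for the exponential
by `one_sub_mul_expInt`, and for the last one because the factor `exp (-z)` turns `expInt (-u 2)`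
into `expInt (u 2)`. -/
theorem solChart_solMotion (P u : Triple) (t : ℝ) :
    solChart (solMotion P u t) = solChart P + expInt (u 2) t • solDirection P u := by
  have e1 : Real.exp (-(u 2 * t) + -P 2) = Real.exp (-P 2) * Real.exp (-(u 2 * t)) := by
    rw [← Real.exp_add]; ring_nf
  have e2 : Real.exp (P 2) * Real.exp (-P 2) = 1 := by
    rw [← Real.exp_add]; simp
  have e3 := one_sub_mul_expInt (u 2) t
  have e4 := expInt_neg (u 2) t
  ext i
  fin_cases i
  · simp [solChart, solMotion, solDirection, e1]
    linear_combination -Real.exp (-P 2) * e3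
  · simp [solChart, solMotion, solDirection]
    ring
  · simp [solChart, solMotion, solDirection, e1]
    linear_combination (-P 1 * Real.exp (-P 2)) * e3 + u 1 * e4 +
      u 1 * expInt (-u 2) t * Real.exp (-(u 2 * t)) * e2

theorem range_solMotion (P u : Triple) :
    Set.range (solMotion P u) =
      {x | ∃ τ : ℝ, solChart x = solChart P + τ • solDirection P u} := by
  ext x
  constructor
  · rintro ⟨t, rfl⟩
    exact ⟨_, solChart_solMotion P u t⟩
  · rintro ⟨τ, h⟩
    have h0 := congrFun h 0
    simp [solChart, solDirection] at h0
    have hpos : 0 < Real.exp (-P 2) * (1 - u 2 * τ) := by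
      rw [show Real.exp (-P 2) * (1 - u 2 * τ) = Real.exp (-x 2) by linear_combination -h0]
      exact Real.exp_pos _
    obtain ⟨t, rfl⟩ := exists_expInt_eq (pos_of_mul_pos_right hpos (Real.exp_pos _).le)
    exact ⟨t, solChart_injective (by rw [h, solChart_solMotion])⟩

theorem IsTranslationCurve.exists_sol_line {γ : ℝ → Triple} (h : IsTranslationCurve .Sol γ) :
    ∃ c d : Triple, d ≠ 0 ∧ Set.range γ = {x | ∃ τ : ℝ, solChart x = c + τ • d} := by
  obtain ⟨⟨u, hu⟩, s, hs⟩ := h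
  have hγ := eq_solMotion hu
  refine ⟨solChart (γ 0), solDirection (γ 0) u, ?_, ?_⟩
  · intro hd
    refine hs (solChart_injective ?_)
    rw [hγ, solChart_solMotion, solChart_solMotion, hd]
    simp
  · rw [← range_solMotion, ← hγ]

theorem exists_sol_curve (P d : Triple) (hd : d ≠ 0) : ∃ γ, IsTranslationCurve .Sol γ ∧
    Set.range γ = {x | ∃ τ : ℝ, solChart x = solChart P + τ • d} := by
  set s := Real.exp (-P 2) with hs
  have hs0 : s ≠ 0 := (Real.exp_pos _).ne'
  -- The solution of the equation `solDirection P u = d`, which is linear and triangular in u.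
  set u : Triple := ![d 1 / s, d 2 - d 0 / s * (P 1 * s), -d 0 / s] with hu
  have hdir : solDirection P u = d := by
    ext i
    fin_cases i <;> simp [solDirection, u, ← hs] <;> field_simp
    ring
  refine ⟨solMotion P u, ⟨⟨u, hasDerivAt_solMotion P u⟩, 1, fun h => ?_⟩, ?_⟩
  · have h1 := congrArg solChart h
    rw [solChart_solMotion, solChart_solMotion, expInt_zero, hdir] at h1
    simp [expInt_one_ne_zero, hd] at h1
  · rw [range_solMotion, hdir]

theorem exists_sol_triple (P : Triple) : ∃ Q R : Triple,
    LinearIndependent ℝ ![solChart Q - solChart P, solChart R - solChart P] := by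
  refine ⟨P + Pi.single 0 1, P + Pi.single 1 1, ?_⟩
  rw [LinearIndependent.pair_iff]
  intro s t h
  have h1 := congrFun h 1
  have h2 := congrFun h 2
  simp [solChart, add_mul] at h1 h2
  exact ⟨h1, h2⟩

end Sol

/-! ### Charts given as inverses of parametrizations. -/

section Parametrization

variable {E : Type*} [AddCommGroup E] [Module ℝ E]

/-- Pappus's theorem for a family of curves that an injective parametrization represents by the
parts of the straight lines in a subset of an affine space. -/
theorem pappus_of_affine_parametrization {P : Type*} {𝒞 : Set P → Prop} {R : Set E} (f : E → P)
    (hf : Set.InjOn f R)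
    (line_of_curve : ∀ C, 𝒞 C → ∀ p ∈ C, ∀ q ∈ C, p ∈ f '' R → q ∈ f '' R → p ≠ q →
      ∃ c d : E, d ≠ 0 ∧ C = f '' {x | x ∈ R ∧ ∃ t : ℝ, x = c + t • d})
    (curve_of_line : ∀ x ∈ R, ∀ d : E, d ≠ 0 → 𝒞 (f '' {y | y ∈ R ∧ ∃ t : ℝ, y = x + t • d}))
    (exists_triple : ∀ x ∈ R, ∃ y ∈ R, ∃ z ∈ R, LinearIndependent ℝ ![y - x, z - x]) :
    PappusProperty 𝒞 (f '' R) := by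
  have hinv : ∀ x ∈ R, Function.invFunOn f R (f x) = x := fun x hx => hf.leftInvOn_invFunOn hx
  have himage : ∀ c d : E, f '' {x | x ∈ R ∧ ∃ t : ℝ, x = c + t • d} =
      {p | p ∈ f '' R ∧ ∃ t : ℝ, Function.invFunOn f R p = c + t • d} := by
    intro c d
    ext p
    constructor
    · rintro ⟨x, ⟨hx, t, ht⟩, rfl⟩
      exact ⟨⟨x, hx, rfl⟩, t, by rw [hinv x hx, ht]⟩
    · rintro ⟨⟨x, hx, rfl⟩, t, ht⟩
      exact ⟨x, ⟨hx, t, by rw [← hinv x hx, ht]⟩, rfl⟩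
  refine pappus_of_affine_chart (D := f '' R) (Function.invFunOn f R) ?_ ?_ ?_
  · intro C hC p hp q hq hpD hqD hpq
    obtain ⟨c, d, hd, h⟩ := line_of_curve C hC p hp q hq hpD hqD hpq
    exact ⟨c, d, hd, by rw [h, himage]⟩
  · rintro _ ⟨x, hx, rfl⟩ d hd
    rw [← himage, hinv x hx]
    exact curve_of_line x hx d hd
  · rintro _ ⟨x, hx, rfl⟩
    obtain ⟨y, hy, z, hz, h⟩ := exists_triple x hx
    exact ⟨_, ⟨y, hy, rfl⟩, _, ⟨z, hz, rfl⟩, by rwa [hinv x hx, hinv y hy, hinv z hz]⟩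

theorem linearIndependent_of_scaled_axes {x : ℝ × ℝ} {r s : ℝ} (hr : r ≠ 0) (hs : s ≠ 0) :
    LinearIndependent ℝ ![(x + (r, 0)) - x, (x + (0, s)) - x] := by
  rw [LinearIndependent.pair_iff]
  intro u v h
  simpa [hr, hs] using h

end Parametrization

theorem exists_normal {T : Fin 3 → Triple} (hT : ¬ LinearIndependent ℝ T) :
    ∃ n : Triple, n ≠ 0 ∧ ∀ P ∈ Submodule.span ℝ (Set.range T), n ⬝ᵥ P = 0 := by
  have hdet : Matrix.det (Matrix.of T) = 0 := by
    by_contra h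
    refine hT ((Matrix.linearIndependent_rows_iff_isUnit (A := Matrix.of T)).2 ?_)
    rw [Matrix.isUnit_iff_isUnit_det]
    exact isUnit_iff_ne_zero.2 h
  obtain ⟨n, hn, h⟩ := Matrix.exists_mulVec_eq_zero_iff.2 hdet
  refine ⟨n, hn, fun P hP => ?_⟩
  induction hP using Submodule.span_induction with
  | mem x hx =>
    obtain ⟨i, rfl⟩ := hx
    rw [dotProduct_comm]
    exact congrFun h i
  | zero => simp
  | add x y _ _ hx hy => rw [dotProduct_add, hx, hy, add_zero]
  | smul c x _ hx => rw [dotProduct_smul, hx, smul_zero]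

/-! ### Geodesics of `S² × ℝ` over one great circle. -/

section Sphere

/-- Orthonormal vectors, the first two of which span the plane `n ⬝ᵥ P = 0`. -/
structure IsFrame (n e₁ e₂ : Triple) : Prop where
  nn : n ⬝ᵥ n = 1
  ee₁ : e₁ ⬝ᵥ e₁ = 1
  ee₂ : e₂ ⬝ᵥ e₂ = 1
  ne₁ : n ⬝ᵥ e₁ = 0
  ne₂ : n ⬝ᵥ e₂ = 0
  e₁e₂ : e₁ ⬝ᵥ e₂ = 0

theorem exists_smul_dotProduct_self {v : Triple} (hv : v ≠ 0) :
    ∃ r : ℝ, 0 < r ∧ (r • v) ⬝ᵥ (r • v) = 1 := by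
  have h0 : 0 < v ⬝ᵥ v := by
    refine lt_of_le_of_ne ?_ (fun h => hv (dotProduct_self_eq_zero.1 h.symm))
    exact Finset.sum_nonneg fun i _ => mul_self_nonneg _
  refine ⟨(Real.sqrt (v ⬝ᵥ v))⁻¹, by positivity, ?_⟩
  have h1 := Real.mul_self_sqrt h0.le
  have h2 : Real.sqrt (v ⬝ᵥ v) ≠ 0 := by positivity
  rw [smul_dotProduct, dotProduct_smul, smul_eq_mul, smul_eq_mul]
  field_simp
  rw [sq, h1]

theorem IsFrame.expand {n e₁ e₂ : Triple} (h : IsFrame n e₁ e₂) {P : Triple} (hP : n ⬝ᵥ P = 0) :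
    P = (e₁ ⬝ᵥ P) • e₁ + (e₂ ⬝ᵥ P) • e₂ := by
  set M : Matrix (Fin 3) (Fin 3) ℝ := Matrix.of ![n, e₁, e₂] with hM
  have h1 : M * Mᵀ = 1 := by
    ext i j
    have : (M * Mᵀ) i j = ![n, e₁, e₂] i ⬝ᵥ ![n, e₁, e₂] j := rfl
    rw [this]
    fin_cases i <;> fin_cases j <;>
      simp [h.nn, h.ee₁, h.ee₂, h.ne₁, h.ne₂, h.e₁e₂, dotProduct_comm e₁ n,
        dotProduct_comm e₂ n, dotProduct_comm e₂ e₁]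
  have h2 : Mᵀ *ᵥ (M *ᵥ P) = P := by
    rw [Matrix.mulVec_mulVec, mul_eq_one_comm.1 h1, Matrix.one_mulVec]
  have h3 : M *ᵥ P = ![0, e₁ ⬝ᵥ P, e₂ ⬝ᵥ P] := by
    ext i
    fin_cases i
    · exact hP
    · rfl
    · rfl
  rw [h3] at h2
  nth_rewrite 1 [← h2]
  ext i
  simp [Matrix.mulVec, dotProduct, Fin.sum_univ_three, hM]
  ring

/-- The vector e₁ is the normalized projection of l to the plane orthogonal to n. With this choice
the half-space of l is described in polar coordinates by a positive cosine. -/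
theorem exists_frame {n l A : Triple} (hn : n ≠ 0) (hA : n ⬝ᵥ A = 0) (hl : 0 < l ⬝ᵥ A) :
    ∃ (r : ℝ) (e₁ e₂ : Triple), r ≠ 0 ∧ IsFrame (r • n) e₁ e₂ ∧ 0 < l ⬝ᵥ e₁ ∧ l ⬝ᵥ e₂ = 0 := by
  obtain ⟨r, hr, hnn⟩ := exists_smul_dotProduct_self hn
  set m := r • n with hm
  have hmA : m ⬝ᵥ A = 0 := by rw [hm, smul_dotProduct, hA, smul_zero]
  set k := l - (l ⬝ᵥ m) • m with hk
  have hmk : m ⬝ᵥ k = 0 := by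
    rw [hk, dotProduct_sub, dotProduct_smul, hnn, dotProduct_comm m l]; simp
  have hkA : k ⬝ᵥ A = l ⬝ᵥ A := by
    rw [hk, sub_dotProduct, smul_dotProduct, hmA]; simp
  have hk0 : k ≠ 0 := by
    intro h
    rw [h, zero_dotProduct] at hkA
    exact hl.ne hkA
  obtain ⟨s, hs, hee⟩ := exists_smul_dotProduct_self hk0
  have hlk : l = k + (l ⬝ᵥ m) • m := by rw [hk]; abel
  have hme : m ⬝ᵥ (s • k) = 0 := by rw [dotProduct_smul, hmk, smul_zero]
  have hle : ∀ v, m ⬝ᵥ v = 0 → l ⬝ᵥ v = s⁻¹ * ((s • k) ⬝ᵥ v) := by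
    intro v hv
    nth_rewrite 1 [hlk]
    rw [add_dotProduct, smul_dotProduct, hv, smul_dotProduct, smul_zero, add_zero, smul_eq_mul,
      inv_mul_cancel_left₀ hs.ne']
  have hmc : m ⬝ᵥ (m ⨯₃ (s • k)) = 0 := dot_self_cross _ _
  have hec : (s • k) ⬝ᵥ (m ⨯₃ (s • k)) = 0 := dot_cross_self _ _
  refine ⟨r, s • k, m ⨯₃ (s • k), hr.ne', ⟨hnn, hee, ?_, hme, hmc, hec⟩, ?_, ?_⟩
  · rw [cross_dot_cross, hnn, hee, dotProduct_comm (s • k) m, hme]; simp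
  · rw [hle _ hme, hee]; positivity
  · rw [hle _ hmc, hec, mul_zero]

/-- Polar coordinates, with logarithmic radius, in the plane spanned by `e₁` and `e₂`. -/
noncomputable def polar (e₁ e₂ : Triple) (x : ℝ × ℝ) : Triple :=
  Real.exp x.1 • (Real.cos x.2 • e₁ + Real.sin x.2 • e₂)

variable {n e₁ e₂ : Triple}

theorem IsFrame.dot_polar₁ (h : IsFrame n e₁ e₂) (x : ℝ × ℝ) :
    e₁ ⬝ᵥ polar e₁ e₂ x = Real.exp x.1 * Real.cos x.2 := by
  simp [polar, dotProduct_add, dotProduct_smul, h.ee₁, h.e₁e₂]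

theorem IsFrame.dot_polar₂ (h : IsFrame n e₁ e₂) (x : ℝ × ℝ) :
    e₂ ⬝ᵥ polar e₁ e₂ x = Real.exp x.1 * Real.sin x.2 := by
  simp [polar, dotProduct_add, dotProduct_smul, h.ee₂, dotProduct_comm e₂ e₁, h.e₁e₂]

theorem dot_polar_of_dot_eq_zero {l : Triple} (hl : l ⬝ᵥ e₂ = 0) (x : ℝ × ℝ) :
    l ⬝ᵥ polar e₁ e₂ x = Real.exp x.1 * (Real.cos x.2 * (l ⬝ᵥ e₁)) := by
  simp [polar, dotProduct_add, dotProduct_smul, hl]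

theorem IsFrame.injOn_polar (h : IsFrame n e₁ e₂) :
    Set.InjOn (polar e₁ e₂) {x | |x.2| < Real.pi / 2} := by
  intro x hx y hy hxy
  have h1 := h.dot_polar₁ x
  have h2 := h.dot_polar₂ x
  rw [hxy, h.dot_polar₁] at h1
  rw [hxy, h.dot_polar₂] at h2
  have hr : Real.exp y.1 = Real.exp x.1 := by
    have hsq : Real.exp y.1 ^ 2 = Real.exp x.1 ^ 2 := by
      have := Real.sin_sq_add_cos_sq x.2
      have := Real.sin_sq_add_cos_sq y.2
      calc Real.exp y.1 ^ 2 = (Real.exp y.1 * Real.cos y.2) ^ 2 + (Real.exp y.1 * Real.sin y.2) ^ 2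
            := by linear_combination (-Real.exp y.1 ^ 2) * this
        _ = (Real.exp x.1 * Real.cos x.2) ^ 2 + (Real.exp x.1 * Real.sin x.2) ^ 2 := by rw [h1, h2]
        _ = _ := by linear_combination (Real.exp x.1 ^ 2) * ‹Real.sin x.2 ^ 2 + _ = 1›
    exact (sq_eq_sq₀ (Real.exp_pos _).le (Real.exp_pos _).le).1 hsq
  rw [hr] at h2
  have h3 := mul_left_cancel₀ (Real.exp_pos _).ne' h2
  have hx' := abs_lt.1 (show |x.2| < Real.pi / 2 from hx)
  have hy' := abs_lt.1 (show |y.2| < Real.pi / 2 from hy)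
  exact Prod.ext (Real.exp_injective hr.symm)
    (Real.injOn_sin ⟨by linarith [hx'.1], hx'.2.le⟩ ⟨by linarith [hy'.1], hy'.2.le⟩ h3.symm)

theorem exists_exp_mul_cos_sin {x y : ℝ} (h : x ≠ 0 ∨ y ≠ 0) :
    ∃ r t : ℝ, x = Real.exp r * Real.cos t ∧ y = Real.exp r * Real.sin t := by
  set z : ℂ := ⟨x, y⟩ with hz
  have hz0 : z ≠ 0 := by
    intro h0
    rw [Complex.ext_iff] at h0
    simp [hz] at h0
    tauto
  have h1 := Complex.exp_log hz0
  refine ⟨(Complex.log z).re, (Complex.log z).im, ?_, ?_⟩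
  · rw [← Complex.exp_re, h1]
  · rw [← Complex.exp_im, h1]

theorem IsFrame.exists_polar_eq (h : IsFrame n e₁ e₂) {P : Triple} (hP : n ⬝ᵥ P = 0)
    (hP0 : P ≠ 0) : ∃ x, P = polar e₁ e₂ x := by
  have hexp := h.expand hP
  obtain ⟨r, t, h1, h2⟩ := exists_exp_mul_cos_sin (x := e₁ ⬝ᵥ P) (y := e₂ ⬝ᵥ P) (by
    by_contra! h0
    rw [h0.1, h0.2] at hexp
    simp at hexp
    exact hP0 hexp)
  refine ⟨(r, t), ?_⟩
  rw [hexp, h1, h2, polar]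
  module

theorem exists_abs_lt_of_cos_pos {t : ℝ} (ht : 0 < Real.cos t) :
    ∃ k : ℤ, |t + k * (2 * Real.pi)| < Real.pi / 2 := by
  refine ⟨-round (t / (2 * Real.pi)), ?_⟩
  have hpi := Real.pi_pos
  set s := t + ((-round (t / (2 * Real.pi)) : ℤ) : ℝ) * (2 * Real.pi) with hs
  have h1 : |s| ≤ Real.pi := by
    have h2 := abs_sub_round (t / (2 * Real.pi))
    have h3 : s = (t / (2 * Real.pi) - round (t / (2 * Real.pi))) * (2 * Real.pi) := by
      rw [hs]; push_cast; field_simp; ring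
    rw [h3, abs_mul, abs_of_pos (by positivity : 0 < 2 * Real.pi)]
    nlinarith
  have h4 : 0 < Real.cos s := by rwa [hs, Real.cos_add_int_mul_two_pi]
  by_contra! h5
  rw [← Real.cos_abs] at h4
  have := Real.cos_nonpos_of_pi_div_two_le_of_le h5 (by linarith)
  linarith

theorem polar_add_int_mul_two_pi (x : ℝ × ℝ) (k : ℤ) :
    polar e₁ e₂ (x.1, x.2 + k * (2 * Real.pi)) = polar e₁ e₂ x := by
  simp [polar, Real.cos_add_int_mul_two_pi, Real.sin_add_int_mul_two_pi]

theorem IsFrame.isS2RMotion_polar (h : IsFrame n e₁ e₂) (x d : ℝ × ℝ) :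
    IsS2RMotion d.2 (fun t => polar e₁ e₂ (x + t • d)) := by
  have hd : ∀ v w : Triple, v ⬝ᵥ w = v 0 * w 0 + v 1 * w 1 + v 2 * w 2 := by
    intro v w; simp [dotProduct, Fin.sum_univ_three]
  have h11 := h.ee₁
  have h22 := h.ee₂
  have h12 := h.e₁e₂
  rw [hd] at h11 h22 h12
  have hcs := Real.sin_sq_add_cos_sq x.2
  refine ⟨d.1, polar e₁ e₂ x, Real.exp x.1 • (Real.cos x.2 • e₂ - Real.sin x.2 • e₁), ?_, ?_, ?_, ?_⟩
  · intro h0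
    have h1 := h.dot_polar₁ x
    have h2 := h.dot_polar₂ x
    rw [h0, dotProduct_zero] at h1 h2
    have h3 : Real.cos x.2 = 0 := by simpa using h1.symm
    have h4 : Real.sin x.2 = 0 := by simpa using h2.symm
    rw [h3, h4] at hcs
    norm_num at hcs
  · simp [polar]
    linear_combination (Real.exp x.1 ^ 2 * Real.cos x.2 * Real.sin x.2) * (h22 - h11) +
      (Real.exp x.1 ^ 2) * (Real.cos x.2 ^ 2 - Real.sin x.2 ^ 2) * h12
  · simp [polar]
    linear_combination (Real.exp x.1 ^ 2 * (Real.cos x.2 ^ 2 - Real.sin x.2 ^ 2)) * (h22 - h11) -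
      4 * (Real.exp x.1 ^ 2) * (Real.cos x.2 * Real.sin x.2) * h12
  · intro t
    simp only [polar, Prod.fst_add, Prod.snd_add, Prod.smul_fst, Prod.smul_snd, smul_eq_mul,
      Real.exp_add, Real.cos_add, Real.sin_add, mul_comm t]
    module

/-- Two points of the geodesic in the plane give linear equations for the products of n with p and
w, of determinant `sin (a (t₁ - t₂))` up to sign. If it is not zero, the whole geodesic lies in the
plane. For a = 0 the geodesic is a fibre, and one point suffices. -/
theorem IsFrame.exists_eq_polar (h : IsFrame n e₁ e₂) {a : ℝ} {γ : ℝ → Triple}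
    (hγ : IsS2RMotion a γ) {t₁ t₂ : ℝ} (ht : a ≠ 0 → Real.sin (a * (t₁ - t₂)) ≠ 0)
    (h₁ : n ⬝ᵥ γ t₁ = 0) (h₂ : n ⬝ᵥ γ t₂ = 0) :
    ∃ x d, ∀ t, γ t = polar e₁ e₂ (x + t • d) := by
  have hd : ∀ v w : Triple, v 0 * w 0 + v 1 * w 1 + v 2 * w 2 = v ⬝ᵥ w := by
    intro v w; simp [dotProduct, Fin.sum_univ_three]
  obtain ⟨b, p, w, hp, hpw, hw, hγ⟩ := hγ
  by_cases ha : a = 0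
  · subst ha
    rw [hγ] at h₁
    obtain ⟨x, hx⟩ := h.exists_polar_eq (P := p) (by simpa using h₁) hp
    refine ⟨x, (b, 0), fun t => ?_⟩
    rw [hγ, hx]
    simp only [polar, Prod.fst_add, Prod.snd_add, Prod.smul_fst, Prod.smul_snd, smul_eq_mul,
      Real.exp_add, mul_comm t, zero_mul, Real.cos_zero, Real.sin_zero, add_zero]
    module
  rw [hγ, dotProduct_smul, dotProduct_add, dotProduct_smul, dotProduct_smul] at h₁ h₂
  simp only [smul_eq_mul, mul_eq_zero, (Real.exp_pos _).ne', false_or] at h₁ h₂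
  have hs := ht ha
  rw [mul_sub, Real.sin_sub] at hs
  have hnp : n ⬝ᵥ p = 0 := by
    refine (mul_eq_zero.1 ?_).resolve_left hs
    linear_combination Real.sin (a * t₁) * h₂ - Real.sin (a * t₂) * h₁
  have hnw : n ⬝ᵥ w = 0 := by
    refine (mul_eq_zero.1 ?_).resolve_left hs
    linear_combination Real.cos (a * t₂) * h₁ - Real.cos (a * t₁) * h₂
  obtain ⟨x, rfl⟩ := h.exists_polar_eq hnp hp
  have hw' := h.expand hnw
  simp only [sq, hd] at hpw hw
  have hcs := Real.sin_sq_add_cos_sq x.2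
  have e1 : Real.cos x.2 * (e₁ ⬝ᵥ w) + Real.sin x.2 * (e₂ ⬝ᵥ w) = 0 := by
    rw [polar, smul_dotProduct, add_dotProduct, smul_dotProduct, smul_dotProduct] at hpw
    simpa using hpw
  have e2 : (e₁ ⬝ᵥ w) ^ 2 + (e₂ ⬝ᵥ w) ^ 2 = Real.exp x.1 ^ 2 := by
    have h3 : w ⬝ᵥ w = (e₁ ⬝ᵥ w) ^ 2 + (e₂ ⬝ᵥ w) ^ 2 := by
      nth_rewrite 1 [hw']
      rw [add_dotProduct, smul_dotProduct, smul_dotProduct]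
      simp only [smul_eq_mul]; ring
    have h4 : polar e₁ e₂ x ⬝ᵥ polar e₁ e₂ x = Real.exp x.1 ^ 2 := by
      nth_rewrite 1 [polar]
      rw [smul_dotProduct, add_dotProduct, smul_dotProduct, smul_dotProduct, h.dot_polar₁,
        h.dot_polar₂]
      simp only [smul_eq_mul]
      linear_combination Real.exp x.1 ^ 2 * hcs
    rw [← h3, hw, h4]
  -- In the plane, w is p turned by a right angle in one of two senses; σ = ±1 records the sense.
  set σ := (Real.cos x.2 * (e₂ ⬝ᵥ w) - Real.sin x.2 * (e₁ ⬝ᵥ w)) / Real.exp x.1 with hσ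
  have hE := (Real.exp_pos x.1).ne'
  have hσE : σ * Real.exp x.1 = Real.cos x.2 * (e₂ ⬝ᵥ w) - Real.sin x.2 * (e₁ ⬝ᵥ w) := by
    rw [hσ]; field_simp
  have hσ2 : σ ^ 2 = 1 := by
    have : Real.exp x.1 ^ 2 * σ ^ 2 = Real.exp x.1 ^ 2 * 1 := by
      rw [← mul_pow, mul_comm, hσE, mul_one, ← e2]
      linear_combination ((e₁ ⬝ᵥ w) ^ 2 + (e₂ ⬝ᵥ w) ^ 2) * hcs -
        (Real.cos x.2 * (e₁ ⬝ᵥ w) + Real.sin x.2 * (e₂ ⬝ᵥ w)) * e1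
    exact mul_left_cancel₀ (pow_ne_zero 2 hE) this
  have hw1 : e₁ ⬝ᵥ w = -(σ * Real.exp x.1 * Real.sin x.2) := by
    rw [hσE]; linear_combination -(e₁ ⬝ᵥ w) * hcs + Real.cos x.2 * e1
  have hw2 : e₂ ⬝ᵥ w = σ * Real.exp x.1 * Real.cos x.2 := by
    rw [hσE]; linear_combination -(e₂ ⬝ᵥ w) * hcs + Real.sin x.2 * e1
  refine ⟨x, (b, σ * a), fun t => ?_⟩
  have hσ1 : σ = 1 ∨ σ = -1 := sq_eq_sq_iff_eq_or_eq_neg.1 (by rw [hσ2, one_pow])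
  have hcσ : Real.cos (σ * a * t) = Real.cos (a * t) := by
    rcases hσ1 with h | h <;> simp [h]
  have hsσ : Real.sin (σ * a * t) = σ * Real.sin (a * t) := by
    rcases hσ1 with h | h <;> simp [h]
  rw [hγ, hw', hw1, hw2]
  simp only [polar, Prod.fst_add, Prod.snd_add, Prod.smul_fst, Prod.smul_snd, smul_eq_mul,
    Real.exp_add, Real.cos_add, Real.sin_add, mul_comm t, hcσ, hsσ]
  module

end Sphere

/-! ### Geodesics of `H² × ℝ` over one hyperbolic line. -/

section Hyperbolic

/-- The Lorentz form. -/
def lorentz (v w : Triple) : ℝ := v 0 * w 0 - v 1 * w 1 - v 2 * w 2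

theorem lorentz_add_left (u v w : Triple) : lorentz (u + v) w = lorentz u w + lorentz v w := by
  simp [lorentz]; ring

theorem lorentz_smul_left (c : ℝ) (v w : Triple) : lorentz (c • v) w = c * lorentz v w := by
  simp [lorentz]; ring

theorem lorentz_comm (v w : Triple) : lorentz v w = lorentz w v := by
  simp [lorentz]; ring

theorem lorentz_add_right (u v w : Triple) : lorentz u (v + w) = lorentz u v + lorentz u w := by
  simp [lorentz]; ring

theorem lorentz_smul_right (c : ℝ) (v w : Triple) : lorentz v (c • w) = c * lorentz v w := by
  simp [lorentz]; ring

/-- By the Cauchy–Schwarz inequality for the last two coordinates. -/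
theorem lorentz_pos {P Q : Triple} (hP : P ∈ ThurstonX.H2R.domain)
    (hQ : Q ∈ ThurstonX.H2R.domain) : 0 < lorentz P Q := by
  obtain ⟨hP0, hP⟩ := hP
  obtain ⟨hQ0, hQ⟩ := hQ
  have h1 : (P 1 * Q 1 + P 2 * Q 2) ^ 2 ≤ (P 1 ^ 2 + P 2 ^ 2) * (Q 1 ^ 2 + Q 2 ^ 2) := by
    nlinarith [sq_nonneg (P 1 * Q 2 - P 2 * Q 1)]
  have h2 : (P 1 ^ 2 + P 2 ^ 2) * (Q 1 ^ 2 + Q 2 ^ 2) < P 0 ^ 2 * Q 0 ^ 2 :=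
    mul_lt_mul'' hP hQ (by positivity) (by positivity)
  have h3 : P 1 * Q 1 + P 2 * Q 2 < P 0 * Q 0 := by
    refine lt_of_pow_lt_pow_left₀ 2 (by positivity) ?_
    rw [mul_pow]
    exact h1.trans_lt h2
  unfold lorentz
  linarith

/-- A vector orthogonal to a time-like vector is space-like. -/
theorem lorentz_self_neg {e k : Triple} (he : lorentz e e = 1) (hek : lorentz e k = 0)
    (hk : k ≠ 0) : lorentz k k < 0 := by
  unfold lorentz at *
  by_contra! h
  have h1 : k 0 = 0 := by
    have h2 : (e 1 * k 1 + e 2 * k 2) ^ 2 ≤ (e 1 ^ 2 + e 2 ^ 2) * (k 1 ^ 2 + k 2 ^ 2) := by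
      nlinarith [sq_nonneg (e 1 * k 2 - e 2 * k 1)]
    have h3 : (e 0 * k 0) ^ 2 = (e 1 * k 1 + e 2 * k 2) ^ 2 := by
      congr 1; linarith
    have h4 : (e 1 ^ 2 + e 2 ^ 2) * (k 1 ^ 2 + k 2 ^ 2) ≤ (e 1 ^ 2 + e 2 ^ 2) * k 0 ^ 2 :=
      mul_le_mul_of_nonneg_left (by linarith) (by positivity)
    have h5 : (e 0 * k 0) ^ 2 = (1 + (e 1 ^ 2 + e 2 ^ 2)) * k 0 ^ 2 := by
      linear_combination (k 0 ^ 2) * he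
    nlinarith
  rw [h1] at h
  have h2 : k 1 = 0 := by nlinarith
  have h3 : k 2 = 0 := by nlinarith
  apply hk
  ext i; fin_cases i <;> assumption

/-- Vectors, orthonormal for the Lorentz form, that span the plane `n ⬝ᵥ P = 0`. -/
structure IsLorentzFrame (n e₁ e₂ : Triple) : Prop where
  ne_zero : n ≠ 0
  pos : 0 < e₁ 0
  ee₁ : lorentz e₁ e₁ = 1
  ee₂ : lorentz e₂ e₂ = -1
  e₁e₂ : lorentz e₁ e₂ = 0
  ne₁ : n ⬝ᵥ e₁ = 0
  ne₂ : n ⬝ᵥ e₂ = 0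

variable {n e₁ e₂ : Triple}

theorem IsLorentzFrame.linearIndependent (h : IsLorentzFrame n e₁ e₂) :
    LinearIndependent ℝ ![e₁, e₂] := by
  rw [LinearIndependent.pair_iff]
  intro s t hst
  have h1 : lorentz e₁ (s • e₁ + t • e₂) = 0 := by rw [hst]; simp [lorentz]
  have h2 : lorentz e₂ (s • e₁ + t • e₂) = 0 := by rw [hst]; simp [lorentz]
  rw [lorentz_add_right, lorentz_smul_right, lorentz_smul_right] at h1 h2
  rw [h.ee₁, h.e₁e₂] at h1
  rw [lorentz_comm e₂ e₁, h.e₁e₂, h.ee₂] at h2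
  constructor <;> linarith

theorem IsLorentzFrame.expand (h : IsLorentzFrame n e₁ e₂) {P : Triple} (hP : n ⬝ᵥ P = 0) :
    P = (lorentz e₁ P) • e₁ + (-lorentz e₂ P) • e₂ := by
  have hdet : Matrix.det (Matrix.of ![e₁, e₂, P]) = 0 := by
    refine Matrix.exists_mulVec_eq_zero_iff.1 ⟨n, h.ne_zero, ?_⟩
    ext i
    fin_cases i
    · exact (dotProduct_comm _ _).trans h.ne₁
    · exact (dotProduct_comm _ _).trans h.ne₂
    · exact (dotProduct_comm _ _).trans hP
  obtain ⟨s, t, rfl⟩ := Submodule.mem_span_pair.1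
    (mem_span_pair_of_det_eq_zero h.linearIndependent hdet)
  simp [lorentz_add_right, lorentz_smul_right, h.ee₁, h.e₁e₂, h.ee₂, lorentz_comm e₂ e₁]

theorem exists_lorentzFrame {A : Triple} (hn : n ≠ 0) (hA : n ⬝ᵥ A = 0)
    (hA' : A ∈ ThurstonX.H2R.domain) : ∃ e₁ e₂, IsLorentzFrame n e₁ e₂ := by
  have hq : 0 < lorentz A A := lorentz_pos hA' hA'
  have hs : 0 < Real.sqrt (lorentz A A) := Real.sqrt_pos.2 hq
  set e₁ := (Real.sqrt (lorentz A A))⁻¹ • A with he₁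
  have h11 : lorentz e₁ e₁ = 1 := by
    rw [he₁, lorentz_smul_left, lorentz_smul_right]
    field_simp
    rw [Real.sq_sqrt hq.le]
  have hn1 : n ⬝ᵥ e₁ = 0 := by rw [he₁, dotProduct_smul, hA, smul_zero]
  have hpos : 0 < e₁ 0 := mul_pos (inv_pos.2 hs) hA'.1
  -- Euclidean orthogonality to j is Lorentz orthogonality to e₁, so the cross product of n and j is
  -- a second vector of the plane, Lorentz orthogonal to e₁.
  set j : Triple := ![e₁ 0, -e₁ 1, -e₁ 2] with hj
  have hjl : ∀ v, j ⬝ᵥ v = lorentz e₁ v := by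
    intro v; simp [hj, lorentz, dotProduct, Fin.sum_univ_three]; ring
  set k := n ⨯₃ j with hk
  have hek : lorentz e₁ k = 0 := by rw [← hjl]; exact dot_cross_self _ _
  have hnk : n ⬝ᵥ k = 0 := dot_self_cross _ _
  have hk0 : k ≠ 0 := by
    intro h0
    have h1 : e₁ ⨯₃ (n ⨯₃ j) = (e₁ ⬝ᵥ j) • n - (e₁ ⬝ᵥ n) • j := by
      ext i
      fin_cases i <;> simp [cross_apply, dotProduct, Fin.sum_univ_three] <;> ring
    rw [← hk, h0, dotProduct_comm e₁ j, hjl, h11, dotProduct_comm e₁ n, hn1] at h1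
    simp at h1
    exact hn h1.symm
  have hkk := lorentz_self_neg h11 hek hk0
  have hs' : 0 < Real.sqrt (-lorentz k k) := Real.sqrt_pos.2 (by linarith)
  refine ⟨e₁, (Real.sqrt (-lorentz k k))⁻¹ • k, hn, hpos, h11, ?_, ?_, hn1, ?_⟩
  · rw [lorentz_smul_left, lorentz_smul_right]
    field_simp
    rw [Real.sq_sqrt (by linarith)]
    ring
  · rw [lorentz_smul_right, hek, mul_zero]
  · rw [dotProduct_smul, hnk, smul_zero]

/-- Hyperbolic polar coordinates, with logarithmic radius, in the plane spanned by `e₁` and `e₂`. -/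
noncomputable def hpolar (e₁ e₂ : Triple) (x : ℝ × ℝ) : Triple :=
  Real.exp x.1 • (Real.cosh x.2 • e₁ + Real.sinh x.2 • e₂)

theorem IsLorentzFrame.lorentz_hpolar₁ (h : IsLorentzFrame n e₁ e₂) (x : ℝ × ℝ) :
    lorentz e₁ (hpolar e₁ e₂ x) = Real.exp x.1 * Real.cosh x.2 := by
  simp [hpolar, lorentz_add_right, lorentz_smul_right, h.ee₁, h.e₁e₂]

theorem IsLorentzFrame.lorentz_hpolar₂ (h : IsLorentzFrame n e₁ e₂) (x : ℝ × ℝ) :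
    lorentz e₂ (hpolar e₁ e₂ x) = -(Real.exp x.1 * Real.sinh x.2) := by
  simp [hpolar, lorentz_add_right, lorentz_smul_right, h.ee₂, lorentz_comm e₂ e₁, h.e₁e₂]

theorem IsLorentzFrame.lorentz_hpolar_self (h : IsLorentzFrame n e₁ e₂) (x : ℝ × ℝ) :
    lorentz (hpolar e₁ e₂ x) (hpolar e₁ e₂ x) = Real.exp x.1 ^ 2 := by
  nth_rewrite 1 [hpolar]
  rw [lorentz_smul_left, lorentz_add_left, lorentz_smul_left, lorentz_smul_left,
    h.lorentz_hpolar₁, h.lorentz_hpolar₂]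
  linear_combination Real.exp x.1 ^ 2 * Real.cosh_sq x.2

theorem IsLorentzFrame.hpolar_injective (h : IsLorentzFrame n e₁ e₂) :
    Function.Injective (hpolar e₁ e₂) := by
  intro x y hxy
  have h2 := h.lorentz_hpolar₂ x
  have h3 := h.lorentz_hpolar_self x
  rw [hxy, h.lorentz_hpolar₂] at h2
  rw [hxy, h.lorentz_hpolar_self] at h3
  have hr := (sq_eq_sq₀ (Real.exp_pos _).le (Real.exp_pos _).le).1 h3
  rw [hr] at h2
  have h4 := mul_left_cancel₀ (Real.exp_pos _).ne' (neg_injective h2)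
  exact Prod.ext (Real.exp_injective hr.symm) (Real.sinh_injective h4.symm)

theorem IsLorentzFrame.hpolar_mem_domain (h : IsLorentzFrame n e₁ e₂) (x : ℝ × ℝ) :
    hpolar e₁ e₂ x ∈ ThurstonX.H2R.domain := by
  have h1 : (e₂ 0) ^ 2 < (e₁ 0) ^ 2 := by
    have h11 := h.ee₁
    have h22 := h.ee₂
    have h12 := h.e₁e₂
    unfold lorentz at h11 h22 h12
    have h3 : (e₁ 1 * e₂ 1 + e₁ 2 * e₂ 2) ^ 2 ≤
        (e₁ 1 ^ 2 + e₁ 2 ^ 2) * (e₂ 1 ^ 2 + e₂ 2 ^ 2) := by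
      nlinarith [sq_nonneg (e₁ 1 * e₂ 2 - e₁ 2 * e₂ 1)]
    rw [show e₁ 1 * e₂ 1 + e₁ 2 * e₂ 2 = e₁ 0 * e₂ 0 by linarith,
      show e₁ 1 ^ 2 + e₁ 2 ^ 2 = e₁ 0 ^ 2 - 1 by linarith,
      show e₂ 1 ^ 2 + e₂ 2 ^ 2 = e₂ 0 ^ 2 + 1 by linarith] at h3
    nlinarith
  have h2 : |Real.sinh x.2| < Real.cosh x.2 := by
    refine abs_lt_of_sq_lt_sq ?_ (Real.cosh_pos _).le
    linarith [Real.cosh_sq x.2]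
  have h3 : |e₂ 0| < e₁ 0 := abs_lt_of_sq_lt_sq h1 h.pos.le
  have h4 := h.lorentz_hpolar_self x
  have h5 : 0 < Real.exp x.1 ^ 2 := by positivity
  refine ⟨?_, ?_⟩
  · have h6 : |Real.sinh x.2 * e₂ 0| < Real.cosh x.2 * e₁ 0 := by
      rw [abs_mul]
      exact mul_lt_mul'' h2 h3 (abs_nonneg _) (abs_nonneg _)
    have h7 := (abs_lt.1 h6).1
    have h8 : 0 < Real.cosh x.2 * e₁ 0 + Real.sinh x.2 * e₂ 0 := by linarith
    simpa [hpolar] using mul_pos (Real.exp_pos x.1) h8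
  · unfold lorentz at h4
    nlinarith

theorem IsLorentzFrame.exists_hpolar_eq (h : IsLorentzFrame n e₁ e₂) {P : Triple}
    (hP : n ⬝ᵥ P = 0) (hP' : P ∈ ThurstonX.H2R.domain) : ∃ x, P = hpolar e₁ e₂ x := by
  have he₁ : e₁ ∈ ThurstonX.H2R.domain := by
    have h11 := h.ee₁
    unfold lorentz at h11
    exact ⟨h.pos, by nlinarith⟩
  have hc : 0 < lorentz e₁ P := lorentz_pos he₁ hP'
  have hexp := h.expand hP
  have hq := lorentz_pos hP' hP'
  have hqq : lorentz P P = lorentz e₁ P ^ 2 - lorentz e₂ P ^ 2 := by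
    nth_rewrite 1 [hexp]
    rw [lorentz_add_left, lorentz_smul_left, lorentz_smul_left]
    ring
  set q := lorentz P P
  have hr : Real.exp (Real.log q / 2) ^ 2 = q := by
    rw [← Real.exp_nat_mul]
    push_cast
    rw [mul_div_cancel₀ _ two_ne_zero, Real.exp_log hq]
  set r := Real.log q / 2
  have hE := Real.exp_pos r
  set θ := Real.arsinh (-lorentz e₂ P / Real.exp r) with hθ
  have hsinh : Real.exp r * Real.sinh θ = -lorentz e₂ P := by
    rw [hθ, Real.sinh_arsinh]; field_simp
  have hcosh : Real.exp r * Real.cosh θ = lorentz e₁ P := by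
    refine (sq_eq_sq₀ (mul_pos hE (Real.cosh_pos _)).le hc.le).1 ?_
    rw [mul_pow, Real.cosh_sq]
    linear_combination (Real.exp r * Real.sinh θ - lorentz e₂ P) * hsinh + hr + hqq
  refine ⟨(r, θ), ?_⟩
  rw [hexp, ← hcosh, ← hsinh, hpolar]
  module

theorem IsLorentzFrame.isH2RMotion_hpolar (h : IsLorentzFrame n e₁ e₂) (x d : ℝ × ℝ) :
    IsH2RMotion d.2 (fun t => hpolar e₁ e₂ (x + t • d)) := by
  have h11 := h.ee₁
  have h22 := h.ee₂
  have h12 := h.e₁e₂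
  unfold lorentz at h11 h22 h12
  have hcs := Real.cosh_sq x.2
  refine ⟨d.1, hpolar e₁ e₂ x, Real.exp x.1 • (Real.cosh x.2 • e₂ + Real.sinh x.2 • e₁),
    h.hpolar_mem_domain x, ?_, ?_, ?_⟩
  · simp [hpolar]
    linear_combination (Real.exp x.1 ^ 2 * Real.cosh x.2 * Real.sinh x.2) * (h11 + h22) +
      (Real.exp x.1 ^ 2) * (Real.cosh x.2 ^ 2 + Real.sinh x.2 ^ 2) * h12
  · simp [hpolar]
    linear_combination -(Real.exp x.1 ^ 2 * (Real.cosh x.2 ^ 2 + Real.sinh x.2 ^ 2)) * (h22 + h11) -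
      4 * (Real.exp x.1 ^ 2) * (Real.cosh x.2 * Real.sinh x.2) * h12
  · intro t
    simp only [hpolar, Prod.fst_add, Prod.snd_add, Prod.smul_fst, Prod.smul_snd, smul_eq_mul,
      Real.exp_add, Real.cosh_add, Real.sinh_add, mul_comm t]
    module

/-- The argument of `IsFrame.exists_eq_polar` with hyperbolic functions. Here the determinant is a
value of `sinh` and vanishes only at 0, so distinct parameters suffice. -/
theorem IsLorentzFrame.exists_eq_hpolar (h : IsLorentzFrame n e₁ e₂) {a : ℝ} {γ : ℝ → Triple}
    (hγ : IsH2RMotion a γ) {t₁ t₂ : ℝ} (ht : t₁ ≠ t₂)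
    (h₁ : n ⬝ᵥ γ t₁ = 0) (h₂ : n ⬝ᵥ γ t₂ = 0) :
    ∃ x d, ∀ t, γ t = hpolar e₁ e₂ (x + t • d) := by
  obtain ⟨b, p, w, hp, hpw, hw, hγ⟩ := hγ
  by_cases ha : a = 0
  · subst ha
    rw [hγ] at h₁
    obtain ⟨x, hx⟩ := h.exists_hpolar_eq (P := p) (by simpa using h₁) hp
    refine ⟨x, (b, 0), fun t => ?_⟩
    rw [hγ, hx]
    simp only [hpolar, Prod.fst_add, Prod.snd_add, Prod.smul_fst, Prod.smul_snd, smul_eq_mul,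
      Real.exp_add, mul_comm t, zero_mul, Real.cosh_zero, Real.sinh_zero, add_zero]
    module
  rw [hγ, dotProduct_smul, dotProduct_add, dotProduct_smul, dotProduct_smul] at h₁ h₂
  simp only [smul_eq_mul, mul_eq_zero, (Real.exp_pos _).ne', false_or] at h₁ h₂
  have hs : Real.sinh (a * t₁ - a * t₂) ≠ 0 := by
    rw [Ne, Real.sinh_eq_zero, ← mul_sub, mul_eq_zero, sub_eq_zero]
    tauto
  rw [Real.sinh_sub] at hs
  have hnp : n ⬝ᵥ p = 0 := by
    refine (mul_eq_zero.1 ?_).resolve_left hs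
    linear_combination Real.sinh (a * t₁) * h₂ - Real.sinh (a * t₂) * h₁
  have hnw : n ⬝ᵥ w = 0 := by
    refine (mul_eq_zero.1 ?_).resolve_left hs
    linear_combination Real.cosh (a * t₂) * h₁ - Real.cosh (a * t₁) * h₂
  obtain ⟨x, rfl⟩ := h.exists_hpolar_eq hnp hp
  have hw' := h.expand hnw
  have hcs := Real.cosh_sq x.2
  have e1 : Real.cosh x.2 * lorentz e₁ w + Real.sinh x.2 * lorentz e₂ w = 0 := by
    have hpw' : lorentz (hpolar e₁ e₂ x) w = 0 := hpw
    rw [hpolar, lorentz_smul_left, lorentz_add_left, lorentz_smul_left, lorentz_smul_left] at hpw'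
    simpa using hpw'
  have e2 : lorentz e₂ w ^ 2 - lorentz e₁ w ^ 2 = Real.exp x.1 ^ 2 := by
    have h3 : lorentz w w = lorentz e₁ w ^ 2 - lorentz e₂ w ^ 2 := by
      nth_rewrite 1 [hw']
      rw [lorentz_add_left, lorentz_smul_left, lorentz_smul_left]
      ring
    have h4 := h.lorentz_hpolar_self x
    unfold lorentz at h3 h4 ⊢
    linarith
  set u := lorentz e₁ w
  set v := lorentz e₂ w
  set σ := -(Real.cosh x.2 * v + Real.sinh x.2 * u) / Real.exp x.1 with hσ
  have hE := (Real.exp_pos x.1).ne'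
  have hσE : σ * Real.exp x.1 = -(Real.cosh x.2 * v + Real.sinh x.2 * u) := by
    rw [hσ]; field_simp
  have hσ2 : σ ^ 2 = 1 := by
    have : Real.exp x.1 ^ 2 * σ ^ 2 = Real.exp x.1 ^ 2 * 1 := by
      rw [← mul_pow, mul_comm, hσE, mul_one, ← e2]
      linear_combination (v ^ 2 - u ^ 2) * hcs +
        (Real.cosh x.2 * u + Real.sinh x.2 * v) * e1
    exact mul_left_cancel₀ (pow_ne_zero 2 hE) this
  have hw1 : u = σ * Real.exp x.1 * Real.sinh x.2 := by
    rw [hσE]; linear_combination -u * hcs + Real.cosh x.2 * e1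
  have hw2 : -v = σ * Real.exp x.1 * Real.cosh x.2 := by
    rw [hσE]; linear_combination v * hcs + Real.sinh x.2 * e1
  refine ⟨x, (b, σ * a), fun t => ?_⟩
  have hσ1 : σ = 1 ∨ σ = -1 := sq_eq_sq_iff_eq_or_eq_neg.1 (by rw [hσ2, one_pow])
  have hcσ : Real.cosh (σ * a * t) = Real.cosh (a * t) := by
    rcases hσ1 with h | h <;> simp [h]
  have hsσ : Real.sinh (σ * a * t) = σ * Real.sinh (a * t) := by
    rcases hσ1 with h | h <;> simp [h]
  rw [hγ, hw', hw1, hw2]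
  simp only [hpolar, Prod.fst_add, Prod.snd_add, Prod.smul_fst, Prod.smul_snd, smul_eq_mul,
    Real.exp_add, Real.cosh_add, Real.sinh_add, mul_comm t, hcσ, hsσ]
  module

end Hyperbolic

/-! ### The hexagon theorem for general type, for `Sol`, and for fibre type in `H² × ℝ`. -/

theorem PappusProperty.mono {P : Type*} {𝒞 : Set P → Prop} {D D' : Set P}
    (h : PappusProperty 𝒞 D) (hD : D' ⊆ D) : PappusProperty 𝒞 D' := by
  rintro a₁ a₂ a₃ b₁ b₂ b₃ m₁ m₂ m₃ ga gb g₁₁ g₃₂ g₂₂ g₁₃ g₃₃ g₂₁ hga hgb hab ha₁ ha₂ ha₃ hb₁ hb₂ hb₃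
  exact h hga hgb hab ⟨hD ha₁.1, ha₁.2⟩ ⟨hD ha₂.1, ha₂.2⟩ ⟨hD ha₃.1, ha₃.2⟩
    ⟨hD hb₁.1, hb₁.2⟩ ⟨hD hb₂.1, hb₂.2⟩ ⟨hD hb₃.1, hb₃.2⟩

theorem pappusProperty_of_isGeneralType {X : ThurstonX} {T : Fin 3 → Triple}
    (hT : IsTranslationTriangle X T) (hG : IsGeneralType X T) (U : Set Triple) :
    PappusProperty (IsSurfaceCurve X T U) (translationSurface X T) :=
  pappus_of_chart (K := ℝ) id
    (fun _ hC _ _ _ _ _ _ _ => hG.exists_plane hC)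
    (fun W hW _ _ _ => Or.inl ⟨hG, W, hW, rfl⟩)
    (fun _ hP => exists_linearIndependent_of_mem_translationSurface hT hG hP)

theorem isSurfaceCurve_iff_of_not_isGeneralType {X : ThurstonX} {T : Fin 3 → Triple}
    (hG : ¬ IsGeneralType X T) {U C : Set Triple} :
    IsSurfaceCurve X T U C ↔ ∃ (γ : ℝ → Triple) (s : ℝ), IsTranslationCurve X γ ∧ γ s ∈ U ∧
      C = γ '' connectedComponentIn (γ ⁻¹' U) s := by
  simp [IsSurfaceCurve, hG]

theorem image_connectedComponentIn_of_forall_mem {γ : ℝ → Triple} {U : Set Triple}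
    (h : ∀ t, γ t ∈ U) (s : ℝ) : γ '' connectedComponentIn (γ ⁻¹' U) s = Set.range γ := by
  have : γ ⁻¹' U = Set.univ := Set.eq_univ_of_forall h
  rw [this, connectedComponentIn_univ, PreconnectedSpace.connectedComponent_eq_univ,
    Set.image_univ]

/-- In `Sol` and in the cover of `SL₂(ℝ)` the curves are the complete translation curves. -/
theorem isSurfaceCurve_univ_iff {X : ThurstonX} (hX : X = .Sol ∨ X = .SL2)
    {T : Fin 3 → Triple} {C : Set Triple} :
    IsSurfaceCurve X T Set.univ C ↔ ∃ γ, IsTranslationCurve X γ ∧ C = Set.range γ := by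
  have hG : ¬ IsGeneralType X T := by
    rintro ⟨h, -⟩
    rcases hX with rfl | rfl <;> simp at h
  rw [isSurfaceCurve_iff_of_not_isGeneralType hG]
  constructor
  · rintro ⟨γ, s, hγ, -, rfl⟩
    exact ⟨γ, hγ, image_connectedComponentIn_of_forall_mem (fun _ => Set.mem_univ _) s⟩
  · rintro ⟨γ, hγ, rfl⟩
    exact ⟨γ, 0, hγ, Set.mem_univ _,
      (image_connectedComponentIn_of_forall_mem (fun _ => Set.mem_univ _) 0).symm⟩

theorem pappusProperty_sol (T : Fin 3 → Triple) :
    PappusProperty (IsSurfaceCurve .Sol T Set.univ) Set.univ := by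
  refine pappus_of_affine_chart solChart ?_ ?_ ?_
  · intro C hC p hp q hq _ _ hpq
    obtain ⟨γ, hγ, rfl⟩ := (isSurfaceCurve_univ_iff (Or.inl rfl)).1 hC
    simpa using hγ.exists_sol_line
  · intro p _ d hd
    obtain ⟨γ, hγ, h⟩ := exists_sol_curve p d hd
    exact (isSurfaceCurve_univ_iff (Or.inl rfl)).2 ⟨γ, hγ, by simp [h]⟩
  · intro p _
    obtain ⟨q, r, h⟩ := exists_sol_triple p
    exact ⟨q, Set.mem_univ _, r, Set.mem_univ _, h⟩

theorem image_line_eq_range {f : ℝ × ℝ → Triple} (x d : ℝ × ℝ) :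
    f '' {y | y ∈ Set.univ ∧ ∃ t : ℝ, y = x + t • d} = Set.range fun t : ℝ => f (x + t • d) := by
  ext P
  constructor
  · rintro ⟨_, ⟨-, t, rfl⟩, rfl⟩
    exact ⟨t, rfl⟩
  · rintro ⟨t, rfl⟩
    exact ⟨_, ⟨Set.mem_univ _, t, rfl⟩, rfl⟩

theorem dotProduct_span_pair {n e₁ e₂ : Triple} (h₁ : n ⬝ᵥ e₁ = 0) (h₂ : n ⬝ᵥ e₂ = 0) (r c s : ℝ) :
    n ⬝ᵥ (r • (c • e₁ + s • e₂)) = 0 := by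
  simp [dotProduct_add, dotProduct_smul, h₁, h₂]

/-- Supplies a point of D, from which a frame of the plane can be built; a hexagon always has a
vertex to offer. -/
theorem PappusProperty.of_forall_mem {P : Type*} {𝒞 : Set P → Prop} {D : Set P}
    (h : ∀ p ∈ D, PappusProperty 𝒞 D) : PappusProperty 𝒞 D := by
  intro a₁ a₂ a₃ b₁ b₂ b₃ m₁ m₂ m₃ ga gb g₁₁ g₃₂ g₂₂ g₁₃ g₃₃ g₂₁ hga hgb hab ha₁
  exact h a₁ ha₁.1 hga hgb hab ha₁

theorem pappusProperty_h2r {T : Fin 3 → Triple} (hT : ¬ LinearIndependent ℝ T) :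
    PappusProperty (IsSurfaceCurve .H2R T ThurstonX.H2R.domain)
      {P | P ∈ ThurstonX.H2R.domain ∧ P ∈ Submodule.span ℝ (Set.range T)} := by
  have hG : ¬ IsGeneralType .H2R T := fun h => hT h.2
  obtain ⟨n, hn, hspan⟩ := exists_normal hT
  refine PappusProperty.of_forall_mem fun A hA => ?_
  obtain ⟨e₁, e₂, h⟩ := exists_lorentzFrame hn (hspan _ hA.2) hA.1
  have hn0 : ∀ x, n ⬝ᵥ hpolar e₁ e₂ x = 0 := fun x => dotProduct_span_pair h.ne₁ h.ne₂ _ _ _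
  -- The property is proved for the whole part of the plane orthogonal to n inside the cone, of
  -- which the span of T may be a smaller piece. Only the vertices of the hexagon are restricted to
  -- D, so passing to a subset is harmless.
  refine PappusProperty.mono (D := hpolar e₁ e₂ '' Set.univ)
    (pappus_of_affine_parametrization (hpolar e₁ e₂) h.hpolar_injective.injOn ?_ ?_ ?_) ?_
  · rintro C hC _ hp _ hq ⟨x, -, rfl⟩ ⟨y, -, rfl⟩ hpq
    obtain ⟨γ, s, ⟨⟨a, hγ⟩, s', hs'⟩, hs, rfl⟩ := (isSurfaceCurve_iff_of_not_isGeneralType hG).1 hC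
    obtain ⟨t₁, -, h₁⟩ := hp
    obtain ⟨t₂, -, h₂⟩ := hq
    obtain ⟨z, d, hz⟩ := h.exists_eq_hpolar hγ (t₁ := t₁) (t₂ := t₂)
      (by rintro rfl; exact hpq (h₁.symm.trans h₂)) (by rw [h₁, hn0]) (by rw [h₂, hn0])
    refine ⟨z, d, ?_, ?_⟩
    · rintro rfl
      exact hs' (by simp [hz])
    · rw [image_line_eq_range, ← funext hz]
      exact image_connectedComponentIn_of_forall_mem (fun t => hz t ▸ h.hpolar_mem_domain _) s
  · intro x _ d hd
    refine (isSurfaceCurve_iff_of_not_isGeneralType hG).2 ⟨fun t => hpolar e₁ e₂ (x + t • d), 0,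
      ⟨⟨d.2, h.isH2RMotion_hpolar x d⟩, 1, fun h1 => hd ?_⟩, h.hpolar_mem_domain _, ?_⟩
    · simpa using h.hpolar_injective h1
    · rw [image_line_eq_range,
        image_connectedComponentIn_of_forall_mem (fun t => h.hpolar_mem_domain _)]
  · intro x _
    exact ⟨_, Set.mem_univ _, _, Set.mem_univ _,
      linearIndependent_of_scaled_axes one_ne_zero one_ne_zero⟩
  · rintro P ⟨hP, hPT⟩
    obtain ⟨x, rfl⟩ := h.exists_hpolar_eq (hspan _ hPT) hP
    exact ⟨x, Set.mem_univ _, rfl⟩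

/-! ### Arcs over an open hemisphere, and fibre type in `S² × ℝ`. -/

section Strip

theorem exists_ne_zero_mem_strip {x d : ℝ} (hx : |x| < Real.pi / 2) :
    ∃ t : ℝ, t ≠ 0 ∧ |x + t * d| < Real.pi / 2 := by
  set t := (Real.pi / 2 - |x|) / 2 / (|d| + 1) with ht
  have hd : 0 < |d| + 1 := by positivity
  have ht0 : 0 < t := div_pos (by linarith) hd
  refine ⟨t, ht0.ne', ?_⟩
  have h1 : t * (|d| + 1) = (Real.pi / 2 - |x|) / 2 := by rw [ht]; field_simp
  calc |x + t * d| ≤ |x| + |t * d| := abs_add_le _ _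
    _ = |x| + t * |d| := by rw [abs_mul, abs_of_pos ht0]
    _ < Real.pi / 2 := by nlinarith

/-- The component of the set where `cos (x + t d)` is positive that contains a point at which
`x + t d` lies between `-π / 2` and `π / 2`. -/
theorem connectedComponentIn_cos_pos {x d s : ℝ} (hs : |x + s * d| < Real.pi / 2) :
    connectedComponentIn {t : ℝ | 0 < Real.cos (x + t * d)} s =
      {t | |x + t * d| < Real.pi / 2} := by
  set S := {t : ℝ | 0 < Real.cos (x + t * d)} with hS
  have hpi := Real.pi_pos
  have hsub : {t | |x + t * d| < Real.pi / 2} ⊆ S := fun t ht =>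
    Real.cos_pos_of_mem_Ioo ⟨(abs_lt.1 ht).1, (abs_lt.1 ht).2⟩
  have hsS : s ∈ S := hsub hs
  apply Set.Subset.antisymm
  · intro t ht
    by_contra hcon
    -- The image of the component is an interval avoiding the zeros of the cosine, so it cannot pass
    -- ±π/2.
    have hpre : IsPreconnected ((fun t => x + t * d) '' connectedComponentIn S s) :=
      isPreconnected_connectedComponentIn.image _ (by fun_prop)
    have hbad : ∀ y, Real.cos y = 0 → y ∉ (fun t => x + t * d) '' connectedComponentIn S s := by
      rintro _ hy ⟨t', ht', rfl⟩
      have h1 : 0 < Real.cos (x + t' * d) := connectedComponentIn_subset S s ht'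
      exact h1.ne' hy
    have hs' := Set.mem_image_of_mem (fun t => x + t * d) (mem_connectedComponentIn hsS)
    have ht' := Set.mem_image_of_mem (fun t => x + t * d) ht
    have hs2 := abs_lt.1 hs
    rcases le_or_gt (Real.pi / 2) (x + t * d) with h | h
    · exact hbad _ Real.cos_pi_div_two (hpre.Icc_subset hs' ht' ⟨hs2.2.le, h⟩)
    · refine hbad (-(Real.pi / 2)) (by simp) (hpre.Icc_subset ht' hs' ⟨?_, hs2.1.le⟩)
      by_contra! h'
      exact hcon (abs_lt.2 ⟨h', h⟩)
  · refine IsPreconnected.subset_connectedComponentIn ?_ hs hsub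
    refine Set.OrdConnected.isPreconnected ⟨fun a ha b hb t ht => ?_⟩
    have ha' := abs_lt.1 (show |x + a * d| < Real.pi / 2 from ha)
    have hb' := abs_lt.1 (show |x + b * d| < Real.pi / 2 from hb)
    show |x + t * d| < Real.pi / 2
    rw [abs_lt]
    rcases le_total 0 d with hd | hd
    · have h1 := mul_le_mul_of_nonneg_right ht.1 hd
      have h2 := mul_le_mul_of_nonneg_right ht.2 hd
      constructor <;> linarith
    · have h1 := mul_le_mul_of_nonpos_right ht.1 hd
      have h2 := mul_le_mul_of_nonpos_right ht.2 hd
      constructor <;> linarith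

/-- On an arc over an open hemisphere a geodesic does not reach antipodal points. -/
theorem IsS2RMotion.sin_ne_zero {a : ℝ} {γ : ℝ → Triple} (hγ : IsS2RMotion a γ) {l : Triple}
    {K : Set ℝ} (hK : IsPreconnected K) (hl : ∀ t ∈ K, 0 < l ⬝ᵥ γ t) {t₁ t₂ : ℝ} (h₁ : t₁ ∈ K)
    (h₂ : t₂ ∈ K) (hne : t₁ ≠ t₂) (ha : a ≠ 0) : Real.sin (a * (t₁ - t₂)) ≠ 0 := by
  intro h0
  obtain ⟨m, hm⟩ := Real.sin_eq_zero_iff.1 h0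
  have hm0 : m ≠ 0 := by
    rintro rfl
    rw [Int.cast_zero, zero_mul, eq_comm, mul_eq_zero, sub_eq_zero] at hm
    tauto
  have hm1 : (1 : ℝ) ≤ |(m : ℝ)| := by exact_mod_cast Int.one_le_abs hm0
  have hmpos : 0 < |(m : ℝ)| := by linarith
  -- The angle between the two parameters is mπ. The fraction 1/|m| of the way is where it has
  -- changed by exactly π; there the product with l has the opposite sign.
  set r := |(m : ℝ)|⁻¹ with hr
  have hr0 : 0 < r := inv_pos.2 hmpos
  have hr1 : r ≤ 1 := inv_le_one_of_one_le₀ hm1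
  have h₃ : t₁ + r * (t₂ - t₁) ∈ K := by
    have hconv : Convex ℝ K := hK.ordConnected.convex
    have := hconv h₁ h₂ (sub_nonneg.2 hr1) hr0.le (by ring)
    convert this using 1
    simp only [smul_eq_mul]; ring
  obtain ⟨b, p, w, -, -, -, hγ⟩ := hγ
  have e1 := hl _ h₁
  have e3 := hl _ h₃
  rw [hγ, dotProduct_smul, smul_eq_mul] at e1 e3
  replace e1 := pos_of_mul_pos_right e1 (Real.exp_pos _).le
  replace e3 := pos_of_mul_pos_right e3 (Real.exp_pos _).le
  have harg : a * (t₁ + r * (t₂ - t₁)) = a * t₁ - r * (m * Real.pi) := by rw [hm]; ring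
  rw [dotProduct_add, dotProduct_smul, dotProduct_smul, smul_eq_mul, smul_eq_mul] at e1 e3
  have hrm : r * m = 1 ∨ r * m = -1 := by
    rcases abs_choice (m : ℝ) with h | h
    · left; rw [hr, h]; exact inv_mul_cancel₀ (by exact_mod_cast hm0)
    · right; rw [hr, h, inv_neg, neg_mul]; rw [inv_mul_cancel₀ (by exact_mod_cast hm0)]
  rcases hrm with h | h
  · rw [harg, ← mul_assoc, h, one_mul, Real.cos_sub_pi, Real.sin_sub_pi] at e3
    linarith
  · rw [harg, ← mul_assoc, h, neg_one_mul, sub_neg_eq_add, Real.cos_add_pi, Real.sin_add_pi] at e3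
    linarith

end Strip

theorem pappusProperty_s2r {T : Fin 3 → Triple} (hT : ¬ LinearIndependent ℝ T) (l : Triple) :
    PappusProperty (IsSurfaceCurve .S2R T {P | 0 < l ⬝ᵥ P})
      {P | 0 < l ⬝ᵥ P ∧ P ∈ Submodule.span ℝ (Set.range T)} := by
  have hG : ¬ IsGeneralType .S2R T := fun h => hT h.2
  obtain ⟨n, hn, hspan⟩ := exists_normal hT
  refine PappusProperty.of_forall_mem fun A hA => ?_
  obtain ⟨r, e₁, e₂, hr, h, hl₁, hl₂⟩ := exists_frame hn (hspan _ hA.2) hA.1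
  have hn0 : ∀ x, (r • n) ⬝ᵥ polar e₁ e₂ x = 0 :=
    fun x => dotProduct_span_pair h.ne₁ h.ne₂ _ _ _
  set R : Set (ℝ × ℝ) := {x | |x.2| < Real.pi / 2} with hR
  have hmem : ∀ x, 0 < l ⬝ᵥ polar e₁ e₂ x ↔ 0 < Real.cos x.2 := by
    intro x
    rw [dot_polar_of_dot_eq_zero hl₂, mul_pos_iff_of_pos_left (Real.exp_pos _),
      mul_pos_iff_of_pos_right hl₁]
  have hRcos : ∀ x ∈ R, 0 < Real.cos x.2 := fun x hx =>
    Real.cos_pos_of_mem_Ioo ⟨(abs_lt.1 hx).1, (abs_lt.1 hx).2⟩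
  have hshift : ∀ x : ℝ × ℝ, 0 < Real.cos x.2 →
      ∃ k : ℤ, (x.1, x.2 + k * (2 * Real.pi)) ∈ R := fun x hx => exists_abs_lt_of_cos_pos hx
  -- In the coordinates of the strip the arcs in the half-space are exactly the pieces of straight
  -- lines in R.
  have hcomp : ∀ (x d : ℝ × ℝ) (s : ℝ), x + s • d ∈ R →
      (fun t : ℝ => polar e₁ e₂ (x + t • d)) ''
        connectedComponentIn ((fun t : ℝ => polar e₁ e₂ (x + t • d)) ⁻¹' {P | 0 < l ⬝ᵥ P}) s =
      polar e₁ e₂ '' {y | y ∈ R ∧ ∃ t : ℝ, y = x + t • d} := by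
    intro x d s hs
    have hpre : (fun t : ℝ => polar e₁ e₂ (x + t • d)) ⁻¹' {P | 0 < l ⬝ᵥ P} =
        {t : ℝ | 0 < Real.cos (x.2 + t * d.2)} := by
      ext t
      exact hmem _
    rw [hpre, connectedComponentIn_cos_pos hs]
    ext P
    constructor
    · rintro ⟨t, ht, rfl⟩
      exact ⟨x + t • d, ⟨ht, t, rfl⟩, rfl⟩
    · rintro ⟨_, ⟨ht, t, rfl⟩, rfl⟩
      exact ⟨t, ht, rfl⟩
  refine PappusProperty.mono (D := polar e₁ e₂ '' R)
    (pappus_of_affine_parametrization (polar e₁ e₂) h.injOn_polar ?_ ?_ ?_) ?_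
  · rintro C hC _ hp _ hq ⟨x, -, rfl⟩ ⟨y, -, rfl⟩ hpq
    obtain ⟨γ, s, ⟨⟨a, hγ⟩, s', hs'⟩, hs, rfl⟩ := (isSurfaceCurve_iff_of_not_isGeneralType hG).1 hC
    obtain ⟨t₁, hK₁, h₁⟩ := hp
    obtain ⟨t₂, hK₂, h₂⟩ := hq
    have hKl : ∀ t ∈ connectedComponentIn (γ ⁻¹' {P | 0 < l ⬝ᵥ P}) s, 0 < l ⬝ᵥ γ t :=
      fun t ht => connectedComponentIn_subset (γ ⁻¹' {P | 0 < l ⬝ᵥ P}) s ht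
    obtain ⟨z, d, hz⟩ := h.exists_eq_polar hγ (t₁ := t₁) (t₂ := t₂)
      (hγ.sin_ne_zero isPreconnected_connectedComponentIn
        hKl hK₁ hK₂
        (by rintro rfl; exact hpq (h₁.symm.trans h₂))) (by rw [h₁, hn0]) (by rw [h₂, hn0])
    have hs2 : 0 < l ⬝ᵥ γ s := hs
    rw [hz, hmem] at hs2
    -- The angle is determined only modulo 2π; the line is moved so that the parameter s falls into
    -- the strip R.
    obtain ⟨k, hk⟩ := hshift _ hs2
    have hz' : γ = fun t => polar e₁ e₂ ((z.1, z.2 + k * (2 * Real.pi)) + t • d) := by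
      ext1 t
      rw [hz, ← polar_add_int_mul_two_pi _ k]
      congr 1
      ext
      · rfl
      · simp; ring
    refine ⟨(z.1, z.2 + k * (2 * Real.pi)), d, ?_, ?_⟩
    · rintro rfl
      exact hs' (by simp [hz])
    · rw [hz']
      refine hcomp _ _ _ ?_
      convert hk using 1
      ext
      · rfl
      · simp; ring
  · intro x hx d hd
    refine (isSurfaceCurve_iff_of_not_isGeneralType hG).2 ⟨fun t => polar e₁ e₂ (x + t • d), 0,
      ⟨⟨d.2, h.isS2RMotion_polar x d⟩, ?_⟩, ?_, ?_⟩
    · obtain ⟨t, ht, htR⟩ := exists_ne_zero_mem_strip (d := d.2) hx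
      refine ⟨t, fun h1 => hd ?_⟩
      have hx0 : x + (0 : ℝ) • d ∈ R := by simpa using hx
      have h2 := h.injOn_polar (show x + t • d ∈ R from htR) hx0 h1
      simpa [ht] using h2
    · refine (hmem _).2 (hRcos _ (by simpa using hx))
    · rw [hcomp x d 0 (by simpa using hx)]
  · intro x hx
    obtain ⟨t, ht, htR⟩ := exists_ne_zero_mem_strip (d := 1) hx
    exact ⟨x + (1, 0), by simpa [hR] using hx, x + (0, t), by simpa [hR] using htR,
      linearIndependent_of_scaled_axes one_ne_zero ht⟩
  · rintro P ⟨hP, hPT⟩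
    obtain ⟨x, rfl⟩ := h.exists_polar_eq (P := P)
      (by rw [smul_dotProduct, hspan _ hPT, smul_zero]) (by rintro rfl; simp at hP)
    obtain ⟨k, hk⟩ := hshift x ((hmem x).1 hP)
    exact ⟨_, hk, polar_add_int_mul_two_pi x k⟩

/-! ### Trigonometric functions with a curvature parameter. -/

section GeneralizedTrigonometry

/-- The solution of `f'' = κ f` with `f 0 = 1` and `f' 0 = 0`. -/
noncomputable def genCos (κ t : ℝ) : ℝ :=
  if κ < 0 then Real.cos (Real.sqrt (-κ) * t) else Real.cosh (Real.sqrt κ * t)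

/-- The solution of `f'' = κ f` with `f 0 = 0` and `f' 0 = 1`. -/
noncomputable def genSin (κ t : ℝ) : ℝ :=
  if κ < 0 then Real.sin (Real.sqrt (-κ) * t) / Real.sqrt (-κ) else
    if κ = 0 then t else Real.sinh (Real.sqrt κ * t) / Real.sqrt κ

variable (κ t : ℝ)

theorem genCos_zero : genCos κ 0 = 1 := by simp [genCos]

theorem genSin_zero : genSin κ 0 = 0 := by simp [genSin]

theorem hasDerivAt_genCos : HasDerivAt (genCos κ) (κ * genSin κ t) t := by
  rcases lt_trichotomy κ 0 with h | h | h
  · have e : genCos κ = fun t => Real.cos (Real.sqrt (-κ) * t) := by ext t; simp [genCos, h]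
    have hs : Real.sqrt (-κ) ^ 2 = -κ := Real.sq_sqrt (by linarith)
    have hs0 : Real.sqrt (-κ) ≠ 0 := (Real.sqrt_pos.2 (by linarith)).ne'
    rw [e]
    refine ((hasDerivAt_id' t).const_mul (Real.sqrt (-κ))).cos.congr_deriv ?_
    simp only [genSin, h, if_true]
    field_simp
    linear_combination -Real.sin (Real.sqrt (-κ) * t) * hs
  · subst h
    have e : genCos 0 = fun _ => 1 := by ext t; simp [genCos]
    rw [e]
    simpa using hasDerivAt_const t (1 : ℝ)
  · have e : genCos κ = fun t => Real.cosh (Real.sqrt κ * t) := by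
      ext t; simp [genCos, h.le.not_gt]
    have hs : Real.sqrt κ ^ 2 = κ := Real.sq_sqrt h.le
    have hs0 : Real.sqrt κ ≠ 0 := (Real.sqrt_pos.2 h).ne'
    rw [e]
    refine ((hasDerivAt_id' t).const_mul (Real.sqrt κ)).cosh.congr_deriv ?_
    simp only [genSin, h.le.not_gt, h.ne', if_false]
    field_simp
    linear_combination Real.sinh (Real.sqrt κ * t) * hs

theorem hasDerivAt_genSin : HasDerivAt (genSin κ) (genCos κ t) t := by
  rcases lt_trichotomy κ 0 with h | h | h
  · have e : genSin κ = fun t => Real.sin (Real.sqrt (-κ) * t) / Real.sqrt (-κ) := by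
      ext t; simp [genSin, h]
    have hs0 : Real.sqrt (-κ) ≠ 0 := (Real.sqrt_pos.2 (by linarith)).ne'
    rw [e]
    refine (((hasDerivAt_id' t).const_mul (Real.sqrt (-κ))).sin.div_const _).congr_deriv ?_
    simp only [genCos, h, if_true]
    field_simp
  · subst h
    have e : genSin 0 = fun t => t := by ext t; simp [genSin]
    rw [e]
    simpa [genCos] using hasDerivAt_id' t
  · have e : genSin κ = fun t => Real.sinh (Real.sqrt κ * t) / Real.sqrt κ := by
      ext t; simp [genSin, h.le.not_gt, h.ne']
    have hs0 : Real.sqrt κ ≠ 0 := (Real.sqrt_pos.2 h).ne'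
    rw [e]
    refine (((hasDerivAt_id' t).const_mul (Real.sqrt κ)).sinh.div_const _).congr_deriv ?_
    simp only [genCos, h.le.not_gt, if_false]
    field_simp

theorem genCos_sq_sub : genCos κ t ^ 2 - κ * genSin κ t ^ 2 = 1 := by
  have h : ∀ t, HasDerivAt (fun t => genCos κ t ^ 2 - κ * genSin κ t ^ 2) 0 t := by
    intro t
    refine (((hasDerivAt_genCos κ t).fun_pow 2).fun_sub
      (((hasDerivAt_genSin κ t).fun_pow 2).const_mul κ)).congr_deriv ?_
    push_cast
    ring
  have := is_const_of_deriv_eq_zero (fun t => (h t).differentiableAt) (fun t => (h t).deriv) t 0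
  simpa [genCos_zero, genSin_zero] using this

theorem neg_of_genSin_eq_zero {κ t : ℝ} (ht : t ≠ 0) (h : genSin κ t = 0) : κ < 0 := by
  by_contra! hκ
  rcases hκ.eq_or_lt with h0 | h0
  · subst h0
    exact ht (by simpa [genSin] using h)
  · have hs0 : Real.sqrt κ ≠ 0 := (Real.sqrt_pos.2 h0).ne'
    simp [genSin, hκ.not_gt, h0.ne', hs0, ht] at h

theorem exists_genSin_ne_zero : ∃ t, genSin κ t ≠ 0 := by
  by_contra! h
  have h1 := hasDerivAt_genSin κ 0
  rw [funext h, genCos_zero] at h1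
  exact zero_ne_one ((hasDerivAt_const (0 : ℝ) (0 : ℝ)).unique h1)

end GeneralizedTrigonometry

/-! ### Invariant vector fields on `SL₂(ℝ)`. -/

section Field

/-- The invariant vector field on `SL₂(ℝ)` with value `(0, u)` at the origin. -/
def sl2Field (u : Triple) : (Fin 4 → ℝ) →ₗ[ℝ] (Fin 4 → ℝ) where
  toFun x := ![-u 0 * x 1 + u 1 * x 2 + u 2 * x 3, u 0 * x 0 + u 1 * x 3 - u 2 * x 2,
    u 0 * x 3 + u 1 * x 0 - u 2 * x 1, -u 0 * x 2 + u 1 * x 1 + u 2 * x 0]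
  map_add' x y := by ext i; fin_cases i <;> simp <;> ring
  map_smul' c x := by ext i; fin_cases i <;> simp <;> ring

theorem sl2Field_apply (u : Triple) (x : Fin 4 → ℝ) :
    sl2Field u x = ![-u 0 * x 1 + u 1 * x 2 + u 2 * x 3, u 0 * x 0 + u 1 * x 3 - u 2 * x 2,
      u 0 * x 3 + u 1 * x 0 - u 2 * x 1, -u 0 * x 2 + u 1 * x 1 + u 2 * x 0] := rfl

theorem vecMul_sl2Translation (u : Triple) (x : Fin 4 → ℝ) :
    ![0, u 0, u 1, u 2] ᵥ* sl2Translation x = sl2Field u x := by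
  ext i
  fin_cases i <;>
    simp [sl2Field_apply, sl2Translation, Matrix.vecMul, dotProduct, Fin.sum_univ_four] <;> ring

/-- The negative of the square of the length of a tangent vector. -/
def sl2Norm (u : Triple) : ℝ := u 1 ^ 2 + u 2 ^ 2 - u 0 ^ 2

/-- A trace-free matrix squares to a scalar. Hence every orbit of the field stays in the plane
spanned by its starting point and its initial velocity. -/
theorem sl2Field_sl2Field (u : Triple) (x : Fin 4 → ℝ) :
    sl2Field u (sl2Field u x) = sl2Norm u • x := by
  ext i
  fin_cases i <;> simp [sl2Field_apply, sl2Norm] <;> ring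

theorem sl2Field_smul_left (c : ℝ) (u : Triple) (x : Fin 4 → ℝ) :
    sl2Field (c • u) x = c • sl2Field u x := by
  ext i
  fin_cases i <;> simp [sl2Field_apply] <;> ring

theorem sl2Field_sub_left (u v : Triple) (x : Fin 4 → ℝ) :
    sl2Field (u - v) x = sl2Field u x - sl2Field v x := by
  ext i
  fin_cases i <;> simp [sl2Field_apply] <;> ring

/-- The quadratic form of the hyperboloid, polarized. -/
def sl2Form (x y : Fin 4 → ℝ) : ℝ := x 0 * y 0 + x 1 * y 1 - x 2 * y 2 - x 3 * y 3

theorem sl2Form_self_cover (P : Triple) : sl2Form (sl2Cover P) (sl2Cover P) = 1 := by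
  have h := Real.sin_sq_add_cos_sq (P 0)
  have hs := Real.sq_sqrt (show 0 ≤ 1 + P 1 ^ 2 + P 2 ^ 2 by positivity)
  simp [sl2Form, sl2Cover]
  linear_combination (Real.sqrt (1 + P 1 ^ 2 + P 2 ^ 2)) ^ 2 * h + hs

theorem sl2Form_sl2Field (u : Triple) (x : Fin 4 → ℝ) : sl2Form x (sl2Field u x) = 0 := by
  simp [sl2Form, sl2Field_apply]; ring

theorem sl2Form_sl2Field_sl2Field (u v : Triple) (x : Fin 4 → ℝ) :
    sl2Form (sl2Field u x) (sl2Field v x) =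
      (u 0 * v 0 - u 1 * v 1 - u 2 * v 2) * sl2Form x x := by
  simp [sl2Form, sl2Field_apply]; ring

/-- On the hyperboloid the products of field values reproduce the nondegenerate form on the tangent
space at the origin. -/
theorem eq_zero_of_sl2Field_eq_zero {u P : Triple} (h : sl2Field u (sl2Cover P) = 0) : u = 0 := by
  have key : ∀ v : Triple, u 0 * v 0 - u 1 * v 1 - u 2 * v 2 = 0 := by
    intro v
    have h1 := sl2Form_sl2Field_sl2Field u v (sl2Cover P)
    rw [h, sl2Form_self_cover, mul_one] at h1
    rw [← h1]
    simp [sl2Form]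
  ext i
  fin_cases i
  · simpa using key ![1, 0, 0]
  · simpa using key ![0, 1, 0]
  · simpa using key ![0, 0, 1]

theorem sl2Cover_ne_zero (P : Triple) : sl2Cover P ≠ 0 := by
  intro h
  have := sl2Form_self_cover P
  rw [h] at this
  simp [sl2Form] at this

theorem linearIndependent_cover_field {u : Triple} (hu : u ≠ 0) (P : Triple) :
    LinearIndependent ℝ ![sl2Cover P, sl2Field u (sl2Cover P)] := by
  rw [LinearIndependent.pair_iff' (sl2Cover_ne_zero P)]
  intro c hc
  have h1 := sl2Form_sl2Field u (sl2Cover P)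
  have h2 : sl2Form (sl2Cover P) (c • sl2Cover P) = c * sl2Form (sl2Cover P) (sl2Cover P) := by
    simp [sl2Form]; ring
  rw [← hc, h2, sl2Form_self_cover, mul_one] at h1
  rw [h1, zero_smul] at hc
  exact hu (eq_zero_of_sl2Field_eq_zero hc.symm)

end Field

/-! ### Motions in the universal cover and the planes of `ℝ⁴` containing their images. -/

section Lift

/-- The values are multiples of 2π; a nonzero one would force |g| to take the value π. This gives
uniqueness of lifts in `eq_of_sl2Cover_eq`. -/
theorem eq_zero_of_cos_eq_one {g : ℝ → ℝ} (hg : Continuous g) (h : ∀ t, Real.cos (g t) = 1)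
    (h0 : g 0 = 0) (t : ℝ) : g t = 0 := by
  by_contra ht
  have hpi := Real.pi_pos
  obtain ⟨n, hn⟩ := (Real.cos_eq_one_iff _).1 (h t)
  have hn0 : n ≠ 0 := by
    rintro rfl
    exact ht (by simpa using hn.symm)
  have hn1 : (1 : ℝ) ≤ |(n : ℝ)| := by exact_mod_cast Int.one_le_abs hn0
  have habs : Real.pi ≤ |g t| := by
    rw [← hn, abs_mul, abs_of_pos (show 0 < 2 * Real.pi by positivity)]
    nlinarith
  obtain ⟨s, hs⟩ := mem_range_of_exists_le_of_exists_ge hg.abs ⟨0, by simpa [h0] using hpi.le⟩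
    ⟨t, habs⟩
  have h1 := h s
  rw [← Real.cos_abs, show |g s| = Real.pi from hs, Real.cos_pi] at h1
  norm_num at h1

theorem cos_sub_of_sl2Cover_eq {P Q : Triple} {c : ℝ} (h : sl2Cover Q = c • sl2Cover P)
    (hc : c ^ 2 = 1) : Real.cos (Q 0 - P 0) = c := by
  have h0 := congrFun h 0
  have h1 := congrFun h 1
  have h2 := congrFun h 2
  have h3 := congrFun h 3
  simp [sl2Cover] at h0 h1 h2 h3
  have hN : 1 + Q 1 ^ 2 + Q 2 ^ 2 = 1 + P 1 ^ 2 + P 2 ^ 2 := by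
    rw [h2, h3]; linear_combination (P 1 ^ 2 + P 2 ^ 2) * hc
  have hs : Real.sqrt (1 + P 1 ^ 2 + P 2 ^ 2) ≠ 0 := by positivity
  rw [hN, mul_left_comm] at h0 h1
  rw [Real.cos_sub, mul_left_cancel₀ hs h0, mul_left_cancel₀ hs h1]
  linear_combination c * Real.sin_sq_add_cos_sq (P 0)

theorem eq_of_sl2Cover_eq {γ δ : ℝ → Triple} (hγ : Continuous γ) (hδ : Continuous δ)
    (h : ∀ t, sl2Cover (γ t) = sl2Cover (δ t)) (h0 : γ 0 = δ 0) : γ = δ := by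
  have hcos : ∀ t, Real.cos (γ t 0 - δ t 0) = 1 := fun t =>
    cos_sub_of_sl2Cover_eq (by rw [h, one_smul]) (one_pow 2)
  have hzero := eq_zero_of_cos_eq_one (g := fun t => γ t 0 - δ t 0) (by fun_prop) hcos
    (by simp [h0])
  ext t i
  fin_cases i
  · exact sub_eq_zero.1 (hzero t)
  · simpa [sl2Cover] using congrFun (h t) 2
  · simpa [sl2Cover] using congrFun (h t) 3

/-- `δ` is the translation motion in the cover of `SL₂(ℝ)` with start `P` and initial
velocity `u`. -/
structure IsSL2Motion (P u : Triple) (δ : ℝ → Triple) : Prop where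
  continuous : Continuous δ
  zero : δ 0 = P
  hasDerivAt : ∀ t, HasDerivAt (fun s => sl2Cover (δ s)) (sl2Field u (sl2Cover (δ t))) t

theorem IsSL2Motion.cover_eq {P u : Triple} {δ : ℝ → Triple} (h : IsSL2Motion P u δ) (t : ℝ) :
    sl2Cover (δ t) =
      genCos (sl2Norm u) t • sl2Cover P + genSin (sl2Norm u) t • sl2Field u (sl2Cover P) := by
  set κ := sl2Norm u
  set x := fun t => sl2Cover (δ t) with hx
  have hlin : ∀ t, HasDerivAt (fun t => sl2Field u (x t)) (sl2Field u (sl2Field u (x t))) t :=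
    fun t => ((sl2Field u).toContinuousLinearMap.hasFDerivAt (x := x t)).comp_hasDerivAt t
      (h.hasDerivAt t)
  -- The flow of the field A with A² = κ is `genCos + genSin · A`. Applying the inverse flow to x
  -- gives a constant, and `genCos_sq_sub` inverts this again.
  have hy : ∀ t, HasDerivAt (fun t => genCos κ t • x t - genSin κ t • sl2Field u (x t)) 0 t := by
    intro t
    refine (((hasDerivAt_genCos κ t).fun_smul (h.hasDerivAt t)).fun_sub
      ((hasDerivAt_genSin κ t).fun_smul (hlin t))).congr_deriv ?_
    rw [sl2Field_sl2Field]
    simp only [hx, κ]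
    module
  have hconst := is_const_of_deriv_eq_zero (fun t => (hy t).differentiableAt)
    (fun t => (hy t).deriv) t 0
  simp only [genCos_zero, genSin_zero, one_smul, zero_smul, sub_zero] at hconst
  have hx0 : x 0 = sl2Cover P := by simp only [hx, h.zero]
  rw [hx0] at hconst
  have hcs := genCos_sq_sub κ t
  rw [← hconst, map_sub, map_smul, map_smul, sl2Field_sl2Field]
  have : x t = (genCos κ t ^ 2 - κ * genSin κ t ^ 2) • x t := by rw [hcs, one_smul]
  change x t = _
  nth_rewrite 1 [this]
  simp only [κ]
  module

theorem IsSL2Motion.unique {P u : Triple} {δ δ' : ℝ → Triple} (h : IsSL2Motion P u δ)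
    (h' : IsSL2Motion P u δ') : δ = δ' :=
  eq_of_sl2Cover_eq h.continuous h'.continuous (fun t => by rw [h.cover_eq, h'.cover_eq])
    (h.zero.trans h'.zero.symm)

theorem IsSL2Motion.shift {P u : Triple} {δ : ℝ → Triple} (h : IsSL2Motion P u δ) (s : ℝ) :
    IsSL2Motion (δ s) u (fun t => δ (t + s)) where
  continuous := h.continuous.comp (continuous_add_const s)
  zero := by simp
  hasDerivAt t := (h.hasDerivAt (t + s)).comp_add_const t s

theorem IsSL2Motion.scale {P u : Triple} {δ : ℝ → Triple} (h : IsSL2Motion P u δ) (c : ℝ) :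
    IsSL2Motion P (c • u) (fun t => δ (c * t)) where
  continuous := h.continuous.comp (continuous_const_mul c)
  zero := by simp [h.zero]
  hasDerivAt t := by
    have h1 : HasDerivAt (fun t => c * t) c t := by
      simpa using (hasDerivAt_id' t).const_mul c
    rw [sl2Field_smul_left]
    exact (h.hasDerivAt (c * t)).scomp t h1

theorem IsSL2Motion.isTranslationCurve {P u : Triple} {δ : ℝ → Triple} (h : IsSL2Motion P u δ)
    (hu : u ≠ 0) : IsTranslationCurve .SL2 δ := by
  refine ⟨⟨h.continuous, u, fun t => ?_⟩, ?_⟩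
  · rw [vecMul_sl2Translation]
    exact h.hasDerivAt t
  · by_contra! hconst
    have h1 := h.hasDerivAt 0
    simp only [hconst, h.zero] at h1
    exact hu (eq_zero_of_sl2Field_eq_zero (h1.unique (hasDerivAt_const _ _)))

theorem IsTranslationCurve.exists_isSL2Motion {γ : ℝ → Triple} (h : IsTranslationCurve .SL2 γ)
    {P : Triple} (hP : P ∈ Set.range γ) :
    ∃ u δ, u ≠ 0 ∧ IsSL2Motion P u δ ∧ Set.range γ = Set.range δ := by
  obtain ⟨⟨hc, u, hu⟩, t, ht⟩ := h
  obtain ⟨s, rfl⟩ := hP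
  have hγ : IsSL2Motion (γ 0) u γ := ⟨hc, rfl, fun t => by
    rw [← vecMul_sl2Translation]; exact hu t⟩
  refine ⟨u, fun t => γ (t + s), ?_, hγ.shift s, ?_⟩
  · rintro rfl
    refine ht (congrFun (hγ.unique (δ' := fun _ => γ 0) ⟨continuous_const, rfl, fun t => ?_⟩) t)
    have : sl2Field 0 (sl2Cover (γ 0)) = 0 := by
      simpa using sl2Field_smul_left 0 0 (sl2Cover (γ 0))
    rw [this]
    exact hasDerivAt_const _ _
  · exact ((Equiv.addRight s).surjective.range_comp γ).symm

/-- The plane spanned by the image of a translation curve. -/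
theorem IsSL2Motion.cover_mem_span {P u : Triple} {δ : ℝ → Triple} (h : IsSL2Motion P u δ)
    (t : ℝ) : sl2Cover (δ t) ∈ Submodule.span ℝ {sl2Cover P, sl2Field u (sl2Cover P)} := by
  rw [h.cover_eq]
  exact Submodule.mem_span_pair.2 ⟨_, _, rfl⟩

theorem IsSL2Motion.field_mem {P u : Triple} {δ : ℝ → Triple} (h : IsSL2Motion P u δ)
    {W : Submodule ℝ (Fin 4 → ℝ)} (hW : ∀ t, sl2Cover (δ t) ∈ W) :
    sl2Field u (sl2Cover P) ∈ W := by
  obtain ⟨t, ht⟩ := exists_genSin_ne_zero (sl2Norm u)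
  have h0 : sl2Cover P ∈ W := h.zero ▸ hW 0
  have h1 := W.sub_mem (hW t) (W.smul_mem (genCos (sl2Norm u) t) h0)
  rw [h.cover_eq, add_sub_cancel_left] at h1
  exact (W.smul_mem_iff ht).1 h1

/-- Field values are orthogonal to the position vector, which has square 1, so the coefficient of
the position vanishes. -/
theorem exists_eq_smul_of_sl2Field_mem {P u v : Triple} (hv : v ≠ 0)
    (hmem : sl2Field v (sl2Cover P) ∈ Submodule.span ℝ {sl2Cover P, sl2Field u (sl2Cover P)}) :
    ∃ b : ℝ, b ≠ 0 ∧ v = b • u := by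
  obtain ⟨a, b, hab⟩ := Submodule.mem_span_pair.1 hmem
  have ha : a = 0 := by
    have h1 := sl2Form_sl2Field v (sl2Cover P)
    have h2 : sl2Form (sl2Cover P) (a • sl2Cover P + b • sl2Field u (sl2Cover P)) =
        a * sl2Form (sl2Cover P) (sl2Cover P) +
          b * sl2Form (sl2Cover P) (sl2Field u (sl2Cover P)) := by
      simp [sl2Form]; ring
    rw [← hab, h2, sl2Form_self_cover, sl2Form_sl2Field] at h1
    linarith
  have hvb : v = b • u := by
    refine sub_eq_zero.1 (eq_zero_of_sl2Field_eq_zero (P := P) ?_)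
    rw [sl2Field_sub_left, sl2Field_smul_left, ← hab, ha]
    simp
  refine ⟨b, ?_, hvb⟩
  rintro rfl
  exact hv (by simpa using hvb)

/-- The image of a translation curve determines the curve if one of its points is given. -/
theorem IsTranslationCurve.range_eq_of_sl2Cover_mem {γ γ' : ℝ → Triple}
    (h : IsTranslationCurve .SL2 γ) (h' : IsTranslationCurve .SL2 γ')
    {W : Submodule ℝ (Fin 4 → ℝ)} (hW : Module.finrank ℝ W = 2)
    (hγ : ∀ x ∈ Set.range γ, sl2Cover x ∈ W) (hγ' : ∀ x ∈ Set.range γ', sl2Cover x ∈ W)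
    {P : Triple} (hP : P ∈ Set.range γ) (hP' : P ∈ Set.range γ') :
    Set.range γ = Set.range γ' := by
  obtain ⟨u, δ, hu, hδ, e⟩ := h.exists_isSL2Motion hP
  obtain ⟨v, δ', hv, hδ', e'⟩ := h'.exists_isSL2Motion hP'
  rw [e] at hγ ⊢
  rw [e'] at hγ' ⊢
  have hu' := hδ.field_mem (fun t => hγ _ ⟨t, rfl⟩)
  have hv' := hδ'.field_mem (fun t => hγ' _ ⟨t, rfl⟩)
  have hPW : sl2Cover P ∈ W := hδ.zero ▸ hγ _ ⟨0, rfl⟩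
  rw [← span_two_eq hW (linearIndependent_cover_field hu P) hPW hu'] at hv'
  obtain ⟨b, hb, rfl⟩ := exists_eq_smul_of_sl2Field_mem hv hv'
  rw [hδ'.unique (hδ.scale b)]
  exact ((Equiv.mulLeft₀ b hb).surjective.range_comp δ).symm

theorem IsTranslationCurve.exists_sl2_plane {γ : ℝ → Triple} (h : IsTranslationCurve .SL2 γ) :
    ∃ W : Submodule ℝ (Fin 4 → ℝ), Module.finrank ℝ W = 2 ∧
      ∀ x ∈ Set.range γ, sl2Cover x ∈ W := by
  obtain ⟨u, δ, hu, hδ, e⟩ := h.exists_isSL2Motion ⟨0, rfl⟩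
  refine ⟨_, finrank_span_two (linearIndependent_cover_field hu (γ 0)), ?_⟩
  rw [e]
  rintro _ ⟨t, rfl⟩
  exact hδ.cover_mem_span t

theorem exists_continuous_argument {x y : ℝ → ℝ} (hx : Continuous x) (hy : Continuous y)
    (h : ∀ t, x t ^ 2 + y t ^ 2 ≠ 0) {φ : ℝ} (hx0 : x 0 = Real.sqrt (x 0 ^ 2 + y 0 ^ 2) * Real.cos φ)
    (hy0 : y 0 = Real.sqrt (x 0 ^ 2 + y 0 ^ 2) * Real.sin φ) :
    ∃ θ : ℝ → ℝ, Continuous θ ∧ θ 0 = φ ∧ ∀ t,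
      x t = Real.sqrt (x t ^ 2 + y t ^ 2) * Real.cos (θ t) ∧
      y t = Real.sqrt (x t ^ 2 + y t ^ 2) * Real.sin (θ t) := by
  let f : C(ℝ, ℂ) := ⟨fun t => (x t : ℂ) + y t * Complex.I, by fun_prop⟩
  have hpos : ∀ t, 0 < x t ^ 2 + y t ^ 2 := fun t => lt_of_le_of_ne (by positivity) (h t).symm
  set N := Real.sqrt (x 0 ^ 2 + y 0 ^ 2) with hN
  have hN0 : 0 < N := Real.sqrt_pos.2 (hpos 0)
  let e₀ : ℂ := ⟨Real.log N, φ⟩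
  have he : Complex.exp e₀ = f 0 := by
    apply Complex.ext
    · rw [Complex.exp_re]
      simp [e₀, f, Real.exp_log hN0, ← hx0]
    · rw [Complex.exp_im]
      simp [e₀, f, Real.exp_log hN0, ← hy0]
  -- The imaginary part of a lift through the exponential is a continuous argument.
  obtain ⟨F, ⟨hF0, hF⟩, -⟩ := Complex.isCoveringMapOn_exp.existsUnique_continuousMap_lifts f he
    (fun t h0 => h t (by
      have h0' : f t = 0 := h0
      have h1 := congrArg Complex.re h0'
      have h2 := congrArg Complex.im h0'
      simp [f] at h1 h2
      rw [h1, h2]; ring))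
  refine ⟨fun t => (F t).im, by fun_prop, by simp [hF0, e₀], fun t => ?_⟩
  have hFt : Complex.exp (F t) = f t := congrFun hF t
  have h1 := congrArg Complex.re hFt
  have h2 := congrArg Complex.im hFt
  rw [Complex.exp_re] at h1
  rw [Complex.exp_im] at h2
  simp [f] at h1 h2
  have h3 : Real.sqrt (x t ^ 2 + y t ^ 2) = Real.exp (F t).re := by
    rw [← h1, ← h2, Real.sqrt_eq_iff_mul_self_eq (by positivity) (by positivity)]
    linear_combination Real.exp (F t).re ^ 2 * Real.sin_sq_add_cos_sq (F t).im
  rw [h3]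
  exact ⟨h1.symm, h2.symm⟩

theorem exists_isSL2Motion (P u : Triple) : ∃ δ, IsSL2Motion P u δ := by
  set κ := sl2Norm u with hκ
  set x : ℝ → Fin 4 → ℝ := fun t =>
    genCos κ t • sl2Cover P + genSin κ t • sl2Field u (sl2Cover P) with hx
  have hderiv : ∀ t, HasDerivAt x (sl2Field u (x t)) t := by
    intro t
    refine (((hasDerivAt_genCos κ t).smul_const (sl2Cover P)).fun_add
      ((hasDerivAt_genSin κ t).smul_const (sl2Field u (sl2Cover P)))).congr_deriv ?_
    simp only [hx, map_add, map_smul, sl2Field_sl2Field, ← hκ]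
    module
  have hcont : Continuous x := continuous_iff_continuousAt.2 fun t => (hderiv t).continuousAt
  have hform : ∀ t, sl2Form (x t) (x t) = 1 := by
    intro t
    have h1 := sl2Form_self_cover P
    have h2 := sl2Form_sl2Field u (sl2Cover P)
    have h3 := sl2Form_sl2Field_sl2Field u u (sl2Cover P)
    rw [h1] at h3
    have h4 := genCos_sq_sub κ t
    have h5 : sl2Form (x t) (x t) = genCos κ t ^ 2 * sl2Form (sl2Cover P) (sl2Cover P) +
        2 * genCos κ t * genSin κ t * sl2Form (sl2Cover P) (sl2Field u (sl2Cover P)) +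
        genSin κ t ^ 2 * sl2Form (sl2Field u (sl2Cover P)) (sl2Field u (sl2Cover P)) := by
      simp [hx, sl2Form]; ring
    have h6 : κ = u 1 ^ 2 + u 2 ^ 2 - u 0 ^ 2 := rfl
    rw [h5, h1, h2, h3]
    linear_combination h4 + genSin κ t ^ 2 * h6
  have hsq : ∀ t, x t 0 ^ 2 + x t 1 ^ 2 = 1 + x t 2 ^ 2 + x t 3 ^ 2 := by
    intro t
    have := hform t
    unfold sl2Form at this
    linarith
  have hx0 : x 0 = sl2Cover P := by simp [hx, genCos_zero, genSin_zero]
  obtain ⟨θ, hθ, hθ0, h⟩ := exists_continuous_argument (x := fun t => x t 0) (y := fun t => x t 1)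
    (φ := P 0) (by fun_prop) (by fun_prop)
    (fun t => by simp only [hsq]; positivity)
    (by simp only [hsq]; rw [hx0]; simp [sl2Cover]) (by simp only [hsq]; rw [hx0]; simp [sl2Cover])
  have hcov : ∀ t, sl2Cover ![θ t, x t 2, x t 3] = x t := by
    intro t
    have h1 := h t
    simp only [hsq] at h1
    ext i
    fin_cases i
    · simpa [sl2Cover] using h1.1.symm
    · simpa [sl2Cover] using h1.2.symm
    · simp [sl2Cover]
    · simp [sl2Cover]
  refine ⟨fun t => ![θ t, x t 2, x t 3], ?_, ?_, fun t => ?_⟩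
  · refine continuous_pi fun i => ?_
    fin_cases i <;> simp <;> fun_prop
  · ext i
    fin_cases i <;> simp [hθ0, hx0, sl2Cover]
  · simp only [hcov]
    exact hderiv t

end Lift

/-! ### The centre of the cover and elliptic translation curves. -/

section Elliptic

/-- The action of the `k`-th power of a generator of the centre of the cover of `SL₂(ℝ)`. -/
noncomputable def sl2Deck (k : ℤ) (P : Triple) : Triple :=
  ![P 0 + k * Real.pi, (-1) ^ k * P 1, (-1) ^ k * P 2]

theorem neg_one_zpow_sq (k : ℤ) : ((-1 : ℝ) ^ k) ^ 2 = 1 := by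
  rw [← zpow_natCast, ← zpow_mul, mul_comm, zpow_mul]
  norm_num

theorem sl2Cover_deck (k : ℤ) (P : Triple) :
    sl2Cover (sl2Deck k P) = (-1 : ℝ) ^ k • sl2Cover P := by
  have hk := neg_one_zpow_sq k
  have hN : 1 + ((-1 : ℝ) ^ k * P 1) ^ 2 + ((-1) ^ k * P 2) ^ 2 = 1 + P 1 ^ 2 + P 2 ^ 2 := by
    linear_combination (P 1 ^ 2 + P 2 ^ 2) * hk
  ext i
  fin_cases i
  · simp [sl2Cover, sl2Deck, hN, Real.cos_add_int_mul_pi]; ring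
  · simp [sl2Cover, sl2Deck, hN, Real.sin_add_int_mul_pi]; ring
  · simp [sl2Cover, sl2Deck]
  · simp [sl2Cover, sl2Deck]

theorem sl2Deck_deck (k l : ℤ) (P : Triple) : sl2Deck k (sl2Deck l P) = sl2Deck (k + l) P := by
  have h : (-1 : ℝ) ^ (k + l) = (-1) ^ k * (-1) ^ l := zpow_add₀ (by norm_num) k l
  ext i
  fin_cases i <;> simp [sl2Deck, h] <;> ring

theorem sl2Deck_zero (P : Triple) : sl2Deck 0 P = P := by
  ext i
  fin_cases i <;> simp [sl2Deck]

theorem continuous_sl2Deck (k : ℤ) : Continuous (sl2Deck k) := by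
  unfold sl2Deck
  refine continuous_pi fun i => ?_
  fin_cases i <;> simp <;> fun_prop

theorem sq_eq_one_of_sl2Cover_eq {P Q : Triple} {c : ℝ} (h : sl2Cover Q = c • sl2Cover P) :
    c ^ 2 = 1 := by
  have h1 := sl2Form_self_cover Q
  have h2 : sl2Form (c • sl2Cover P) (c • sl2Cover P) =
      c ^ 2 * sl2Form (sl2Cover P) (sl2Cover P) := by
    simp [sl2Form]; ring
  rwa [h, h2, sl2Form_self_cover, mul_one] at h1

/-- Both images lie on the hyperboloid, so c = ±1, and the angles differ by a multiple of π of
matching parity. -/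
theorem exists_eq_sl2Deck {P Q : Triple} {c : ℝ} (h : sl2Cover Q = c • sl2Cover P) :
    ∃ k : ℤ, Q = sl2Deck k P := by
  have hc := sq_eq_one_of_sl2Cover_eq h
  have hcos := cos_sub_of_sl2Cover_eq h hc
  obtain ⟨k, hk, hkc⟩ : ∃ k : ℤ, Q 0 - P 0 = k * Real.pi ∧ (-1 : ℝ) ^ k = c := by
    rcases (sq_eq_sq_iff_eq_or_eq_neg.1 (by rw [hc, one_pow]) : c = 1 ∨ c = -1) with rfl | rfl
    · obtain ⟨n, hn⟩ := (Real.cos_eq_one_iff _).1 hcos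
      refine ⟨2 * n, by rw [← hn]; push_cast; ring, ?_⟩
      rw [zpow_mul]; norm_num
    · obtain ⟨n, hn⟩ := Real.cos_eq_neg_one_iff.1 hcos
      refine ⟨1 + 2 * n, by rw [← hn]; push_cast; ring, ?_⟩
      rw [zpow_add₀ (by norm_num), zpow_mul]; norm_num
  refine ⟨k, ?_⟩
  have h2 := congrFun h 2
  have h3 := congrFun h 3
  simp [sl2Cover] at h2 h3
  ext i
  fin_cases i
  · simp [sl2Deck, ← hk]
  · simp [sl2Deck, hkc, h2]
  · simp [sl2Deck, hkc, h3]

theorem IsSL2Motion.deck {P u : Triple} {δ : ℝ → Triple} (h : IsSL2Motion P u δ) (k : ℤ) :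
    IsSL2Motion (sl2Deck k P) u (fun t => sl2Deck k (δ t)) where
  continuous := (continuous_sl2Deck k).comp h.continuous
  zero := by rw [h.zero]
  hasDerivAt t := by
    simp only [sl2Cover_deck, map_smul]
    exact (h.hasDerivAt t).fun_const_smul _

/-- For an elliptic direction the angle changes monotonically. -/
theorem angular_velocity_ne_zero {u : Triple} (hu : sl2Norm u < 0) (P : Triple) :
    sl2Cover P 0 * sl2Field u (sl2Cover P) 1 - sl2Cover P 1 * sl2Field u (sl2Cover P) 0 ≠ 0 := by
  set x := sl2Cover P
  intro h
  have hform : sl2Form x x = 1 := sl2Form_self_cover P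
  unfold sl2Form at hform
  unfold sl2Norm at hu
  simp [sl2Field_apply] at h
  set A := x 0 ^ 2 + x 1 ^ 2 with hA
  have hA1 : 1 ≤ A := by nlinarith [sq_nonneg (x 2), sq_nonneg (x 3)]
  have h1 : u 0 * A = u 2 * (x 0 * x 2 + x 1 * x 3) - u 1 * (x 0 * x 3 - x 1 * x 2) := by
    rw [hA]; linear_combination h
  have h2 : (x 0 * x 2 + x 1 * x 3) ^ 2 + (x 0 * x 3 - x 1 * x 2) ^ 2 = A * (A - 1) := by
    have : x 2 ^ 2 + x 3 ^ 2 = A - 1 := by rw [hA]; linarith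
    rw [← this, hA]; ring
  set p := x 0 * x 2 + x 1 * x 3
  set q := x 0 * x 3 - x 1 * x 2
  -- Cauchy–Schwarz. For an elliptic u the right side is at most u₀²A(A − 1), which is less than
  -- u₀²A².
  have h3 : (u 0 * A) ^ 2 ≤ (u 1 ^ 2 + u 2 ^ 2) * (A * (A - 1)) := by
    rw [h1, ← h2]
    nlinarith [sq_nonneg (u 2 * q + u 1 * p)]
  have h4 : (u 1 ^ 2 + u 2 ^ 2) * (A * (A - 1)) ≤ u 0 ^ 2 * (A * (A - 1)) :=
    mul_le_mul_of_nonneg_right (by linarith) (mul_nonneg (by linarith) (by linarith))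
  have h5 : 0 < u 0 ^ 2 := by nlinarith [sq_nonneg (u 1), sq_nonneg (u 2)]
  nlinarith [mul_pos h5 (show 0 < A by linarith)]

/-- After half a period, an elliptic translation motion reaches the image of its start under a
generator of the centre. -/
theorem IsSL2Motion.exists_half_period {P u : Triple} {δ : ℝ → Triple} (h : IsSL2Motion P u δ)
    (hu : sl2Norm u < 0) : ∃ (T : ℝ) (e : ℤ), e * e = 1 ∧ δ T = sl2Deck e P := by
  set κ := sl2Norm u
  have hω : 0 < Real.sqrt (-κ) := Real.sqrt_pos.2 (by linarith)
  set ω := Real.sqrt (-κ) with hωdef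
  have hpi := Real.pi_pos
  have hT : 0 < Real.pi / ω := by positivity
  set T := Real.pi / ω with hTdef
  have hωT : ω * T = Real.pi := by rw [hTdef]; field_simp
  have hsin : ∀ t ∈ Set.Ioo 0 T, genSin κ t ≠ 0 := by
    intro t ht
    have h1 : ω * t < Real.pi := by
      rw [← hωT]; exact mul_lt_mul_of_pos_left ht.2 hω
    have h2 := Real.sin_pos_of_pos_of_lt_pi (mul_pos hω ht.1) h1
    rw [genSin, if_pos hu, ← hωdef]
    positivity
  set D := sl2Cover P 0 * sl2Field u (sl2Cover P) 1 - sl2Cover P 1 * sl2Field u (sl2Cover P) 0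
    with hD
  have hD0 : D ≠ 0 := angular_velocity_ne_zero hu P
  set g : ℝ → ℝ := fun t => δ t 0 - P 0 with hg
  have hδ := h.continuous
  have hgc : Continuous g := by fun_prop
  have hg0 : g 0 = 0 := by simp [hg, h.zero]
  -- Up to a positive factor the sine of the angle gained is `genSin κ t * D`, without zeros before
  -- time T. So at most the angle π is gained, which leaves only a generator of the centre or its
  -- inverse.
  have hgsin : ∀ t ∈ Set.Ioo 0 T, Real.sin (g t) ≠ 0 := by
    intro t ht h0
    refine mul_ne_zero (hsin t ht) hD0 ?_
    have hcov := h.cover_eq t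
    have h1 : sl2Cover P 0 * sl2Cover (δ t) 1 - sl2Cover P 1 * sl2Cover (δ t) 0 =
        genSin κ t * D := by
      rw [hcov, hD]
      simp only [Pi.add_apply, Pi.smul_apply, smul_eq_mul]
      ring
    rw [← h1]
    simp only [hg, Real.sin_sub] at h0
    simp only [sl2Cover, Matrix.cons_val]
    linear_combination Real.sqrt (1 + P 1 ^ 2 + P 2 ^ 2) *
      Real.sqrt (1 + δ t 1 ^ 2 + δ t 2 ^ 2) * h0
  have hle : |g T| ≤ Real.pi := by
    by_contra! hlt
    obtain ⟨s, hs, hgs⟩ := intermediate_value_Ioo hT.le hgc.abs.continuousOn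
      (show Real.pi ∈ Set.Ioo |g 0| |g T| from ⟨by simpa [hg0] using hpi, hlt⟩)
    have hgs' : |g s| = Real.pi := hgs
    refine hgsin s hs ?_
    rcases abs_choice (g s) with h1 | h1
    · rw [← h1, hgs', Real.sin_pi]
    · rw [show g s = -Real.pi by linarith, Real.sin_neg, Real.sin_pi, neg_zero]
  have hcovT : sl2Cover (δ T) = (-1 : ℝ) • sl2Cover P := by
    have hc : genCos κ T = -1 := by rw [genCos, if_pos hu, ← hωdef, hωT, Real.cos_pi]
    have hs : genSin κ T = 0 := by rw [genSin, if_pos hu, ← hωdef, hωT, Real.sin_pi, zero_div]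
    rw [h.cover_eq T]
    change genCos κ T • _ + genSin κ T • _ = _
    rw [hc, hs, zero_smul, add_zero]
  obtain ⟨k, hk⟩ := exists_eq_sl2Deck hcovT
  have hgk : g T = k * Real.pi := by simp [hg, hk, sl2Deck]
  have hk1 : |(k : ℝ)| ≤ 1 := by
    rw [hgk, abs_mul, abs_of_pos hpi] at hle
    exact le_of_mul_le_mul_right (by linarith) hpi
  have hk2 : |k| ≤ 1 := by exact_mod_cast hk1
  have hk0 : k ≠ 0 := by
    rintro rfl
    rw [hk, sl2Deck_zero] at hcovT
    have h1 : (2 : ℝ) • sl2Cover P = 0 := by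
      rw [two_smul]
      nth_rewrite 1 [hcovT]
      simp
    exact sl2Cover_ne_zero P ((smul_eq_zero.1 h1).resolve_left two_ne_zero)
  refine ⟨T, k, ?_, hk⟩
  have := abs_le.1 hk2
  have : k = 1 ∨ k = -1 := by omega
  rcases this with rfl | rfl <;> rfl

/-- An elliptic translation curve contains all points that differ from one of its points by an
element of the centre. -/
theorem IsSL2Motion.mem_range_of_elliptic {P u Q : Triple} {δ : ℝ → Triple}
    (h : IsSL2Motion P u δ) (hu : sl2Norm u < 0) {c : ℝ} (hQ : sl2Cover Q = c • sl2Cover P) :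
    Q ∈ Set.range δ := by
  obtain ⟨T, e, he, hT⟩ := h.exists_half_period hu
  have hper : ∀ t, δ (t + T) = sl2Deck e (δ t) := by
    have h1 := h.shift T
    rw [hT] at h1
    exact congrFun (h1.unique (h.deck e))
  have hmul : ∀ m : ℤ, δ (m * T) = sl2Deck (m * e) P := by
    intro m
    induction m using Int.induction_on with
    | zero => simp [h.zero, sl2Deck_zero]
    | succ i ih =>
      rw [show (((i : ℤ) + 1 : ℤ) : ℝ) * T = ((i : ℤ) : ℝ) * T + T by push_cast; ring, hper, ih,
        sl2Deck_deck]
      congr 1; ring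
    | pred i ih =>
      have h1 := hper (((-(i : ℤ) - 1 : ℤ) : ℝ) * T)
      rw [show ((-(i : ℤ) - 1 : ℤ) : ℝ) * T + T = ((-(i : ℤ) : ℤ) : ℝ) * T by push_cast; ring,
        ih] at h1
      have h2 := congrArg (sl2Deck (-e)) h1
      rw [sl2Deck_deck, sl2Deck_deck, neg_add_cancel, sl2Deck_zero] at h2
      rw [← h2]
      congr 1; ring
  obtain ⟨k, rfl⟩ := exists_eq_sl2Deck hQ
  refine ⟨((k * e : ℤ) : ℝ) * T, ?_⟩
  rw [hmul, mul_assoc, he, mul_one]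

/-- A translation curve through two points that differ by an element of the centre contains all
such points. -/
theorem IsTranslationCurve.mem_range_of_smul {γ : ℝ → Triple} (h : IsTranslationCurve .SL2 γ)
    {P Q R : Triple} (hP : P ∈ Set.range γ) (hQ : Q ∈ Set.range γ) (hPQ : P ≠ Q) {c d : ℝ}
    (hc : sl2Cover Q = c • sl2Cover P) (hd : sl2Cover R = d • sl2Cover P) : R ∈ Set.range γ := by
  obtain ⟨u, δ, hu, hδ, hr⟩ := h.exists_isSL2Motion hP
  rw [hr] at hQ ⊢
  obtain ⟨t, rfl⟩ := hQ
  have ht : t ≠ 0 := by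
    rintro rfl
    exact hPQ hδ.zero.symm
  refine hδ.mem_range_of_elliptic (neg_of_genSin_eq_zero ht ?_) hd
  rw [hδ.cover_eq] at hc
  refine (LinearIndependent.pair_iff.1 (linearIndependent_cover_field hu P)
    (genCos (sl2Norm u) t - c) _ ?_).2
  rw [sub_smul, ← hc]
  abel

/-- Points that differ by an element of the centre lie on two different translation curves. -/
theorem exists_two_curves {P Q : Triple} {c : ℝ} (hc : sl2Cover Q = c • sl2Cover P) :
    ∃ γ δ, IsTranslationCurve .SL2 γ ∧ IsTranslationCurve .SL2 δ ∧ P ∈ Set.range γ ∧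
      Q ∈ Set.range γ ∧ P ∈ Set.range δ ∧ Q ∈ Set.range δ ∧ Set.range γ ≠ Set.range δ := by
  -- Any two elliptic directions that are not proportional would do.
  set u : Triple := ![1, 0, 0] with hu
  set v : Triple := ![2, 1, 0] with hv
  have hu1 : sl2Norm u < 0 := by simp [sl2Norm, hu]
  have hv1 : sl2Norm v < 0 := by simp [sl2Norm, hv]
  have hu0 : u ≠ 0 := fun h => by simpa [hu] using congrFun h 0
  have hv0 : v ≠ 0 := fun h => by simpa [hv] using congrFun h 0
  obtain ⟨γ, hγ⟩ := exists_isSL2Motion P u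
  obtain ⟨δ, hδ⟩ := exists_isSL2Motion P v
  refine ⟨γ, δ, hγ.isTranslationCurve hu0, hδ.isTranslationCurve hv0, ⟨0, hγ.zero⟩,
    hγ.mem_range_of_elliptic hu1 hc, ⟨0, hδ.zero⟩, hδ.mem_range_of_elliptic hv1 hc, fun h => ?_⟩
  have hmem := hδ.field_mem (W := Submodule.span ℝ {sl2Cover P, sl2Field u (sl2Cover P)})
    (fun t => by
      obtain ⟨s, hs⟩ : δ t ∈ Set.range γ := h ▸ ⟨t, rfl⟩
      rw [← hs]
      exact hγ.cover_mem_span s)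
  obtain ⟨b, -, hb⟩ := exists_eq_smul_of_sl2Field_mem hv0 hmem
  have h1 := congrFun hb 1
  simp [hu, hv] at h1

end Elliptic

/-! ### The hexagon theorem in the cover of `SL₂(ℝ)`. -/

section SL2

open Submodule

theorem IsOnlyCurve.linearIndependent_sl2Cover {T : Fin 3 → Triple} {P Q : Triple} {g : Set Triple}
    (h : IsOnlyCurve (IsSurfaceCurve .SL2 T Set.univ) P Q g) :
    LinearIndependent ℝ ![sl2Cover P, sl2Cover Q] ∧
      ∀ x ∈ g, sl2Cover x ∈ span ℝ {sl2Cover P, sl2Cover Q} := by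
  obtain ⟨hg, hP, hQ, huniq⟩ := h
  have hli : LinearIndependent ℝ ![sl2Cover P, sl2Cover Q] := by
    rw [LinearIndependent.pair_iff' (sl2Cover_ne_zero P)]
    intro c hc
    obtain ⟨γ, δ, hγ, hδ, hPγ, hQγ, hPδ, hQδ, hne⟩ := exists_two_curves hc.symm
    exact hne ((huniq _ ((isSurfaceCurve_univ_iff (Or.inr rfl)).2 ⟨γ, hγ, rfl⟩) hPγ hQγ).trans
      (huniq _ ((isSurfaceCurve_univ_iff (Or.inr rfl)).2 ⟨δ, hδ, rfl⟩) hPδ hQδ).symm)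
  refine ⟨hli, ?_⟩
  obtain ⟨γ, hγ, rfl⟩ := (isSurfaceCurve_univ_iff (Or.inr rfl)).1 hg
  obtain ⟨W, hW, hmem⟩ := hγ.exists_sl2_plane
  rwa [span_two_eq hW hli (hmem _ hP) (hmem _ hQ)]

/-- Both curves lie over the same plane and share R, hence coincide. -/
theorem range_eq_of_dependent {P Q R : Triple}
    (hPR : LinearIndependent ℝ ![sl2Cover P, sl2Cover R])
    (hQR : LinearIndependent ℝ ![sl2Cover Q, sl2Cover R])
    (hdep : sl2Cover Q ∈ span ℝ {sl2Cover P, sl2Cover R}) {γ δ : ℝ → Triple}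
    (hγ : IsTranslationCurve .SL2 γ) (hδ : IsTranslationCurve .SL2 δ) (hPγ : P ∈ Set.range γ)
    (hRγ : R ∈ Set.range γ) (hQδ : Q ∈ Set.range δ) (hRδ : R ∈ Set.range δ) :
    Set.range γ = Set.range δ := by
  obtain ⟨W, hW, hmem⟩ := hγ.exists_sl2_plane
  obtain ⟨W', hW', hmem'⟩ := hδ.exists_sl2_plane
  have h1 := span_two_eq hW hPR (hmem _ hPγ) (hmem _ hRγ)
  have h2 := span_two_eq hW' hQR (hmem' _ hQδ) (hmem' _ hRδ)
  rw [h1] at hdep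
  have h3 := span_two_eq hW hQR hdep (hmem _ hRγ)
  rw [← h2, h3] at hmem'
  exact hγ.range_eq_of_sl2Cover_mem hδ hW hmem hmem' hRγ hRδ

theorem exists_common_curve_of_dependent {M₁ M₂ M₃ : Triple}
    (hdep : ¬ LinearIndependent ℝ ![sl2Cover M₁, sl2Cover M₂, sl2Cover M₃])
    {γ₁₂ γ₁₃ γ₂₃ : ℝ → Triple} (h₁₂ : IsTranslationCurve .SL2 γ₁₂)
    (h₁₃ : IsTranslationCurve .SL2 γ₁₃) (h₂₃ : IsTranslationCurve .SL2 γ₂₃)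
    (h₁₂₁ : M₁ ∈ Set.range γ₁₂) (h₁₂₂ : M₂ ∈ Set.range γ₁₂) (h₁₃₁ : M₁ ∈ Set.range γ₁₃)
    (h₁₃₃ : M₃ ∈ Set.range γ₁₃) (h₂₃₂ : M₂ ∈ Set.range γ₂₃) (h₂₃₃ : M₃ ∈ Set.range γ₂₃) :
    ∃ γ, IsTranslationCurve .SL2 γ ∧ M₁ ∈ Set.range γ ∧ M₂ ∈ Set.range γ ∧ M₃ ∈ Set.range γ := by
  have hmem : ∀ {x y z : Fin 4 → ℝ}, LinearIndependent ℝ ![x, y] →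
      ¬ LinearIndependent ℝ ![x, y, z] → z ∈ span ℝ {x, y} := by
    intro x y z h h'
    by_contra hz
    exact h' (linearIndependent_triple.2 ⟨h, hz⟩)
  have hswap : ∀ {x y : Fin 4 → ℝ}, LinearIndependent ℝ ![x, y] → LinearIndependent ℝ ![y, x] :=
    fun h => LinearIndependent.pair_symm_iff.1 h
  have hsmul : ∀ {P Q : Triple}, ¬ LinearIndependent ℝ ![sl2Cover P, sl2Cover Q] →
      ∃ c : ℝ, c ≠ 0 ∧ sl2Cover Q = c • sl2Cover P :=
    fun h => exists_smul_of_not_pair (sl2Cover_ne_zero _) (sl2Cover_ne_zero _) h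
  -- All three images are one projective point. A curve through two different points over it is
  -- elliptic and contains every point over it.
  have hprop : ∀ c d : ℝ, sl2Cover M₂ = c • sl2Cover M₁ → sl2Cover M₃ = d • sl2Cover M₁ →
      ∃ γ, IsTranslationCurve .SL2 γ ∧ M₁ ∈ Set.range γ ∧ M₂ ∈ Set.range γ ∧
        M₃ ∈ Set.range γ := by
    intro c d hc hd
    by_cases heq : M₁ = M₂
    · exact ⟨γ₁₃, h₁₃, h₁₃₁, heq ▸ h₁₃₁, h₁₃₃⟩
    · exact ⟨γ₁₂, h₁₂, h₁₂₁, h₁₂₂, h₁₂.mem_range_of_smul h₁₂₁ h₁₂₂ heq hc hd⟩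
  by_cases l₁₂ : LinearIndependent ℝ ![sl2Cover M₁, sl2Cover M₂]
  · by_cases l₁₃ : LinearIndependent ℝ ![sl2Cover M₁, sl2Cover M₃]
    · have h := range_eq_of_dependent (hswap l₁₂) (hswap l₁₃)
        (Set.pair_comm (sl2Cover M₁) (sl2Cover M₂) ▸ hmem l₁₂ hdep) h₁₂ h₁₃ h₁₂₂ h₁₂₁ h₁₃₃ h₁₃₁
      exact ⟨γ₁₂, h₁₂, h₁₂₁, h₁₂₂, h ▸ h₁₃₃⟩
    · by_cases l₂₃ : LinearIndependent ℝ ![sl2Cover M₂, sl2Cover M₃]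
      · have h := range_eq_of_dependent l₁₂ (hswap l₂₃) (hmem l₁₂ hdep) h₁₂ h₂₃ h₁₂₁ h₁₂₂
          h₂₃₃ h₂₃₂
        exact ⟨γ₁₂, h₁₂, h₁₂₁, h₁₂₂, h ▸ h₂₃₃⟩
      · obtain ⟨c, hc0, hc⟩ := hsmul l₁₃
        obtain ⟨d, hd0, hd⟩ := hsmul l₂₃
        refine hprop (d⁻¹ * c) c ?_ hc
        rw [mul_smul, ← hc, hd, inv_smul_smul₀ hd0]
  · obtain ⟨c, hc0, hc⟩ := hsmul l₁₂
    by_cases l₁₃ : LinearIndependent ℝ ![sl2Cover M₁, sl2Cover M₃]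
    · have l₂₃ : LinearIndependent ℝ ![sl2Cover M₂, sl2Cover M₃] := by
        by_contra hcon
        obtain ⟨d, hd0, hd⟩ := hsmul hcon
        rw [LinearIndependent.pair_iff' (sl2Cover_ne_zero M₁)] at l₁₃
        exact l₁₃ (d * c) (by rw [hd, hc, mul_smul])
      have hM₂ : sl2Cover M₂ ∈ span ℝ {sl2Cover M₁, sl2Cover M₃} :=
        hc ▸ smul_mem _ _ (subset_span (by simp))
      have h := range_eq_of_dependent l₁₃ l₂₃ hM₂ h₁₃ h₂₃ h₁₃₁ h₁₃₃ h₂₃₂ h₂₃₃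
      exact ⟨γ₁₃, h₁₃, h₁₃₁, h ▸ h₂₃₂, h₁₃₃⟩
    · obtain ⟨d, -, hd⟩ := hsmul l₁₃
      exact hprop c d hc hd

theorem pappus_sl2 {T : Fin 3 → Triple} {A₁ A₂ A₃ B₁ B₂ B₃ M₁ M₂ M₃ : Triple}
    {ga gb g₁₁ g₃₂ g₂₂ g₁₃ g₃₃ g₂₁ : Set Triple}
    (hga : IsSurfaceCurve .SL2 T Set.univ ga) (hgb : IsSurfaceCurve .SL2 T Set.univ gb)
    (hab : ga ≠ gb) (hA₁ : A₁ ∈ ga) (hA₂ : A₂ ∈ ga) (hA₃ : A₃ ∈ ga)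
    (hB₁ : B₁ ∈ gb) (hB₂ : B₂ ∈ gb) (hB₃ : B₃ ∈ gb)
    (h₁₁ : IsOnlyCurve (IsSurfaceCurve .SL2 T Set.univ) A₁ B₁ g₁₁)
    (h₃₂ : IsOnlyCurve (IsSurfaceCurve .SL2 T Set.univ) A₃ B₂ g₃₂)
    (h₂₂ : IsOnlyCurve (IsSurfaceCurve .SL2 T Set.univ) A₂ B₂ g₂₂)
    (h₁₃ : IsOnlyCurve (IsSurfaceCurve .SL2 T Set.univ) A₁ B₃ g₁₃)
    (h₃₃ : IsOnlyCurve (IsSurfaceCurve .SL2 T Set.univ) A₃ B₃ g₃₃)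
    (h₂₁ : IsOnlyCurve (IsSurfaceCurve .SL2 T Set.univ) A₂ B₁ g₂₁)
    (hM₁ : M₁ ∈ g₁₁ ∩ g₃₂) (hM₂ : M₂ ∈ g₂₂ ∩ g₁₃) (hM₃ : M₃ ∈ g₃₃ ∩ g₂₁)
    (hM₁₂ : ∃ C, IsSurfaceCurve .SL2 T Set.univ C ∧ M₁ ∈ C ∧ M₂ ∈ C)
    (hM₁₃ : ∃ C, IsSurfaceCurve .SL2 T Set.univ C ∧ M₁ ∈ C ∧ M₃ ∈ C)
    (hM₂₃ : ∃ C, IsSurfaceCurve .SL2 T Set.univ C ∧ M₂ ∈ C ∧ M₃ ∈ C) :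
    ∃ C, IsSurfaceCurve .SL2 T Set.univ C ∧ M₁ ∈ C ∧ M₂ ∈ C ∧ M₃ ∈ C := by
  have hcurve : ∀ {C : Set Triple}, IsSurfaceCurve .SL2 T Set.univ C ↔
      ∃ γ, IsTranslationCurve .SL2 γ ∧ C = Set.range γ := isSurfaceCurve_univ_iff (Or.inr rfl)
  obtain ⟨i₁₁, j₁₁⟩ := h₁₁.linearIndependent_sl2Cover
  obtain ⟨i₃₂, j₃₂⟩ := h₃₂.linearIndependent_sl2Cover
  obtain ⟨i₂₂, j₂₂⟩ := h₂₂.linearIndependent_sl2Cover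
  obtain ⟨i₁₃, j₁₃⟩ := h₁₃.linearIndependent_sl2Cover
  obtain ⟨i₃₃, j₃₃⟩ := h₃₃.linearIndependent_sl2Cover
  obtain ⟨i₂₁, j₂₁⟩ := h₂₁.linearIndependent_sl2Cover
  obtain ⟨α, hα, rfl⟩ := hcurve.1 hga
  obtain ⟨β, hβ, rfl⟩ := hcurve.1 hgb
  obtain ⟨Wa, hWa, ha⟩ := hα.exists_sl2_plane
  obtain ⟨Wb, hWb, hb⟩ := hβ.exists_sl2_plane
  -- Different curves may lie over the same plane. Here the join of A₁ and B₁ would also lie over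
  -- it, and sharing a point with each carrier it would be equal to both.
  have hne : Wa ≠ Wb := by
    rintro rfl
    obtain ⟨γ, hγ, rfl⟩ := hcurve.1 h₁₁.1
    rw [span_two_eq hWa i₁₁ (ha _ hA₁) (hb _ hB₁)] at j₁₁
    exact hab ((hα.range_eq_of_sl2Cover_mem hγ hWa ha j₁₁ hA₁ h₁₁.2.1).trans
      (hβ.range_eq_of_sl2Cover_mem hγ hWa hb j₁₁ hB₁ h₁₁.2.2.1).symm)
  have hdep := pappus hWa hWb hne (ha _ hA₁) (ha _ hA₂) (ha _ hA₃) (hb _ hB₁) (hb _ hB₂) (hb _ hB₃)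
    i₁₁ i₃₂ i₂₂ i₁₃ i₃₃ i₂₁ (j₁₁ _ hM₁.1) (j₃₂ _ hM₁.2) (j₂₂ _ hM₂.1) (j₁₃ _ hM₂.2)
    (j₃₃ _ hM₃.1) (j₂₁ _ hM₃.2)
  obtain ⟨_, c₁₂, p₁₂, q₁₂⟩ := hM₁₂
  obtain ⟨_, c₁₃, p₁₃, q₁₃⟩ := hM₁₃
  obtain ⟨_, c₂₃, p₂₃, q₂₃⟩ := hM₂₃
  obtain ⟨γ₁₂, k₁₂, rfl⟩ := hcurve.1 c₁₂
  obtain ⟨γ₁₃, k₁₃, rfl⟩ := hcurve.1 c₁₃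
  obtain ⟨γ₂₃, k₂₃, rfl⟩ := hcurve.1 c₂₃
  obtain ⟨γ, hγ, h⟩ :=
    exists_common_curve_of_dependent hdep k₁₂ k₁₃ k₂₃ p₁₂ q₁₂ p₁₃ q₁₃ p₂₃ q₂₃
  exact ⟨_, hcurve.2 ⟨γ, hγ, rfl⟩, h⟩

end SL2

/-! ### Assembly of the cases. -/

theorem IsSurfaceCurve.subset_region {X : ThurstonX} {T : Fin 3 → Triple} {U C : Set Triple}
    (hG : ¬ IsGeneralType X T) (h : IsSurfaceCurve X T U C) : C ⊆ U := by
  obtain ⟨γ, s, -, -, rfl⟩ := (isSurfaceCurve_iff_of_not_isGeneralType hG).1 h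
  exact Set.image_subset_iff.2 (connectedComponentIn_subset _ _)

/-- In the geometries other than the cover of `SL₂(ℝ)` the theorem of Pappus holds for the points
of the surface. -/
theorem pappusProperty_translationSurface {X : ThurstonX} (hX : X ≠ .SL2) {T : Fin 3 → Triple}
    (hT : IsTranslationTriangle X T) {U : Set Triple} (hU : IsAdmissibleRegion X T U) :
    PappusProperty (IsSurfaceCurve X T U) (translationSurface X T) := by
  by_cases hG : IsGeneralType X T
  · exact pappusProperty_of_isGeneralType hT hG U
  have hfibre : IsFibreType X T → ∀ P ∈ translationSurface X T,
      P ∈ X.domain ∧ P ∈ Submodule.span ℝ (Set.range T) := by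
    rintro hF P ⟨hP, h | h⟩
    · exact ⟨hP, h.2⟩
    · exact absurd hF h.1
  -- The vertices lie on curves that are contained in U, so restricting them to U loses nothing.
  have hregion : PappusProperty (IsSurfaceCurve X T U) (translationSurface X T ∩ U) →
      PappusProperty (IsSurfaceCurve X T U) (translationSurface X T) := by
    intro h a₁ a₂ a₃ b₁ b₂ b₃ m₁ m₂ m₃ ga gb g₁₁ g₃₂ g₂₂ g₁₃ g₃₃ g₂₁ hga hgb hab ha₁ ha₂ ha₃
      hb₁ hb₂ hb₃
    have ha := hga.subset_region hG
    have hb := hgb.subset_region hG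
    exact h hga hgb hab ⟨⟨ha₁.1, ha ha₁.2⟩, ha₁.2⟩ ⟨⟨ha₂.1, ha ha₂.2⟩, ha₂.2⟩
      ⟨⟨ha₃.1, ha ha₃.2⟩, ha₃.2⟩ ⟨⟨hb₁.1, hb hb₁.2⟩, hb₁.2⟩ ⟨⟨hb₂.1, hb hb₂.2⟩, hb₂.2⟩
      ⟨⟨hb₃.1, hb hb₃.2⟩, hb₃.2⟩
  cases X with
  | SL2 => exact absurd rfl hX
  | Sol =>
    obtain rfl : U = Set.univ := by
      rcases hU with ⟨h, -⟩ | ⟨-, h⟩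
      · simp at h
      · exact h
    exact (pappusProperty_sol T).mono (Set.subset_univ _)
  | H2R =>
    have hli : ¬ LinearIndependent ℝ T := fun h => hG ⟨Or.inr rfl, h⟩
    obtain rfl : U = ThurstonX.H2R.domain := by
      rcases hU with ⟨h, -⟩ | ⟨-, h⟩
      · simp at h
      · exact h
    exact (pappusProperty_h2r hli).mono (hfibre ⟨Or.inr rfl, hli⟩)
  | S2R =>
    have hli : ¬ LinearIndependent ℝ T := fun h => hG ⟨Or.inl rfl, h⟩
    have hF : IsFibreType .S2R T := ⟨Or.inl rfl, hli⟩
    obtain ⟨l, rfl⟩ : ∃ l : Triple, U = {P | 0 < l ⬝ᵥ P} := by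
      rcases hU with ⟨-, -, h⟩ | ⟨h, -⟩
      · exact h
      · exact absurd ⟨rfl, hF⟩ h
    exact hregion ((pappusProperty_s2r hli l).mono fun P hP => ⟨hP.2, (hfibre hF P hP.1).2⟩)

theorem theorem3p3 (X : ThurstonX) (T : Fin 3 → Triple) (hT : IsTranslationTriangle X T)
    (U : Set Triple) (hU : IsAdmissibleRegion X T U)
    (A₁ A₂ A₃ B₁ B₂ B₃ M₁ M₂ M₃ : Triple)
    (ga gb : Set Triple) (hga : IsSurfaceCurve X T U ga) (hgb : IsSurfaceCurve X T U gb)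
    (hab : ga ≠ gb)
    (hA₁ : A₁ ∈ translationSurface X T ∩ ga) (hA₂ : A₂ ∈ translationSurface X T ∩ ga)
    (hA₃ : A₃ ∈ translationSurface X T ∩ ga)
    (hA₁₂ : A₁ ≠ A₂) (hA₁₃ : A₁ ≠ A₃) (hA₂₃ : A₂ ≠ A₃)
    (hB₁ : B₁ ∈ translationSurface X T ∩ gb) (hB₂ : B₂ ∈ translationSurface X T ∩ gb)
    (hB₃ : B₃ ∈ translationSurface X T ∩ gb)
    (hB₁₂ : B₁ ≠ B₂) (hB₁₃ : B₁ ≠ B₃) (hB₂₃ : B₂ ≠ B₃)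
    (g₁₁ g₃₂ g₂₂ g₁₃ g₃₃ g₂₁ : Set Triple)
    (h₁₁ : IsJoin X T U A₁ B₁ g₁₁) (h₃₂ : IsJoin X T U A₃ B₂ g₃₂)
    (h₂₂ : IsJoin X T U A₂ B₂ g₂₂) (h₁₃ : IsJoin X T U A₁ B₃ g₁₃)
    (h₃₃ : IsJoin X T U A₃ B₃ g₃₃) (h₂₁ : IsJoin X T U A₂ B₁ g₂₁)
    (hM₁ : M₁ ∈ g₁₁ ∩ g₃₂) (hM₂ : M₂ ∈ g₂₂ ∩ g₁₃) (hM₃ : M₃ ∈ g₃₃ ∩ g₂₁)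
    (hjoin : X = .SL2 →
      (∃ C, IsSurfaceCurve X T U C ∧ M₁ ∈ C ∧ M₂ ∈ C) ∧
      (∃ C, IsSurfaceCurve X T U C ∧ M₁ ∈ C ∧ M₃ ∈ C) ∧
      (∃ C, IsSurfaceCurve X T U C ∧ M₂ ∈ C ∧ M₃ ∈ C)) :
    ∃ C, IsSurfaceCurve X T U C ∧ M₁ ∈ C ∧ M₂ ∈ C ∧ M₃ ∈ C := by

  by_cases hX : X = .SL2
  · subst hX
    obtain rfl : U = Set.univ := by
      rcases hU with ⟨h, -⟩ | ⟨-, h⟩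
      · simp at h
      · exact h
    obtain ⟨c₁₂, c₁₃, c₂₃⟩ := hjoin rfl
    exact pappus_sl2 hga hgb hab hA₁.2 hA₂.2 hA₃.2 hB₁.2 hB₂.2 hB₃.2 h₁₁ h₃₂ h₂₂ h₁₃ h₃₃ h₂₁
      hM₁ hM₂ hM₃ c₁₂ c₁₃ c₂₃
  · exact pappusProperty_translationSurface hX hT hU hga hgb hab hA₁ hA₂ hA₃ hB₁ hB₂ hB₃ hA₁₂ hB₁₂
      h₁₁ h₃₂ h₂₂ h₁₃ h₃₃ h₂₁ hM₁ hM₂ hM₃
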